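/- Let $\mathcal G$ be a finite graph with vertex set $\mathcal V$, internal edges $\mathcal I$, incoming external edges $\mathcal E_-$ and outgoing external edges $\mathcal E_+$. Each $i\in\mathcal I$ has an initial vertex, a terminal vertex and a length $a_i>0$, and $I_i=(0,a_i)$; each $e\in\mathcal E_-$ has only an initial vertex and $I_e=(0,\infty)$; each $e\in\mathcal E_+$ has only a terminal vertex and $I_e=(-\infty,0)$. For $j\in\mathcal I\cup\mathcal E_-\cup\mathcal E_+$ let $X_j$ be a complex Hilbert space, with $X_j\neq\{0\}$ for at least one $j$, and let $$L^2(\mathcal G,\underline a;\mathcal X)=\bigoplus_j L^2(I_j;X_j),\qquad W^{1,2}(\mathcal G,\underline a;\mathcal X)=\bigoplus_j W^{1,2}(I_j;X_j).$$ Let $\mathcal G$ be balanced, i.e. $|\mathcal E_-|=|\mathcal E_+|$; fix a bijection $p:\mathcal E_+\to\mathcal E_-$ and isometric isomorphisms $X_{e}\cong X_{p(e)}$, $e\in\mathcal E_+$, which are used to identify these spaces. On the Hilbert space $\mathcal K=\bigoplus_{i\in\mathcal I}X_i\oplus\bigoplus_{e\in\mathcal E_-}X_e$ of boundary values put, for $\psi\in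 W^{1,2}(\mathcal G,\underline a;\mathcal X)$, $$\underline\psi_-=\big((\psi_i(0))_{i\in\mathcal I},(\psi_e(0))_{e\in\mathcal E_-}\big),\qquad \underline\psi_+=\big((\psi_i(a_i))_{i\in\mathcal I},(\psi_{p^{-1}(e)}(0))_{e\in\mathcal E_-}\big).$$ For a bounded linear operator $\mathbb B$ on $\mathcal K$ let $D_t(\mathbb B)$ be the operator $\psi\mapsto\psi'$ in $L^2(\mathcal G,\underline a;\mathcal X)$ with domain $\{\psi\in W^{1,2}(\mathcal G,\underline a;\mathcal X):\underline\psi_-=\mathbb B\underline\psi_+\}$. Let $\Sigma_\omega=\{\lambda\in\mathbb C\setminus\{0\}:|\arg\lambda|<\omega\}$. A closed, densely defined operator $A$ in a Banach space is sectorial of angle $\omega\in(0,\pi)$ if $\sigma(A)\subset\overline{\Sigma_\omega}$ and $\sup\{\|\lambda(\lambda-A)^{-1}\|:\lambda\ne0,\ \nu\le|\arg\lambda|\le\pi\}<\infty$ for every $\nu\in(\omega,\pi)$. Let $H_0^\infty(\Sigma_\theta)$ be the set of holomorphic $f:\Sigma_\theta\to\mathbb C$ with $|f(z)|\le C\min(|z|^s,|z|^{-s})$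 for some $C$ and some $s>0$. The operator $A$ has a bounded $H^\infty(\Sigma_\theta)$-calculus, $\theta\in(0,\pi)$, if it is sectorial of some angle $\omega<\theta$ and there is a constant $C$ with $\|f(A)\|\le C\sup_{\Sigma_\theta}|f|$ for all $f\in H_0^\infty(\Sigma_\theta)$, where $f(A)=\frac1{2\pi i}\int_{\partial\Sigma_\nu}f(\lambda)(\lambda-A)^{-1}\,d\lambda$ with $\omega<\nu<\theta$. It has a bounded $H^\infty$-calculus if this holds for some $\theta\in(0,\pi)$, and its $H^\infty$-angle $\phi_A^\infty$ is the infimum of all such $\theta$. If $\mathbb B$ is a contraction, i.e. $\|\mathbb B\|_{\mathcal L(\mathcal K)}\le1$, then $D_t(\mathbb B)$ has a bounded $H^\infty$-calculus on $L^2(\mathcal G,\underline a;\mathcal X)$, and its angle is $\phi^\infty_{D_t(\mathbb B)}=\frac\pi2$. -/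

import Mathlib

open MeasureTheory Set
open scoped ContDiff

noncomputable section

namespace TimeGraph

/-! ### Unbounded operators: resolvent, sectoriality, `H^∞`-calculus -/

section Operators

variable {H : Type*} [NormedAddCommGroup H] [NormedSpace ℂ H]

/-- `R` is a bounded two-sided inverse of `z - A : D(A) → H`. -/
def IsResolventAt (A : H →ₗ.[ℂ] H) (z : ℂ) (R : H →L[ℂ] H) : Prop :=
  (∀ x : H, ∃ h : R x ∈ A.domain, z • R x - A ⟨R x, h⟩ = x) ∧
    ∀ y : A.domain, R (z • (y : H) - A y) = (y : H)

theorem IsResolventAt.unique {A : H →ₗ.[ℂ] H} {z : ℂ} {R S : H →L[ℂ] H}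
    (hR : IsResolventAt A z R) (hS : IsResolventAt A z S) : R = S := by
  ext x
  obtain ⟨h, hx⟩ := hS.1 x
  have := hR.2 ⟨S x, h⟩
  simpa [hx] using this

/-- The resolvent set `ρ(A)`. -/
def resolventSet (A : H →ₗ.[ℂ] H) : Set ℂ := {z | ∃ R, IsResolventAt A z R}

/-- The spectrum `σ(A)`. -/
def spectrum (A : H →ₗ.[ℂ] H) : Set ℂ := (resolventSet A)ᶜ

open Classical in
/-- The resolvent `(z - A)⁻¹` for `z ∈ ρ(A)` (and `0` for `z ∈ σ(A)`). -/
def resolvent (A : H →ₗ.[ℂ] H) (z : ℂ) : H →L[ℂ] H :=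
  if h : z ∈ resolventSet A then h.choose else 0

theorem isResolventAt_resolvent {A : H →ₗ.[ℂ] H} {z : ℂ} (h : z ∈ resolventSet A) :
    IsResolventAt A z (resolvent A z) := by
  rw [resolvent, dif_pos h]
  exact h.choose_spec

/-- The open sector `Σ_α = {λ ≠ 0 : |arg λ| < α}`. -/
def sector (α : ℝ) : Set ℂ := {z | z ≠ 0 ∧ |z.arg| < α}

/-- `A` is sectorial of angle `α ∈ (0, π)`: closed, densely defined, `σ(A) ⊆ closure Σ_α`, and
`λ (λ - A)⁻¹` is uniformly bounded on `ν ≤ |arg λ| ≤ π`, for every `ν ∈ (α, π)`. -/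
structure IsSectorial (A : H →ₗ.[ℂ] H) (α : ℝ) : Prop where
  pos : 0 < α
  lt_pi : α < Real.pi
  closed : A.IsClosed
  dense : Dense (A.domain : Set H)
  spectrum_subset : spectrum A ⊆ closure (sector α)
  bounded : ∀ ν : ℝ, α < ν → ν < Real.pi → ∃ M : ℝ, ∀ z : ℂ, z ≠ 0 → ν ≤ |z.arg| →
    ‖z • resolvent A z‖ ≤ M

/-- The class `H₀^∞(Σ_θ)`: functions holomorphic on `Σ_θ` with
`|f(z)| ≤ C min (|z|^s, |z|^(-s))` there, for some `C` and some `s > 0`. -/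
structure MemHZero (θ : ℝ) (f : ℂ → ℂ) : Prop where
  holo : DifferentiableOn ℂ f (sector θ)
  decay : ∃ C s : ℝ, 0 < s ∧ ∀ z ∈ sector θ, ‖f z‖ ≤ C * min (‖z‖ ^ s) (‖z‖ ^ (-s))

/-- The ray `r ↦ r e^{i ν}`. -/
def ray (ν r : ℝ) : ℂ := (r : ℂ) * Complex.exp ((ν : ℂ) * Complex.I)

/-- The integrand `f(λ) (λ - A)⁻¹ dλ` along the ray `λ = r e^{i ν}`. -/
def rayIntegrand (A : H →ₗ.[ℂ] H) (f : ℂ → ℂ) (ν r : ℝ) : H →L[ℂ] H :=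
  (f (ray ν r) * Complex.exp ((ν : ℂ) * Complex.I)) • resolvent A (ray ν r)

/-- The Dunford integral `f(A) = (2πi)⁻¹ ∫_Γ f(λ) (λ - A)⁻¹ dλ`, where `Γ` is the boundary of
`Σ_ν`, running from `∞ e^{iν}` to `0` and from `0` to `∞ e^{-iν}`. -/
def dunford (A : H →ₗ.[ℂ] H) (f : ℂ → ℂ) (ν : ℝ) : H →L[ℂ] H :=
  (2 * (Real.pi : ℂ) * Complex.I)⁻¹ •
    ((∫ r in Ioi (0 : ℝ), rayIntegrand A f (-ν) r) - ∫ r in Ioi (0 : ℝ), rayIntegrand A f ν r)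

/-- `A` has a bounded `H^∞(Σ_θ)`-calculus: `A` is sectorial of some angle `α < θ < π` and there is
a constant `C` with `‖f(A)‖ ≤ C sup_{Σ_θ} |f|` for all `f ∈ H₀^∞(Σ_θ)`, where `f(A)` is the
(absolutely convergent) Dunford integral over the boundary of `Σ_ν`, `α < ν < θ`. -/
def HasBoundedHInfty (A : H →ₗ.[ℂ] H) (θ : ℝ) : Prop :=
  θ < Real.pi ∧ ∃ α : ℝ, α < θ ∧ IsSectorial A α ∧ ∃ C : ℝ,
    ∀ f : ℂ → ℂ, MemHZero θ f → ∀ ν : ℝ, α < ν → ν < θ →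
      IntegrableOn (rayIntegrand A f ν) (Ioi 0) ∧ IntegrableOn (rayIntegrand A f (-ν)) (Ioi 0) ∧
      ∀ M : ℝ, (∀ z ∈ sector θ, ‖f z‖ ≤ M) → ‖dunford A f ν‖ ≤ C * M

/-- `A` has a bounded `H^∞`-calculus. -/
def HasBoundedHInftyCalculus (A : H →ₗ.[ℂ] H) : Prop := ∃ θ : ℝ, HasBoundedHInfty A θ

/-- The `H^∞`-angle `φ_A^∞`. -/
def hInftyAngle (A : H →ₗ.[ℂ] H) : ℝ := sInf {θ : ℝ | HasBoundedHInfty A θ}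

end Operators

/-! ### First order Sobolev functions of one variable -/

section Sobolev

variable {F : Type*} [NormedAddCommGroup F] [NormedSpace ℝ F]

/-- `g` is the weak derivative of `f` on the open set `s`. -/
def IsWeakDerivOn (s : Set ℝ) (f g : ℝ → F) : Prop :=
  ∀ φ : ℝ → ℝ, ContDiff ℝ ∞ φ → HasCompactSupport φ → tsupport φ ⊆ s →
    ∫ t in s, deriv φ t • f t = -∫ t in s, φ t • g t

/-- `x` is the value at `t₀ ∈ closure s` of the continuous representative of `f` on `closure s`. -/
def IsTraceAt (s : Set ℝ) (f : ℝ → F) (t₀ : ℝ) (x : F) : Prop :=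
  ∃ u : ℝ → F, ContinuousOn u (closure s) ∧ u =ᵐ[volume.restrict s] f ∧ u t₀ = x

theorem integrableOn_test_smul {s : Set ℝ} {φ : ℝ → ℝ} (hφ : Continuous φ)
    (hc : HasCompactSupport φ) {f : ℝ → F} (hf : MemLp f 2 (volume.restrict s)) :
    Integrable (fun t => φ t • f t) (volume.restrict s) := by
  have h1 : MemLp φ 2 (volume.restrict s) := hφ.memLp_of_hasCompactSupport hc
  have h2 : MemLp (φ • f) 1 (volume.restrict s) := hf.smul h1
  exact memLp_one_iff_integrable.1 h2

theorem isWeakDerivOn_add {s : Set ℝ} {f₁ f₂ g₁ g₂ : ℝ → F}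
    (hf₁ : MemLp f₁ 2 (volume.restrict s)) (hf₂ : MemLp f₂ 2 (volume.restrict s))
    (hg₁ : MemLp g₁ 2 (volume.restrict s)) (hg₂ : MemLp g₂ 2 (volume.restrict s))
    (h₁ : IsWeakDerivOn s f₁ g₁) (h₂ : IsWeakDerivOn s f₂ g₂) :
    IsWeakDerivOn s (f₁ + f₂) (g₁ + g₂) := by
  intro φ hφ hc hs
  have hd : Continuous (deriv φ) := hφ.continuous_deriv (by simp)
  have e₁ := h₁ φ hφ hc hs
  have e₂ := h₂ φ hφ hc hs
  simp only [Pi.add_apply, smul_add]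
  rw [integral_add (integrableOn_test_smul hd hc.deriv hf₁)
      (integrableOn_test_smul hd hc.deriv hf₂),
    integral_add (integrableOn_test_smul hφ.continuous hc hg₁)
      (integrableOn_test_smul hφ.continuous hc hg₂), e₁, e₂]
  abel

theorem IsWeakDerivOn.congr {s : Set ℝ} {f f' g g' : ℝ → F} (h : IsWeakDerivOn s f g)
    (hf : f' =ᵐ[volume.restrict s] f) (hg : g' =ᵐ[volume.restrict s] g) :
    IsWeakDerivOn s f' g' := by
  intro φ hφ hc hs
  have e := h φ hφ hc hs
  rw [integral_congr_ae (g := fun t => deriv φ t • f t)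
      (by filter_upwards [hf] with t ht; simp [ht]),
    integral_congr_ae (μ := volume.restrict s) (f := fun t => φ t • g' t)
      (g := fun t => φ t • g t) (by filter_upwards [hg] with t ht; simp [ht]), e]

/-- The weak derivative is unique. -/
theorem IsWeakDerivOn.unique [CompleteSpace F] {s : Set ℝ} (hs : IsOpen s) {f g g' : ℝ → F}
    (hg : MemLp g 2 (volume.restrict s)) (hg' : MemLp g' 2 (volume.restrict s))
    (h : IsWeakDerivOn s f g) (h' : IsWeakDerivOn s f g') : g =ᵐ[volume.restrict s] g' := by
  have hloc : LocallyIntegrableOn (g - g') s := by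
    rw [locallyIntegrableOn_iff hs.isLocallyClosed]
    intro k hk hkc
    have h1 : MemLp (g - g') 2 (volume.restrict k) :=
      (hg.sub hg').mono_measure (Measure.restrict_mono hk le_rfl)
    have : IsFiniteMeasure (volume.restrict k) := ⟨by simpa using hkc.measure_lt_top⟩
    exact h1.integrable (by norm_num)
  have key := hs.ae_eq_zero_of_integral_contDiff_smul_eq_zero hloc (fun φ hφ hc hsupp => by
    have e := h φ hφ hc hsupp
    have e' := h' φ hφ hc hsupp
    have hz : ∫ t in s, φ t • (g - g') t = 0 := by
      simp only [Pi.sub_apply, smul_sub]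
      rw [integral_sub (integrableOn_test_smul hφ.continuous hc hg)
        (integrableOn_test_smul hφ.continuous hc hg')]
      rw [e] at e'
      rw [neg_inj.1 e', sub_self]
    rw [← hz]
    symm
    apply setIntegral_eq_integral_of_forall_compl_eq_zero
    intro t ht
    have : φ t = 0 := by
      by_contra hne
      exact ht (hsupp (subset_tsupport _ hne))
    simp [this])
  rw [Filter.EventuallyEq, ae_restrict_iff' hs.measurableSet]
  filter_upwards [key] with t ht hts
  exact sub_eq_zero.1 (ht hts)

end Sobolev

theorem IsWeakDerivOn.const_smul {F : Type*} [NormedAddCommGroup F] [NormedSpace ℂ F] {s : Set ℝ}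
    {f g : ℝ → F} (h : IsWeakDerivOn s f g) (c : ℂ) : IsWeakDerivOn s (c • f) (c • g) := by
  intro φ hφ hc hs
  have e := h φ hφ hc hs
  simp only [Pi.smul_apply]
  simp_rw [smul_comm _ c]
  rw [integral_smul, integral_smul, e, smul_neg]

/-! ### Metric graphs -/

/-- A metric graph with vertices `V`, internal edges `I`, incoming external edges `Em` (`ℰ₋`) and
outgoing external edges `Ep` (`ℰ₊`): an internal edge has an initial vertex, a terminal vertex and
a length; an incoming edge has an initial vertex only, an outgoing one a terminal vertex only. -/
structure MetricGraph (V I Em Ep : Type*) where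
  init : I → V
  term : I → V
  initExt : Em → V
  termExt : Ep → V
  length : I → ℝ
  length_pos : ∀ i, 0 < length i

/-- The edges `I ∪ ℰ`. -/
abbrev Edge (I Em Ep : Type*) := I ⊕ (Em ⊕ Ep)

namespace Edge

variable {I Em Ep : Type*}

abbrev internal (i : I) : Edge I Em Ep := Sum.inl i
abbrev incoming (e : Em) : Edge I Em Ep := Sum.inr (Sum.inl e)
abbrev outgoing (e : Ep) : Edge I Em Ep := Sum.inr (Sum.inr e)

end Edge

section Graph

variable {V I Em Ep : Type*}

set_option linter.unusedSectionVars false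

/-- The interval `I_j`: `(0, a_j)` for internal edges, `(0, ∞)` for incoming and `(-∞, 0)` for
outgoing external edges. -/
def MetricGraph.interval (G : MetricGraph V I Em Ep) : Edge I Em Ep → Set ℝ :=
  Sum.elim (fun i => Ioo 0 (G.length i)) (Sum.elim (fun _ => Ioi 0) (fun _ => Iio 0))

theorem MetricGraph.isOpen_interval (G : MetricGraph V I Em Ep) (j : Edge I Em Ep) :
    IsOpen (G.interval j) := by
  rcases j with i | e | e
  · exact isOpen_Ioo
  · exact isOpen_Ioi
  · exact isOpen_Iio

variable [Fintype I] [Fintype Em] [Fintype Ep]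
variable (G : MetricGraph V I Em Ep)
variable (X : Edge I Em Ep → Type*) [∀ j, NormedAddCommGroup (X j)]
  [∀ j, InnerProductSpace ℂ (X j)]

/-- The Hilbert space `L²(G, a; X) = ⨁_j L²(I_j; X_j)`. -/
abbrev L2 := PiLp 2 (fun j => Lp (X j) 2 (volume.restrict (G.interval j)))

/-- The Hilbert space `𝒦 = ⨁_{i ∈ I} X_i ⊕ ⨁_{e ∈ ℰ₋} X_e` of boundary values. -/
abbrev BoundarySpace :=
  WithLp 2 (PiLp 2 (fun i : I => X (Edge.internal i)) × PiLp 2 (fun e : Em => X (Edge.incoming e)))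

variable {X}

/-- `ψ ∈ W^{1,2}(G, a; X)` and `ψ' = g`. -/
def IsDeriv (ψ g : L2 G X) : Prop := ∀ j, IsWeakDerivOn (G.interval j) (ψ j) (g j)

/-- `x = ψ₋`: the values of `ψ` at the initial vertices, i.e. at `0`, of all edges in `I ∪ ℰ₋`. -/
def IsInitialValue (ψ : L2 G X) (x : BoundarySpace X) : Prop :=
  (∀ i : I, IsTraceAt (G.interval (Edge.internal i)) (ψ (Edge.internal i)) 0 (x.fst i)) ∧
    ∀ e : Em, IsTraceAt (G.interval (Edge.incoming e)) (ψ (Edge.incoming e)) 0 (x.snd e)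

/-- `y = ψ₊`: the values of `ψ` at the terminal vertices, i.e. at `a_i` for `i ∈ I` and at `0` for
the outgoing edges, where the outgoing edge `q e` is paired with the incoming edge `e` and
`X_{q e}` is identified with `X_e` through `U e`. -/
def IsTerminalValue (q : Em ≃ Ep)
    (U : ∀ e : Em, X (Edge.outgoing (q e)) ≃ₗᵢ[ℂ] X (Edge.incoming e))
    (ψ : L2 G X) (y : BoundarySpace X) : Prop :=
  (∀ i : I, IsTraceAt (G.interval (Edge.internal i)) (ψ (Edge.internal i)) (G.length i)
      (y.fst i)) ∧
    ∀ e : Em, IsTraceAt (G.interval (Edge.outgoing (q e))) (ψ (Edge.outgoing (q e))) 0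
      ((U e).symm (y.snd e))

variable {G}

theorem IsTraceAt.add_coeFn {j : Edge I Em Ep} {ψ φ : L2 G X} {t₀ : ℝ} {x y : X j}
    (hx : IsTraceAt (G.interval j) (ψ j) t₀ x) (hy : IsTraceAt (G.interval j) (φ j) t₀ y) :
    IsTraceAt (G.interval j) ((ψ + φ) j) t₀ (x + y) := by
  obtain ⟨u, hu, hu', rfl⟩ := hx
  obtain ⟨v, hv, hv', rfl⟩ := hy
  refine ⟨u + v, hu.add hv, ?_, rfl⟩
  have := Lp.coeFn_add (ψ j) (φ j)
  filter_upwards [hu', hv', this] with t h1 h2 h3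
  rw [PiLp.add_apply, h3]
  simp [h1, h2]

theorem IsTraceAt.smul_coeFn {j : Edge I Em Ep} {ψ : L2 G X} {t₀ : ℝ} {x : X j}
    (hx : IsTraceAt (G.interval j) (ψ j) t₀ x) (c : ℂ) :
    IsTraceAt (G.interval j) ((c • ψ) j) t₀ (c • x) := by
  obtain ⟨u, hu, hu', rfl⟩ := hx
  refine ⟨c • u, hu.const_smul c, ?_, rfl⟩
  have := Lp.coeFn_smul c (ψ j)
  filter_upwards [hu', this] with t h1 h3
  rw [PiLp.smul_apply, h3]
  simp [h1]

theorem isTraceAt_zero (j : Edge I Em Ep) (t₀ : ℝ) :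
    IsTraceAt (G.interval j) ((0 : L2 G X) j) t₀ (0 : X j) := by
  refine ⟨0, continuousOn_const, ?_, rfl⟩
  exact (Lp.coeFn_zero (X j) 2 (volume.restrict (G.interval j))).symm

variable (G)

/-- The graph of `D_t(𝓜)`, for a subspace `𝓜 ⊆ 𝒦²`: all `(ψ, ψ')` with
`ψ ∈ W^{1,2}(G, a; X)` and `[ψ] = (ψ₊, ψ₋) ∈ 𝓜`. -/
def dtGraph (q : Em ≃ Ep)
    (U : ∀ e : Em, X (Edge.outgoing (q e)) ≃ₗᵢ[ℂ] X (Edge.incoming e))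
    (M : Submodule ℂ (BoundarySpace X × BoundarySpace X)) :
    Submodule ℂ (L2 G X × L2 G X) where
  carrier := {P | IsDeriv G P.1 P.2 ∧
    ∃ y x : BoundarySpace X, IsTerminalValue G q U P.1 y ∧ IsInitialValue G P.1 x ∧ (y, x) ∈ M}
  zero_mem' := by
    refine ⟨fun j => ?_, 0, 0, ⟨fun i => isTraceAt_zero _ _, fun e => ?_⟩,
      ⟨fun i => isTraceAt_zero _ _, fun e => isTraceAt_zero _ _⟩, M.zero_mem⟩
    · have h0 := Lp.coeFn_zero (X j) 2 (volume.restrict (G.interval j))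
      exact IsWeakDerivOn.congr (f := 0) (g := 0) (fun φ _ _ _ => by simp) h0 h0
    · have := isTraceAt_zero (G := G) (X := X) (Edge.outgoing (q e)) 0
      rw [← (U e).symm.map_zero] at this
      exact this
  add_mem' := by
    rintro P Q ⟨hP, y, x, ⟨hy, hy'⟩, hx, hM⟩ ⟨hQ, y₂, x₂, ⟨hy₂, hy₂'⟩, hx₂, hM₂⟩
    refine ⟨fun j => ?_, y + y₂, x + x₂, ⟨fun i => (hy i).add_coeFn (hy₂ i), fun e => ?_⟩,
      ⟨fun i => (hx.1 i).add_coeFn (hx₂.1 i), fun e => (hx.2 e).add_coeFn (hx₂.2 e)⟩, M.add_mem hM hM₂⟩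
    · exact (isWeakDerivOn_add (Lp.memLp _) (Lp.memLp _) (Lp.memLp _) (Lp.memLp _)
        (hP j) (hQ j)).congr (Lp.coeFn_add _ _) (Lp.coeFn_add _ _)
    · have := (hy' e).add_coeFn (hy₂' e)
      rw [← (U e).symm.map_add] at this
      exact this
  smul_mem' := by
    rintro c P ⟨hP, y, x, ⟨hy, hy'⟩, hx, hM⟩
    refine ⟨fun j => ?_, c • y, c • x, ⟨fun i => (hy i).smul_coeFn c, fun e => ?_⟩,
      ⟨fun i => (hx.1 i).smul_coeFn c, fun e => (hx.2 e).smul_coeFn c⟩, M.smul_mem c hM⟩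
    · exact ((hP j).const_smul c).congr (Lp.coeFn_smul _ _) (Lp.coeFn_smul _ _)
    · have := (hy' e).smul_coeFn c
      rw [← (U e).symm.map_smul] at this
      exact this

/-- The operator `D_t(𝓜)` in `L²(G, a; X)`. -/
def dtOf (q : Em ≃ Ep)
    (U : ∀ e : Em, X (Edge.outgoing (q e)) ≃ₗᵢ[ℂ] X (Edge.incoming e))
    (M : Submodule ℂ (BoundarySpace X × BoundarySpace X)) : L2 G X →ₗ.[ℂ] L2 G X :=
  (dtGraph G q U M).toLinearPMap

/-- The operator `D_t(𝓜)` has the intended graph. -/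
theorem graph_dtOf [∀ j, CompleteSpace (X j)] (q : Em ≃ Ep)
    (U : ∀ e : Em, X (Edge.outgoing (q e)) ≃ₗᵢ[ℂ] X (Edge.incoming e))
    (M : Submodule ℂ (BoundarySpace X × BoundarySpace X)) :
    (dtOf G q U M).graph = dtGraph G q U M := by
  apply Submodule.toLinearPMap_graph_eq
  rintro ⟨ψ, g⟩ hP h0
  obtain rfl : ψ = 0 := h0
  have h1 := hP.1
  have h2 := (dtGraph G q U M).zero_mem.1
  refine PiLp.ext fun j => ?_
  exact Lp.ext ((h1 j).unique (G.isOpen_interval j) (Lp.memLp _) (Lp.memLp _) (h2 j))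

/-- The subspace `𝓜(B) = {(y, x) ∈ 𝒦² : x - B y = 0}`. -/
def boundaryCondition (B : BoundarySpace X →L[ℂ] BoundarySpace X) :
    Submodule ℂ (BoundarySpace X × BoundarySpace X) where
  carrier := {P | P.2 - B P.1 = 0}
  zero_mem' := by simp
  add_mem' := by
    intro P Q hP hQ
    simp only [Set.mem_ofPred_eq, sub_eq_zero] at *
    simp [hP, hQ]
  smul_mem' := by
    intro c P hP
    simp only [Set.mem_ofPred_eq, sub_eq_zero] at *
    simp [hP]

/-- The operator `D_t(B)`: `ψ ↦ ψ'` on all `ψ ∈ W^{1,2}(G, a; X)` with `ψ₋ = B ψ₊`. -/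
def dt (q : Em ≃ Ep)
    (U : ∀ e : Em, X (Edge.outgoing (q e)) ≃ₗᵢ[ℂ] X (Edge.incoming e))
    (B : BoundarySpace X →L[ℂ] BoundarySpace X) : L2 G X →ₗ.[ℂ] L2 G X :=
  dtOf G q U (boundaryCondition B)

end Graph

end TimeGraph

end

/-!
The operator `D_t(B)` is m-accretive on the Hilbert space `L²(G, a; X)`, and the upper bound for the
`H^∞`-angle holds for every m-accretive operator.

Integration by parts on the edges gives `2 Re ⟪ψ, ψ'⟫ = ‖ψ₊‖² - ‖ψ₋‖²`, which is nonnegative if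
`ψ₋ = B ψ₊` with a contraction `B` (`norm_sq_sub_norm_sq_le_re_inner`). The equation `ψ + ψ' = g` is
solved explicitly on each edge, by convolution with `e^{-t}` and a multiple of `e^{-t}`
(`solution`). The boundary condition is then an equation for the vector `x` of initial values,
`x = B (terminal values)`. Its right-hand side is Lipschitz in `x` with a constant
`max e^{-a_i} < 1`, so Banach's fixed point theorem applies (`isMAccretive_dt`).

For an m-accretive operator `A`, the estimate `‖(λ - A)⁻¹‖ ≤ 1 / |Re λ|` in the left half plane gives
sectoriality of angle `π / 2`. The bound `‖f(A)‖ ≤ sup |f|` (`IsMAccretive.hasBoundedHInfty`) is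
von Neumann's inequality for the half plane, and is proved without dilations. First, `A` is
approximated, in the sense of resolvents, by bounded operators `P` with `Re P ≥ c > 0`
(`boundedApprox`). Next, `P` is the value at `z = 1` of the pencil `z S + T`, where `S` and `T` are
the self-adjoint and the skew-adjoint part of `P`. The function `z ↦ f(z S + T)` is holomorphic and
bounded on the right half plane, so by the Phragmén-Lindelöf principle it is enough to bound it on
the imaginary axis (`norm_sectorIntegral_le_of_accretive`). There `z S + T` is skew-adjoint, the
Dunford integral is a continuous functional calculus, and Cauchy's formula on the sector
(`MemHZero.cauchy`) identifies the scalar Dunford integral with `f`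
(`norm_sectorIntegral_le_of_skew`).

The angle cannot be smaller than `π / 2` (`pi_div_two_le_of_isSectorial_dt`): for a bump function
`χ` supported inside an edge with `X_j ≠ 0` and a vector `x ≠ 0`, the function `e^{iτt} χ(t) x`
satisfies every boundary condition, its norm does not depend on `τ`, and
`(iτ - D_t(B)) (e^{iτt} χ x) = -e^{iτt} χ' x` is bounded in `τ`. So `λ (λ - D_t(B))⁻¹` is unbounded on
the positive imaginary axis.
-/

/-! ### Cauchy's integral formula on a strip, and functions of class `H₀^∞` on rays -/

namespace TimeGraph

open Complex Filter Topology

/-- The principal value of `∫ dt / (t + iβ)`. The two signs of `β` correspond to the two values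
`l = ±π / 2`. -/
theorem tendsto_intervalIntegral_inv_add_mul_I {β : ℝ} (hβ : β ≠ 0) {l : ℝ}
    (hl : Tendsto (fun N : ℝ => Real.arctan (N / β)) atTop (𝓝 l)) :
    Tendsto (fun N : ℝ => ∫ t in (-N)..N, ((t : ℂ) + β * I)⁻¹) atTop (𝓝 (-2 * l * I)) := by
  have hpos : ∀ t : ℝ, 0 < t ^ 2 + β ^ 2 := fun t => by positivity
  have hne : ∀ t : ℝ, (t : ℂ) + β * I ≠ 0 := by
    intro t h
    have := congrArg Complex.im h
    simp at this
    exact hβ this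
  -- a branch of `log (t + iβ)`, up to a constant
  have hd : ∀ t : ℝ, HasDerivAt
      (fun t : ℝ => (((Real.log (t ^ 2 + β ^ 2) / 2 : ℝ) : ℂ) - (Real.arctan (t / β) : ℝ) * I))
      ((t : ℂ) + β * I)⁻¹ t := by
    intro t
    have h1 : HasDerivAt (fun t : ℝ => Real.log (t ^ 2 + β ^ 2) / 2)
        (t / (t ^ 2 + β ^ 2)) t := by
      have := (((hasDerivAt_pow 2 t).add_const (β ^ 2)).log (hpos t).ne').div_const 2
      refine this.congr_deriv ?_
      field_simp
      simp
      ring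
    have h2 : HasDerivAt (fun t : ℝ => Real.arctan (t / β)) (β / (t ^ 2 + β ^ 2)) t := by
      have := ((hasDerivAt_id' t).div_const β).arctan
      refine this.congr_deriv ?_
      have := hpos t
      field_simp
      ring
    refine (h1.ofReal_comp.sub (h2.ofReal_comp.mul_const I)).congr_deriv ?_
    have h3 : ((t : ℂ) ^ 2 + (β : ℂ) ^ 2) ≠ 0 := by exact_mod_cast (hpos t).ne'
    refine eq_inv_of_mul_eq_one_left ?_
    push_cast
    field_simp
    linear_combination (-(β : ℂ) ^ 2) * I_sq
  have key : ∀ N : ℝ, ∫ t in (-N)..N, ((t : ℂ) + β * I)⁻¹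
      = -2 * (Real.arctan (N / β) : ℝ) * I := by
    intro N
    rw [intervalIntegral.integral_eq_sub_of_hasDerivAt (fun t _ => hd t)]
    · simp only [neg_sq, neg_div, Real.arctan_neg]
      push_cast
      ring
    · exact (Continuous.inv₀ (by fun_prop) hne).intervalIntegrable _ _
  simp_rw [key]
  exact (((continuous_ofReal.tendsto l).comp hl).const_mul _).mul_const _

/-- Cauchy's integral formula on a horizontal strip, in the form `∫_∂ F = 2πi Res F`: the function
`F ζ = m ζ / (ζ - iη)` has a simple pole at `iη` and tends to `0` at both ends of the strip. -/
theorem integral_strip_boundary {m : ℂ → ℂ} {θ ν η : ℝ} (hνθ : ν < θ) (hη : |η| < ν)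
    (hm : DifferentiableOn ℂ m {ζ | |ζ.im| < θ}) {b : ℝ → ℝ}
    (hb0 : Tendsto b atTop (𝓝 0)) (hb1 : Tendsto (fun t => b (-t)) atTop (𝓝 0))
    (hb : ∀ t y : ℝ, t ≠ 0 → |y| ≤ ν → ‖m (t + y * I) / (t + y * I - η * I)‖ ≤ b t)
    (hi : Integrable fun t : ℝ => m (t + ν * I) / (t + ν * I - η * I))
    (hi' : Integrable fun t : ℝ => m (t + (-ν : ℝ) * I) / (t + (-ν : ℝ) * I - η * I)) :
    (∫ t : ℝ, m (t + (-ν : ℝ) * I) / (t + (-ν : ℝ) * I - η * I)) -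
      ∫ t : ℝ, m (t + ν * I) / (t + ν * I - η * I) = 2 * Real.pi * I * m (η * I) := by
  have hν : 0 < ν := (abs_nonneg η).trans_lt hη
  obtain ⟨hη1, hη2⟩ := abs_lt.1 hη
  set F : ℂ → ℂ := fun ζ => m ζ / (ζ - η * I) with hF
  set h : ℂ → ℂ := dslope m (η * I) with hh
  have hopen : IsOpen {ζ : ℂ | |ζ.im| < θ} :=
    isOpen_lt (continuous_im.abs) continuous_const
  have hmem : {ζ : ℂ | |ζ.im| < θ} ∈ 𝓝 ((η : ℂ) * I) :=
    hopen.mem_nhds (by simpa using hη.trans hνθ)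
  have hdiff : DifferentiableOn ℂ h {ζ | |ζ.im| < θ} := (differentiableOn_dslope hmem).2 hm
  -- removing the pole leaves a holomorphic function, and the principal part is integrated explicitly
  have hform : ∀ ζ : ℂ, ζ ≠ η * I → h ζ = F ζ - m (η * I) * (ζ - η * I)⁻¹ := by
    intro ζ hζ
    rw [hh, dslope_of_ne _ hζ, slope_def_field, hF]
    simp only
    rw [sub_div, div_eq_mul_inv (m (η * I))]
  -- the rectangle with corners `-N - iν` and `N + iν`
  have hrect : ∀ N : ℝ, (∫ t in (-N)..N, h (t + (-ν : ℝ) * I)) - (∫ t in (-N)..N, h (t + ν * I))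
      + I * (∫ y in (-ν)..ν, h (N + y * I)) - I * (∫ y in (-ν)..ν, h ((-N : ℝ) + y * I)) = 0 := by
    intro N
    have := integral_boundary_rect_eq_zero_of_differentiableOn h (⟨-N, -ν⟩ : ℂ) ⟨N, ν⟩
      (hdiff.mono (by
        intro ζ hζ
        have := hζ.2
        change ζ.im ∈ uIcc (-ν) ν at this
        rw [uIcc_of_le (by linarith)] at this
        simp only [Set.mem_ofPred_eq]
        exact (abs_le.2 this).trans_lt hνθ))
    simpa [smul_eq_mul] using this
  have hne : ∀ (t y : ℝ), y ≠ η → (t : ℂ) + y * I ≠ η * I := by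
    intro t y hy h
    have := congrArg Complex.im h
    simp at this
    exact hy this
  have hne' : ∀ (t y : ℝ), t ≠ 0 → (t : ℂ) + y * I ≠ η * I := by
    intro t y hy h
    have := congrArg Complex.re h
    simp at this
    exact hy this
  have hline : ∀ y : ℝ, y ≠ η → Integrable (fun t : ℝ => F (t + y * I)) → ∀ l : ℝ,
      Tendsto (fun N : ℝ => Real.arctan (N / (y - η))) atTop (𝓝 l) →
      Tendsto (fun N : ℝ => ∫ t in (-N)..N, h (t + y * I)) atTop
        (𝓝 ((∫ t : ℝ, F (t + y * I)) - m (η * I) * (-2 * l * I))) := by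
    intro y hy hint l hl
    have e : ∀ N : ℝ, ∫ t in (-N)..N, h (t + y * I) = (∫ t in (-N)..N, F (t + y * I)) -
        m (η * I) * ∫ t in (-N)..N, ((t : ℂ) + (y - η : ℝ) * I)⁻¹ := by
      intro N
      rw [← intervalIntegral.integral_const_mul, ← intervalIntegral.integral_sub]
      · refine intervalIntegral.integral_congr fun t _ => ?_
        rw [hform _ (hne t y hy)]
        congr 3
        push_cast
        ring
      · exact hint.intervalIntegrable
      · refine (Continuous.intervalIntegrable ?_ _ _)
        refine continuous_const.mul (Continuous.inv₀ (by fun_prop) ?_)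
        intro t h
        have := congrArg Complex.im h
        simp at this
        exact hy (by linarith)
    simp_rw [e]
    exact (intervalIntegral_tendsto_integral hint tendsto_neg_atTop_atBot tendsto_id).sub
      ((tendsto_intervalIntegral_inv_add_mul_I (sub_ne_zero.2 hy) hl).const_mul _)
  have hside : ∀ σ : ℝ, |σ| = 1 → Tendsto (fun N : ℝ => b (σ * N)) atTop (𝓝 0) →
      Tendsto (fun N : ℝ => ∫ y in (-ν)..ν, h ((σ * N : ℝ) + y * I)) atTop (𝓝 0) := by
    intro σ hσ hbσ
    have hbd : ∀ᶠ N : ℝ in atTop, ‖∫ y in (-ν)..ν, h ((σ * N : ℝ) + y * I)‖ ≤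
        (b (σ * N) + ‖m (η * I)‖ * N⁻¹) * |ν - -ν| := by
      filter_upwards [eventually_gt_atTop 0] with N hN
      refine intervalIntegral.norm_integral_le_of_norm_le_const fun y hy => ?_
      rw [uIoc_of_le (by linarith)] at hy
      have hne0 : σ * N ≠ 0 := by
        refine mul_ne_zero ?_ hN.ne'
        rintro rfl
        simp at hσ
      rw [hform _ (hne' _ _ hne0)]
      refine (norm_sub_le _ _).trans (add_le_add (hb _ y hne0 (abs_le.2 ⟨hy.1.le, hy.2⟩)) ?_)
      rw [norm_mul, norm_inv]
      gcongr
      have := abs_re_le_norm (((σ * N : ℝ) : ℂ) + y * I - η * I)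
      simpa [abs_mul, hσ, abs_of_pos hN] using this
    refine squeeze_zero_norm' hbd ?_
    have := (hbσ.add (tendsto_inv_atTop_zero.const_mul ‖m (η * I)‖)).mul_const (|ν - -ν|)
    simpa using this
  have hpos : Tendsto (fun N : ℝ => Real.arctan (N / (ν - η))) atTop (𝓝 (Real.pi / 2)) :=
    (tendsto_nhds_of_tendsto_nhdsWithin Real.tendsto_arctan_atTop).comp
      (tendsto_id.atTop_div_const (by linarith))
  have hneg : Tendsto (fun N : ℝ => Real.arctan (N / (-ν - η))) atTop (𝓝 (-(Real.pi / 2))) := by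
    have : Tendsto (fun N : ℝ => Real.arctan (N / (-ν - η))) atTop (𝓝 (-(Real.pi / 2))) :=
      (tendsto_nhds_of_tendsto_nhdsWithin Real.tendsto_arctan_atBot).comp
        (tendsto_id.atTop_div_const_of_neg (by linarith))
    exact this
  have h1 := hline ν (by linarith) hi _ hpos
  have h2 := hline (-ν) (by linarith) hi' _ hneg
  have h3 := hside 1 (by simp) (by simpa using hb0)
  have h4 := hside (-1) (by simp) (by simpa using hb1)
  have hlim := ((h2.sub h1).add (h3.const_mul I)).sub (h4.const_mul I)
  have hz : (fun N : ℝ => (∫ t in (-N)..N, h (t + (-ν : ℝ) * I)) -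
      (∫ t in (-N)..N, h (t + ν * I)) + I * (∫ y in (-ν)..ν, h ((1 * N : ℝ) + y * I)) -
      I * (∫ y in (-ν)..ν, h ((-1 * N : ℝ) + y * I))) = fun _ => 0 := by
    funext N
    have := hrect N
    simpa only [one_mul, neg_one_mul] using this
  rw [hz] at hlim
  have := tendsto_nhds_unique hlim tendsto_const_nhds
  push_cast at this ⊢
  linear_combination this

theorem norm_ray (ν : ℝ) {r : ℝ} (hr : 0 < r) : ‖ray ν r‖ = r := by
  rw [ray, norm_mul, norm_exp_ofReal_mul_I, mul_one, norm_real, Real.norm_of_nonneg hr.le]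

theorem re_ray (ν r : ℝ) : (ray ν r).re = r * Real.cos ν := by
  rw [ray, re_ofReal_mul, exp_ofReal_mul_I_re]

theorem ray_mem_sector {ν θ r : ℝ} (hν : |ν| < θ) (hθ : θ ≤ Real.pi) (hr : 0 < r) :
    ray ν r ∈ sector θ := by
  have hn : ray ν r ≠ 0 := norm_pos_iff.1 (by rw [norm_ray ν hr]; exact hr)
  refine ⟨hn, ?_⟩
  have h := abs_lt.1 hν
  rwa [ray, arg_real_mul _ hr, arg_exp_mul_I, toIocMod_eq_self Real.two_pi_pos |>.2]
  constructor <;> linarith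

theorem continuous_ray (ν : ℝ) : Continuous (ray ν) := by
  unfold ray
  fun_prop

theorem min_rpow_eq_exp {x : ℝ} (hx : 0 < x) {s : ℝ} (hs : 0 < s) :
    min (x ^ s) (x ^ (-s)) = Real.exp (-s * |Real.log x|) := by
  rw [Real.rpow_def_of_pos hx, Real.rpow_def_of_pos hx]
  rcases le_total 0 (Real.log x) with h | h
  · rw [abs_of_nonneg h, min_eq_right]
    · ring_nf
    · exact Real.exp_le_exp.2 (by nlinarith)
  · rw [abs_of_nonpos h, min_eq_left]
    · ring_nf
    · exact Real.exp_le_exp.2 (by nlinarith)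

theorem integrableOn_min_rpow_div {s : ℝ} (hs : 0 < s) :
    IntegrableOn (fun r : ℝ => min (r ^ s) (r ^ (-s)) / r) (Ioi 0) := by
  have hmeas : Measurable fun r : ℝ => min (r ^ s) (r ^ (-s)) / r := by fun_prop
  rw [← Ioc_union_Ioi_eq_Ioi zero_le_one]
  refine IntegrableOn.union ?_ ?_
  · have h : IntegrableOn (fun r : ℝ => r ^ (s - 1)) (Ioc 0 1) := by
      rw [← intervalIntegrable_iff_integrableOn_Ioc_of_le zero_le_one]
      exact intervalIntegral.intervalIntegrable_rpow' (by linarith)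
    refine Integrable.mono' h hmeas.aestronglyMeasurable ?_
    filter_upwards [ae_restrict_mem measurableSet_Ioc] with r hr
    have hr0 : 0 < r := hr.1
    rw [Real.norm_of_nonneg (by positivity), Real.rpow_sub_one hr0.ne']
    gcongr
    exact min_le_left _ _
  · have h : IntegrableOn (fun r : ℝ => r ^ (-s - 1)) (Ioi 1) :=
      integrableOn_Ioi_rpow_of_lt (by linarith) one_pos
    refine Integrable.mono' h hmeas.aestronglyMeasurable ?_
    filter_upwards [ae_restrict_mem measurableSet_Ioi] with r hr
    have hr0 : 0 < r := one_pos.trans hr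
    rw [Real.norm_of_nonneg (by positivity), Real.rpow_sub_one hr0.ne']
    gcongr
    exact min_le_right _ _

theorem MemHZero.exists_exp_bound {θ : ℝ} {f : ℂ → ℂ} (hf : MemHZero θ f) :
    ∃ C s : ℝ, 0 ≤ C ∧ 0 < s ∧ ∀ z ∈ sector θ, ‖f z‖ ≤ C * Real.exp (-s * |Real.log ‖z‖|) := by
  obtain ⟨C, s, hs, h⟩ := hf.decay
  refine ⟨max C 0, s, le_max_right _ _, hs, fun z hz => (h z hz).trans ?_⟩
  rw [min_rpow_eq_exp (norm_pos_iff.2 hz.1) hs]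
  gcongr
  exact le_max_left _ _

/-- Along each ray of the sector, `f` is dominated by one function that is integrable for the
scale invariant measure `dr / r`. -/
theorem MemHZero.exists_integrable_bound {θ : ℝ} {f : ℂ → ℂ} (hf : MemHZero θ f)
    (hθ : θ ≤ Real.pi) : ∃ b : ℝ → ℝ, IntegrableOn b (Ioi 0) ∧
      ∀ φ : ℝ, |φ| < θ → ∀ r : ℝ, 0 < r → ‖f (ray φ r)‖ / r ≤ b r := by
  obtain ⟨C, s, hs, h⟩ := hf.decay
  refine ⟨_, (integrableOn_min_rpow_div hs).const_mul C, fun φ hφ r hr => ?_⟩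
  have := h _ (ray_mem_sector hφ hθ hr)
  rw [norm_ray φ hr] at this
  rw [← mul_div_assoc]
  gcongr

theorem MemHZero.continuousOn_ray {θ : ℝ} {f : ℂ → ℂ} (hf : MemHZero θ f)
    (hθ : θ ≤ Real.pi) {φ : ℝ} (hφ : |φ| < θ) : ContinuousOn (fun r => f (ray φ r)) (Ioi 0) :=
  hf.holo.continuousOn.comp (continuous_ray φ).continuousOn fun _ hr => ray_mem_sector hφ hθ hr

theorem image_mul_exp_univ {ρ : ℝ} (hρ : 0 < ρ) :
    (fun t : ℝ => ρ * Real.exp t) '' univ = Ioi 0 := by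
  ext x
  simp only [image_univ, mem_range, mem_Ioi]
  constructor
  · rintro ⟨t, rfl⟩
    positivity
  · intro hx
    exact ⟨Real.log (x / ρ), by rw [Real.exp_log (by positivity)]; field_simp⟩

theorem integral_Ioi_eq_integral_exp {E : Type*} [NormedAddCommGroup E] [NormedSpace ℝ E]
    {ρ : ℝ} (hρ : 0 < ρ) (g : ℝ → E) :
    ∫ r in Ioi 0, g r = ∫ t : ℝ, (ρ * Real.exp t) • g (ρ * Real.exp t) := by
  rw [← image_mul_exp_univ hρ, integral_image_eq_integral_abs_deriv_smul (f' := fun t => ρ * Real.exp t)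
    MeasurableSet.univ (fun t _ => ((Real.hasDerivAt_exp t).const_mul ρ).hasDerivWithinAt)
    (fun a _ b _ h => by simpa [hρ.ne'] using h)]
  rw [setIntegral_univ]
  refine integral_congr_ae (ae_of_all _ fun t => ?_)
  simp only
  rw [abs_of_pos (by positivity)]

theorem integrable_exp_iff_integrableOn_Ioi {E : Type*} [NormedAddCommGroup E] [NormedSpace ℝ E]
    {ρ : ℝ} (hρ : 0 < ρ) (g : ℝ → E) :
    IntegrableOn g (Ioi 0) ↔ Integrable fun t : ℝ => (ρ * Real.exp t) • g (ρ * Real.exp t) := by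
  rw [← image_mul_exp_univ hρ, integrableOn_image_iff_integrableOn_abs_deriv_smul (f' := fun t => ρ * Real.exp t)
    MeasurableSet.univ (fun t _ => ((Real.hasDerivAt_exp t).const_mul ρ).hasDerivWithinAt)
    (fun a _ b _ h => by simpa [hρ.ne'] using h), integrableOn_univ]
  refine integrable_congr (ae_of_all _ fun t => ?_)
  simp only
  rw [abs_of_pos (by positivity)]

/-- Along a ray, the product of `f ∈ H₀^∞` with a vector-valued function bounded by `κ / |λ|`, such
as the resolvent of a sectorial operator, is integrable. -/
theorem integrableOn_smul_of_norm_le {E : Type*} [NormedAddCommGroup E] [NormedSpace ℂ E]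
    {θ : ℝ} {f : ℂ → ℂ} {φ : ℝ} {g : ℝ → E} {b : ℝ → ℝ} {w : ℂ} {κ : ℝ}
    (hb : IntegrableOn b (Ioi 0)) (hbf : ∀ r : ℝ, 0 < r → ‖f (ray φ r)‖ / r ≤ b r)
    (hf : MemHZero θ f) (hθ : θ ≤ Real.pi) (hφ : |φ| < θ)
    (hg : ContinuousOn g (Ioi 0)) (hκ : ∀ r, 0 < r → ‖w • g r‖ ≤ κ / r) (hκ0 : 0 ≤ κ) :
    IntegrableOn (fun r => (f (ray φ r) * w) • g r) (Ioi 0) := by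
  refine Integrable.mono' (hb.const_mul κ) ?_ ?_
  · exact (((hf.continuousOn_ray hθ hφ).mul continuousOn_const).smul hg).aestronglyMeasurable
      measurableSet_Ioi
  · filter_upwards [ae_restrict_mem measurableSet_Ioi] with r hr
    rw [mul_smul, norm_smul]
    calc _ ≤ ‖f (ray φ r)‖ * (κ / r) := by gcongr; exact hκ r hr
      _ = κ * (‖f (ray φ r)‖ / r) := by ring
      _ ≤ _ := by gcongr; exact hbf r hr

theorem mul_abs_cos_le_norm_ray_sub {ν r : ℝ} (hr : 0 < r) (hν : Real.cos ν < 0) {z : ℂ}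
    (hz : 0 ≤ z.re) : r * |Real.cos ν| ≤ ‖ray ν r - z‖ := by
  refine le_trans ?_ (abs_re_le_norm _)
  rw [sub_re, re_ray, abs_of_neg hν, abs_of_nonpos (by nlinarith)]
  nlinarith

theorem ray_sub_ne_zero {ν r : ℝ} (hr : 0 < r) (hν : Real.cos ν < 0) {z : ℂ}
    (hz : 0 ≤ z.re) : ray ν r - z ≠ 0 := by
  have h := mul_abs_cos_le_norm_ray_sub hr hν hz
  exact norm_pos_iff.1 (lt_of_lt_of_le (mul_pos hr (abs_pos.2 hν.ne)) h)

theorem integrableOn_ray_div {θ φ : ℝ} {f : ℂ → ℂ} (hf : MemHZero θ f) (hθ : θ ≤ Real.pi)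
    (hφ : |φ| < θ) (hφ' : Real.cos φ < 0) {z : ℂ} (hz : 0 ≤ z.re) :
    IntegrableOn (fun r => f (ray φ r) * exp (φ * I) / (ray φ r - z)) (Ioi 0) := by
  obtain ⟨b, hb, hbf⟩ := hf.exists_integrable_bound hθ
  have := integrableOn_smul_of_norm_le (g := fun r => (ray φ r - z)⁻¹) (w := exp (φ * I))
    (κ := |Real.cos φ|⁻¹) hb (hbf φ hφ) hf hθ hφ ?_ ?_ (by positivity)
  · simpa [div_eq_mul_inv] using this
  · exact ContinuousOn.inv₀ ((continuous_ray φ).sub continuous_const).continuousOn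
      fun r hr => ray_sub_ne_zero hr hφ' hz
  · intro r hr
    rw [norm_smul, norm_exp_ofReal_mul_I, one_mul, norm_inv, inv_eq_one_div |Real.cos φ|, div_div,
      mul_comm, ← inv_eq_one_div]
    exact inv_anti₀ (mul_pos hr (abs_pos.2 hφ'.ne)) (mul_abs_cos_le_norm_ray_sub hr hφ' hz)

end TimeGraph

/-! ### Cauchy's integral formula on a sector -/

namespace TimeGraph

open Complex Filter Topology

theorem tendsto_exp_div_abs_exp_sub_one_atTop :
    Tendsto (fun t : ℝ => Real.exp t / |Real.exp t - 1|) atTop (𝓝 1) := by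
  have h : Tendsto (fun t : ℝ => |1 - Real.exp (-t)|⁻¹) atTop (𝓝 1) := by
    have := ((Real.tendsto_exp_neg_atTop_nhds_zero.const_sub 1).abs).inv₀ (by simp)
    simpa using this
  refine h.congr fun t => ?_
  have : Real.exp t - 1 = Real.exp t * (1 - Real.exp (-t)) := by
    rw [mul_sub, ← Real.exp_add]; simp
  rw [this, abs_mul, abs_of_pos (Real.exp_pos t), inv_eq_one_div]
  rw [← div_div, div_self (Real.exp_pos t).ne']

theorem tendsto_exp_div_abs_exp_sub_one_atBot :
    Tendsto (fun t : ℝ => Real.exp t / |Real.exp t - 1|) atBot (𝓝 0) := by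
  have := Real.tendsto_exp_atBot.div ((Real.tendsto_exp_atBot.sub_const 1).abs) (by simp)
  rw [zero_sub, abs_neg, abs_one, zero_div] at this
  exact this

theorem tendsto_exp_neg_mul_abs {ι : Type*} {l : Filter ι} {u : ι → ℝ} {s : ℝ} (hs : 0 < s)
    (hu : Tendsto (fun i => |u i|) l atTop) :
    Tendsto (fun i => Real.exp (-s * |u i|)) l (𝓝 0) :=
  Real.tendsto_exp_atBot.comp (hu.const_mul_atTop_of_neg (by linarith))

/-- Cauchy's integral formula on a sector, for points `z` of the closed right half plane. The
substitution `λ = |z| e^ζ` turns it into the formula on a strip; the factor `dslope exp` absorbs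
the difference between the poles `1 / (e^ζ - e^{iη})` and `1 / (ζ - iη)`. -/
theorem MemHZero.cauchy {θ ν : ℝ} {f : ℂ → ℂ} (hf : MemHZero θ f) (hν : Real.pi / 2 < ν)
    (hνθ : ν < θ) (hθ : θ < Real.pi) {z : ℂ} (hz : 0 ≤ z.re) (hz0 : z ≠ 0) :
    (∫ r in Ioi (0 : ℝ), f (ray (-ν) r) * exp ((-ν : ℝ) * I) / (ray (-ν) r - z)) -
      ∫ r in Ioi (0 : ℝ), f (ray ν r) * exp (ν * I) / (ray ν r - z) =
    2 * Real.pi * I * f z := by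
  obtain ⟨C, s, hC, hs, hdec⟩ := hf.exists_exp_bound
  have hν0 : 0 < ν := by linarith [Real.pi_pos]
  set ρ := ‖z‖ with hρ
  have hρ0 : 0 < ρ := norm_pos_iff.2 hz0
  set η := z.arg with hη
  have hην : |η| ≤ Real.pi / 2 := abs_arg_le_pi_div_two_iff.2 hz
  have hzη : z = ρ * exp (η * I) := (norm_mul_exp_arg_mul_I z).symm
  have hcos : Real.cos ν < 0 :=
    Real.cos_neg_of_pi_div_two_lt_of_lt hν (by linarith [Real.pi_pos])
  have habs : |ν| < θ := by rwa [abs_of_pos hν0]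
  -- in the coordinate `λ = ρ e^ζ` the pole `z` sits at `iη` and the sector becomes a strip
  set m : ℂ → ℂ := fun ζ => f (ρ * exp ζ) * exp ζ / dslope exp (η * I) ζ with hm
  have hray : ∀ t y : ℝ, (ρ : ℂ) * exp (t + y * I) = ray y (ρ * Real.exp t) := by
    intro t y
    rw [ray, exp_add]
    push_cast
    ring
  have hsec : ∀ ζ : ℂ, |ζ.im| < θ → (ρ : ℂ) * exp ζ ∈ sector θ := by
    intro ζ hζ
    rw [← re_add_im ζ, hray]
    exact ray_mem_sector hζ hθ.le (by positivity)
  have hinj : ∀ ζ : ℂ, |ζ.im| < θ → exp ζ = exp (η * I) → ζ = η * I := by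
    intro ζ hζ h
    have h1 := abs_lt.1 hζ
    have h2 := abs_le.1 hην
    refine exp_inj_of_neg_pi_lt_of_le_pi (by linarith) (by linarith) ?_ ?_ h
    · simp; linarith
    · simp; linarith
  have hds : ∀ ζ : ℂ, |ζ.im| < θ → dslope exp (η * I) ζ ≠ 0 := by
    intro ζ hζ h
    by_cases hne : ζ = η * I
    · rw [hne, dslope_same, Complex.deriv_exp] at h
      exact exp_ne_zero _ h
    · have := sub_smul_dslope exp (η * I) ζ
      rw [h, smul_zero] at this
      exact hne (hinj ζ hζ (sub_eq_zero.1 this.symm))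
  have hmd : DifferentiableOn ℂ m {ζ | |ζ.im| < θ} := by
    refine DifferentiableOn.div ?_ ?_ hds
    · refine DifferentiableOn.mul ?_ differentiable_exp.differentiableOn
      exact hf.holo.comp ((differentiable_exp.const_mul _).differentiableOn) hsec
    · exact ((differentiableOn_dslope (s := univ) univ_mem).2
        differentiable_exp.differentiableOn).mono (subset_univ _)
  have hF : ∀ ζ : ℂ, m ζ / (ζ - η * I) = f (ρ * exp ζ) * exp ζ / (exp ζ - exp (η * I)) := by
    intro ζ
    rw [hm]
    simp only
    rw [div_div, mul_comm (dslope _ _ _), ← smul_eq_mul (ζ - η * I), sub_smul_dslope]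
  have hF' : ∀ (y t : ℝ), m (t + y * I) / (t + y * I - η * I) = (ρ * Real.exp t) •
      (f (ray y (ρ * Real.exp t)) * exp (y * I) / (ray y (ρ * Real.exp t) - z)) := by
    intro y t
    rw [hF, hray, ← hray t y, hzη, ← mul_sub, exp_add, real_smul]
    push_cast
    rw [mul_comm (ρ : ℂ) (exp t * exp (y * I) - _), ← div_div, ← mul_div_assoc]
    have : (ρ : ℂ) ≠ 0 := by exact_mod_cast hρ0.ne'
    field_simp
  have hmz : m (η * I) = f z := by
    rw [hm]
    simp only
    rw [dslope_same, Complex.deriv_exp, mul_div_assoc, div_self (exp_ne_zero _), mul_one, ← hzη]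
  have hint : ∀ φ : ℝ, |φ| < θ → Real.cos φ < 0 →
      Integrable fun t : ℝ => m (t + φ * I) / (t + φ * I - η * I) := by
    intro φ hφ hφ'
    simp_rw [hF']
    exact (integrable_exp_iff_integrableOn_Ioi hρ0 _).1 (integrableOn_ray_div hf hθ.le hφ hφ' hz)
  set b : ℝ → ℝ := fun t => C * Real.exp (-s * |t + Real.log ρ|) *
    (Real.exp t / |Real.exp t - 1|) with hb
  have key := integral_strip_boundary (m := m) (b := b) hνθ (hην.trans_lt hν) hmd ?_ ?_ ?_
    (hint ν habs hcos) (hint (-ν) (by rwa [abs_neg]) (by rwa [Real.cos_neg]))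
  · rw [integral_Ioi_eq_integral_exp hρ0, integral_Ioi_eq_integral_exp hρ0]
    simp_rw [← hF']
    rw [key, hmz]
  · have h1 : Tendsto (fun t : ℝ => |t + Real.log ρ|) atTop atTop :=
      tendsto_abs_atTop_atTop.comp (tendsto_atTop_add_const_right _ _ tendsto_id)
    have := ((tendsto_exp_neg_mul_abs hs h1).const_mul C).mul tendsto_exp_div_abs_exp_sub_one_atTop
    rw [mul_zero, zero_mul] at this
    exact this
  · have h1 : Tendsto (fun t : ℝ => |-t + Real.log ρ|) atTop atTop :=
      tendsto_abs_atBot_atTop.comp (tendsto_atBot_add_const_right _ _ tendsto_neg_atTop_atBot)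
    have := ((tendsto_exp_neg_mul_abs hs h1).const_mul C).mul
      (tendsto_exp_div_abs_exp_sub_one_atBot.comp tendsto_neg_atTop_atBot)
    rw [mul_zero] at this
    exact this
  · intro t y ht hy
    have hy' : |((t : ℂ) + y * I).im| < θ := by simpa using hy.trans_lt hνθ
    have hn : ‖exp ((t : ℂ) + y * I)‖ = Real.exp t := by rw [norm_exp]; simp
    rw [hF, mul_div_assoc, norm_mul, norm_div, hn]
    have h1 := hdec _ (hsec _ hy')
    rw [norm_mul, hn, norm_real, Real.norm_of_nonneg hρ0.le,
      Real.log_mul hρ0.ne' (Real.exp_pos t).ne', Real.log_exp, add_comm (Real.log ρ)] at h1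
    have h2 : |Real.exp t - 1| ≤ ‖exp ((t : ℂ) + y * I) - exp (η * I)‖ := by
      have := abs_norm_sub_norm_le (exp ((t : ℂ) + y * I)) (exp (η * I))
      rwa [hn, norm_exp_ofReal_mul_I] at this
    have h3 : 0 < |Real.exp t - 1| :=
      abs_pos.2 (sub_ne_zero.2 (by rwa [Ne, Real.exp_eq_one_iff]))
    rw [hb]
    simp only
    gcongr

end TimeGraph

/-! ### Dunford integrals of bounded accretive operators -/

namespace TimeGraph

open Complex Filter Topology

/-- The contribution `∫₀^∞ f(λ) g(λ) dλ`, `λ = r e^{iφ}`, of one ray to a Dunford integral, with an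
arbitrary function `g` in the place of the resolvent. -/
noncomputable def rayIntegral {E : Type*} [NormedAddCommGroup E] [NormedSpace ℂ E] (f : ℂ → ℂ)
    (φ : ℝ) (g : ℂ → E) : E :=
  ∫ r in Ioi (0 : ℝ), (f (ray φ r) * exp ((φ : ℂ) * I)) • g (ray φ r)

/-- The Dunford integral over the boundary of `Σ_ν`, with an arbitrary function `g` in the place
of the resolvent. -/
noncomputable def sectorIntegral {E : Type*} [NormedAddCommGroup E] [NormedSpace ℂ E] (f : ℂ → ℂ)
    (ν : ℝ) (g : ℂ → E) : E :=
  (2 * (Real.pi : ℂ) * I)⁻¹ • (rayIntegral f (-ν) g - rayIntegral f ν g)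

/-- The resolvent `(z - P)⁻¹` of a bounded operator, as an inverse in the Banach algebra
(and `0` on the spectrum). -/
noncomputable def bddResolvent {H : Type*} [NormedAddCommGroup H] [NormedSpace ℂ H]
    (P : H →L[ℂ] H) (z : ℂ) : H →L[ℂ] H :=
  Ring.inverse (algebraMap ℂ (H →L[ℂ] H) z - P)

theorem MemHZero.sectorIntegral_inv {θ ν : ℝ} {f : ℂ → ℂ} (hf : MemHZero θ f)
    (hν : Real.pi / 2 < ν) (hνθ : ν < θ) (hθ : θ < Real.pi) {z : ℂ} (hz : 0 ≤ z.re)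
    (hz0 : z ≠ 0) : sectorIntegral f ν (fun l => (l - z)⁻¹) = f z := by
  have h := hf.cauchy hν hνθ hθ hz hz0
  simp only [sectorIntegral, rayIntegral, smul_eq_mul, ← div_eq_mul_inv]
  rw [h, ← mul_assoc, inv_mul_cancel₀ two_pi_I_ne_zero, one_mul]

section Dominated

variable {E : Type*} [NormedAddCommGroup E] [NormedSpace ℂ E] {θ φ κ : ℝ} {f : ℂ → ℂ}

theorem integrableOn_rayIntegrand (hf : MemHZero θ f) (hθ : θ ≤ Real.pi) (hφ : |φ| < θ)
    {g : ℂ → E} (hg : ContinuousOn (fun r => g (ray φ r)) (Ioi 0))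
    (hκ : ∀ r, 0 < r → ‖g (ray φ r)‖ ≤ κ / r) :
    IntegrableOn (fun r => (f (ray φ r) * exp ((φ : ℂ) * I)) • g (ray φ r)) (Ioi 0) := by
  obtain ⟨b, hb, hbf⟩ := hf.exists_integrable_bound hθ
  have hκ0 : 0 ≤ κ := by simpa using (norm_nonneg _).trans (hκ 1 one_pos)
  refine integrableOn_smul_of_norm_le (w := exp ((φ : ℂ) * I)) hb (hbf φ hφ) hf hθ hφ hg ?_ hκ0
  intro r hr
  rw [norm_smul, norm_exp_ofReal_mul_I, one_mul]
  exact hκ r hr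

/-- Dominated convergence: `rayIntegral f φ` is continuous under pointwise convergence of functions
with a common bound `κ / |λ|`. -/
theorem tendsto_rayIntegral {ι : Type*} {l : Filter ι} [l.IsCountablyGenerated]
    (hf : MemHZero θ f) (hθ : θ ≤ Real.pi) (hφ : |φ| < θ) {G : ι → ℂ → E} {g : ℂ → E}
    (hG : ∀ᶠ i in l, ContinuousOn (fun r => G i (ray φ r)) (Ioi 0))
    (hκ : ∀ᶠ i in l, ∀ r, 0 < r → ‖G i (ray φ r)‖ ≤ κ / r)
    (hlim : ∀ r, 0 < r → Tendsto (fun i => G i (ray φ r)) l (𝓝 (g (ray φ r)))) :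
    Tendsto (fun i => rayIntegral f φ (G i)) l (𝓝 (rayIntegral f φ g)) := by
  obtain ⟨b, hb, hbf⟩ := hf.exists_integrable_bound hθ
  refine tendsto_integral_filter_of_dominated_convergence (fun r => |κ| * b r) ?_ ?_
    (hb.const_mul |κ|) ?_
  · filter_upwards [hG] with i hi
    exact (((hf.continuousOn_ray hθ hφ).mul continuousOn_const).smul hi).aestronglyMeasurable
      measurableSet_Ioi
  · filter_upwards [hκ] with i hi
    filter_upwards [ae_restrict_mem measurableSet_Ioi] with r hr
    rw [norm_smul, norm_mul, norm_exp_ofReal_mul_I, mul_one]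
    calc _ ≤ ‖f (ray φ r)‖ * (κ / r) := by gcongr; exact hi r hr
      _ = κ * (‖f (ray φ r)‖ / r) := by ring
      _ ≤ |κ| * (‖f (ray φ r)‖ / r) := by
        have : 0 ≤ r := le_of_lt hr
        gcongr
        exact le_abs_self κ
      _ ≤ _ := by gcongr; exact hbf φ hφ r hr
  · filter_upwards [ae_restrict_mem measurableSet_Ioi] with r hr
    exact (hlim r hr).const_smul _

end Dominated

section Bounded

variable {H : Type*} [NormedAddCommGroup H] [InnerProductSpace ℂ H]

open scoped InnerProductSpace

theorem re_inner_algebraMap_sub_apply (P : H →L[ℂ] H) (z : ℂ) (x : H) :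
    (⟪x, (algebraMap ℂ (H →L[ℂ] H) z - P) x⟫_ℂ).re = z.re * ‖x‖ ^ 2 - (⟪x, P x⟫_ℂ).re := by
  rw [_root_.sub_apply, inner_sub_right, Algebra.algebraMap_eq_smul_one,
    _root_.smul_apply, one_apply_eq_self, inner_smul_right,
    inner_self_eq_norm_sq_to_K, sub_re]
  congr 1
  change (z * ((‖x‖ : ℝ) : ℂ) ^ 2).re = _
  rw [← Complex.ofReal_pow]
  exact re_mul_ofReal _ _

variable [CompleteSpace H]

/-- A bounded operator `P` with `Re ⟪x, P x⟫ ≥ c ‖x‖²` has the half plane `Re z < c` in its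
resolvent set. -/
theorem isUnit_sub_of_accretive {P : H →L[ℂ] H} {c : ℝ}
    (hP : ∀ x, c * ‖x‖ ^ 2 ≤ (⟪x, P x⟫_ℂ).re) {z : ℂ} (hz : z.re < c) :
    IsUnit (algebraMap ℂ (H →L[ℂ] H) z - P) := by
  refine ContinuousLinearMap.isUnit_of_forall_le_norm_inner_map _ (c := (c - z.re).toNNReal)
    (by simpa using hz) fun x => ?_
  rw [norm_inner_symm]
  refine le_trans ?_ ((neg_le_abs _).trans (abs_re_le_norm _))
  have h1 : (⟪x, (algebraMap ℂ (H →L[ℂ] H) z - P) x⟫_ℂ).re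
      = z.re * ‖x‖ ^ 2 - (⟪x, P x⟫_ℂ).re := re_inner_algebraMap_sub_apply P z x
  rw [h1]
  have := hP x
  rw [Real.coe_toNNReal _ (by linarith)]
  nlinarith

theorem norm_bddResolvent_le {P : H →L[ℂ] H} {c : ℝ}
    (hP : ∀ x, c * ‖x‖ ^ 2 ≤ (⟪x, P x⟫_ℂ).re) {z : ℂ} (hz : z.re < c) :
    ‖bddResolvent P z‖ ≤ (c - z.re)⁻¹ := by
  have hc : 0 < c - z.re := by linarith
  refine ContinuousLinearMap.opNorm_le_bound _ (by positivity) fun y => ?_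
  set x := bddResolvent P z y with hx
  have hy : (algebraMap ℂ (H →L[ℂ] H) z - P) x = y := by
    rw [hx, bddResolvent, ← mul_apply_eq_comp,
      Ring.mul_inverse_cancel _ (isUnit_sub_of_accretive hP hz), one_apply_eq_self]
  have h1 : (⟪x, y⟫_ℂ).re = z.re * ‖x‖ ^ 2 - (⟪x, P x⟫_ℂ).re := by
    rw [← hy, re_inner_algebraMap_sub_apply]
  have h2 : (c - z.re) * ‖x‖ ^ 2 ≤ ‖x‖ * ‖y‖ := by
    have h3 := (neg_le_abs _).trans ((abs_re_le_norm _).trans (norm_inner_le_norm (𝕜 := ℂ) x y))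
    have := hP x
    nlinarith
  rw [inv_mul_eq_div, le_div_iff₀ hc]
  rcases (norm_nonneg x).eq_or_lt with h0 | h0
  · rw [← h0]; simp
  · refine le_of_mul_le_mul_left ?_ h0
    nlinarith

theorem continuousAt_ringInverse_of_isUnit {R : Type*} [NormedRing R] [HasSummableGeomSeries R]
    {x : R} (hx : IsUnit x) : ContinuousAt Ring.inverse x := by
  obtain ⟨u, rfl⟩ := hx
  exact NormedRing.inverse_continuousAt u

theorem continuousOn_bddResolvent_ray {P : H →L[ℂ] H} {φ : ℝ} (hφ : Real.cos φ < 0)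
    (hP : ∀ x, 0 ≤ (⟪x, P x⟫_ℂ).re) :
    ContinuousOn (fun r => bddResolvent P (ray φ r)) (Ioi 0) := by
  intro r hr
  have hu : IsUnit (algebraMap ℂ (H →L[ℂ] H) (ray φ r) - P) :=
    isUnit_sub_of_accretive (c := 0) (by simpa using hP) (by rw [re_ray]; exact mul_neg_of_pos_of_neg hr hφ)
  refine ContinuousAt.continuousWithinAt ?_
  refine ContinuousAt.comp (g := Ring.inverse) (continuousAt_ringInverse_of_isUnit hu) ?_
  exact (((continuous_algebraMap ℂ (H →L[ℂ] H)).comp (continuous_ray φ)).sub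
    continuous_const).continuousAt

theorem norm_bddResolvent_ray_le {P : H →L[ℂ] H} {φ : ℝ} (hφ : Real.cos φ < 0)
    (hP : ∀ x, 0 ≤ (⟪x, P x⟫_ℂ).re) {r : ℝ} (hr : 0 < r) :
    ‖bddResolvent P (ray φ r)‖ ≤ |Real.cos φ|⁻¹ / r := by
  refine (norm_bddResolvent_le (c := 0) (by simpa using hP)
    (by rw [re_ray]; exact mul_neg_of_pos_of_neg hr hφ)).trans ?_
  rw [re_ray, abs_of_neg hφ, zero_sub, ← mul_neg, mul_inv, mul_comm, div_eq_mul_inv]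

theorem hasDerivAt_bddResolvent_smul_add (S T : H →L[ℂ] H) (l z : ℂ)
    (hu : IsUnit (algebraMap ℂ (H →L[ℂ] H) l - (z • S + T))) :
    HasDerivAt (fun z : ℂ => bddResolvent (z • S + T) l)
      (bddResolvent (z • S + T) l * S * bddResolvent (z • S + T) l) z := by
  obtain ⟨u, hu⟩ := hu
  have h1 : HasDerivAt (fun z : ℂ => algebraMap ℂ (H →L[ℂ] H) l - (z • S + T)) (-S) z := by
    have := (((hasDerivAt_id z).smul_const S).add_const T).const_sub (algebraMap ℂ (H →L[ℂ] H) l)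
    simpa using this
  have h2 := hasFDerivAt_ringInverse (𝕜 := ℂ) u
  rw [hu] at h2
  have h3 := h2.comp_hasDerivAt z h1
  refine h3.congr_deriv ?_
  rw [bddResolvent, ← hu, Ring.inverse_unit]
  simp

theorem re_inner_eq_zero_of_star_eq_neg {N : H →L[ℂ] H} (hN : star N = -N) (x : H) :
    (⟪x, N x⟫_ℂ).re = 0 := by
  have h1 : ⟪x, N x⟫_ℂ = -⟪N x, x⟫_ℂ := by
    rw [← ContinuousLinearMap.adjoint_inner_left, ← ContinuousLinearMap.star_eq_adjoint, hN,
      _root_.neg_apply, inner_neg_left]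
  have h2 := inner_re_symm (𝕜 := ℂ) x (N x)
  have h3 := congrArg Complex.re h1
  simp only [neg_re] at h3
  change (⟪x, N x⟫_ℂ).re = (⟪N x, x⟫_ℂ).re at h2
  linarith

/-- For a skew-adjoint bounded operator `N` the Dunford integral is the continuous functional
calculus of `N`, applied to the scalar Dunford integrals; by Cauchy's formula these are the values
of `f` on the imaginary axis. Hence `‖f(N)‖ ≤ sup |f|`. -/
theorem norm_sectorIntegral_le_of_skew {N : H →L[ℂ] H} (hN : star N = -N) {θ ν : ℝ} {f : ℂ → ℂ}
    (hf : MemHZero θ f) (hν : Real.pi / 2 < ν) (hνθ : ν < θ) (hθ : θ < Real.pi) {M : ℝ}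
    (hM : ∀ z ∈ sector θ, ‖f z‖ ≤ M) : ‖sectorIntegral f ν (bddResolvent N)‖ ≤ M := by
  have hre := re_inner_eq_zero_of_star_eq_neg hN
  have hnormal : IsStarNormal N := ⟨by rw [hN]; exact (Commute.refl N).neg_left⟩
  have hspec : ∀ w ∈ _root_.spectrum ℂ N, w.re = 0 := by
    intro w hw
    by_contra h
    apply hw
    rw [spectrum.mem_resolventSet_iff]
    rcases lt_or_gt_of_ne h with h | h
    · exact isUnit_sub_of_accretive (c := 0) (by simp [hre]) h
    · have := isUnit_sub_of_accretive (P := -N) (c := 0) (z := -w) (by simp [hre]) (by simpa using h)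
      rw [map_neg, ← neg_sub', IsUnit.neg_iff] at this
      exact this
  have hM0 : 0 ≤ M := (norm_nonneg _).trans
    (hM (ray 0 1) (ray_mem_sector (by simp; linarith [Real.pi_pos]) hθ.le one_pos))
  have hcos : Real.cos ν < 0 :=
    Real.cos_neg_of_pi_div_two_lt_of_lt hν (by linarith [Real.pi_pos])
  have habs : |ν| < θ := by rwa [abs_of_pos (by linarith [Real.pi_pos])]
  -- the Bochner integral commutes with the continuous functional calculus
  have hray : ∀ φ : ℝ, |φ| < θ → Real.cos φ < 0 → rayIntegral f φ (bddResolvent N) =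
      cfc (fun w : ℂ => rayIntegral f φ fun l => (l - w)⁻¹) N := by
    intro φ hφ hφ'
    obtain ⟨b, hb, hbf⟩ := hf.exists_integrable_bound hθ.le
    have hne : ∀ r, 0 < r → ∀ w ∈ _root_.spectrum ℂ N, ray φ r - w ≠ 0 := fun r hr w hw =>
      ray_sub_ne_zero hr hφ' (hspec w hw).ge
    simp only [rayIntegral]
    rw [cfc_setIntegral measurableSet_Ioi (fun r w => (f (ray φ r) * exp ((φ : ℂ) * I)) •
      (ray φ r - w)⁻¹) (fun r => |Real.cos φ|⁻¹ * b r) N]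
    · refine setIntegral_congr_fun measurableSet_Ioi fun r hr => ?_
      have hc : ContinuousOn (fun w : ℂ => ray φ r - w) (_root_.spectrum ℂ N) := by fun_prop
      rw [cfc_smul _ (fun w : ℂ => (ray φ r - w)⁻¹) _ (hc.inv₀ (hne r hr)), cfc_inv _ _ (hne r hr) hc, bddResolvent]
      congr 2
      rw [cfc_sub _ _ _ (by fun_prop) (by fun_prop), cfc_const _ _, cfc_id' ℂ N]
    · refine ContinuousOn.smul (f := fun p : ℝ × ℂ => f (ray φ p.1) * exp ((φ : ℂ) * I))
        (g := fun p : ℝ × ℂ => (ray φ p.1 - p.2)⁻¹) ?_ ?_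
      · exact ((hf.continuousOn_ray hθ.le hφ).mul continuousOn_const).comp continuousOn_fst
          fun p hp => hp.1
      · refine ContinuousOn.inv₀ ?_ fun p hp => hne p.1 hp.1 p.2 hp.2
        exact ((continuous_ray φ).comp continuous_fst).continuousOn.sub continuousOn_snd
    · filter_upwards [ae_restrict_mem measurableSet_Ioi] with r hr w hw
      have hr : 0 < r := hr
      have hcp := abs_pos.2 hφ'.ne
      rw [norm_smul, norm_mul, norm_exp_ofReal_mul_I, mul_one, norm_inv]
      calc _ ≤ ‖f (ray φ r)‖ * (r * |Real.cos φ|)⁻¹ := by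
            gcongr
            exact mul_abs_cos_le_norm_ray_sub hr hφ' (hspec w hw).ge
        _ = |Real.cos φ|⁻¹ * (‖f (ray φ r)‖ / r) := by field_simp
        _ ≤ _ := by gcongr; exact hbf φ hφ r hr
    · exact (hb.const_mul _).hasFiniteIntegral
  have hcont : ∀ φ : ℝ, |φ| < θ → Real.cos φ < 0 → ContinuousOn
      (fun w : ℂ => rayIntegral f φ fun l => (l - w)⁻¹) {w | 0 ≤ w.re} := by
    intro φ hφ hφ' w hw
    refine tendsto_rayIntegral (κ := |Real.cos φ|⁻¹) hf hθ.le hφ ?_ ?_ ?_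
    · filter_upwards [self_mem_nhdsWithin] with w hw
      exact ContinuousOn.inv₀ ((continuous_ray φ).sub continuous_const).continuousOn
        fun r hr => ray_sub_ne_zero hr hφ' hw
    · filter_upwards [self_mem_nhdsWithin] with w hw r hr
      rw [norm_inv, div_eq_mul_inv, ← mul_inv, mul_comm]
      exact inv_anti₀ (mul_pos hr (abs_pos.2 hφ'.ne)) (mul_abs_cos_le_norm_ray_sub hr hφ' hw)
    · intro r hr
      exact ((continuous_const.sub continuous_id).continuousAt.inv₀
        (ray_sub_ne_zero hr hφ' hw)).continuousWithinAt
  have hcos' : Real.cos (-ν) < 0 := by rwa [Real.cos_neg]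
  have habs' : |-ν| < θ := by rwa [abs_neg]
  have hsub : _root_.spectrum ℂ N ⊆ {w | 0 ≤ w.re} := fun w hw => (hspec w hw).ge
  have hwhole : sectorIntegral f ν (bddResolvent N) =
      cfc (fun w : ℂ => sectorIntegral f ν fun l => (l - w)⁻¹) N := by
    simp only [sectorIntegral]
    rw [hray _ habs hcos, hray _ habs' hcos',
      cfc_smul _ (fun w : ℂ => (rayIntegral f (-ν) fun l => (l - w)⁻¹) -
        rayIntegral f ν fun l => (l - w)⁻¹) _
        (((hcont _ habs' hcos').mono hsub).sub ((hcont _ habs hcos).mono hsub)),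
      cfc_sub _ _ _ ((hcont _ habs' hcos').mono hsub) ((hcont _ habs hcos).mono hsub)]
  rw [hwhole]
  refine norm_cfc_le hM0 fun w hw => ?_
  have hgood : ∀ w : ℂ, 0 ≤ w.re → w ≠ 0 → ‖sectorIntegral f ν fun l => (l - w)⁻¹‖ ≤ M := by
    intro w hw hw0
    rw [hf.sectorIntegral_inv hν hνθ hθ hw hw0]
    refine hM w ⟨hw0, ?_⟩
    have := abs_arg_le_pi_div_two_iff.2 hw
    linarith
  rcases eq_or_ne w 0 with rfl | h0
  · -- the value at `0` is the limit of the values along the positive axis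
    have hc : ContinuousOn (fun w : ℂ => sectorIntegral f ν fun l => (l - w)⁻¹) {w | 0 ≤ w.re} :=
      ((hcont _ habs' hcos').sub (hcont _ habs hcos)).const_smul (2 * (Real.pi : ℂ) * I)⁻¹
    have ht : Tendsto (fun t : ℝ => (t : ℂ)) (𝓝[>] 0) (𝓝[{w : ℂ | 0 ≤ w.re}] 0) := by
      refine tendsto_nhdsWithin_iff.2 ⟨?_, ?_⟩
      · exact (continuous_ofReal.tendsto' 0 0 (by simp)).mono_left nhdsWithin_le_nhds
      · filter_upwards [self_mem_nhdsWithin] with t ht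
        simpa using le_of_lt ht
    have hl := ((hc 0 (by simp)).tendsto.comp ht).norm
    refine le_of_tendsto hl ?_
    filter_upwards [self_mem_nhdsWithin] with t ht
    exact hgood t (by simpa using le_of_lt ht) (by simpa using (ne_of_gt ht))
  · exact hgood w (hspec w hw).ge h0

end Bounded

end TimeGraph

/-! ### The `H^∞` bound for bounded strictly accretive operators -/

namespace TimeGraph

open Complex Filter Topology

section Accretive

variable {H : Type*} [NormedAddCommGroup H] [InnerProductSpace ℂ H] [CompleteSpace H]

open scoped InnerProductSpace

variable {θ φ c : ℝ} {f : ℂ → ℂ} {S T : H →L[ℂ] H}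

theorem re_inner_smul_add_apply (S T : H →L[ℂ] H)
    (hS : IsSelfAdjoint S) (hT : star T = -T) (z : ℂ) (x : H) :
    (⟪x, (z • S + T) x⟫_ℂ).re = z.re * (⟪x, S x⟫_ℂ).re := by
  have hT' := re_inner_eq_zero_of_star_eq_neg hT x
  have hS' : (⟪x, S x⟫_ℂ).im = 0 := by
    have h1 : ⟪x, S x⟫_ℂ = ⟪S x, x⟫_ℂ := by
      rw [← ContinuousLinearMap.adjoint_inner_left, ← ContinuousLinearMap.star_eq_adjoint, hS.star_eq]
    rw [← conj_eq_iff_im]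
    rw [inner_conj_symm, ← h1]
  rw [_root_.add_apply, _root_.smul_apply, inner_add_right, inner_smul_right, add_re, hT', mul_re,
    hS']
  ring

/-- The Dunford integral over one ray is analytic along the pencil `z S + T`. -/
theorem differentiableAt_rayIntegral_pencil (hf : MemHZero θ f) (hθ : θ ≤ Real.pi) (hφ : |φ| < θ)
    (hφ' : Real.cos φ < 0) (hS : IsSelfAdjoint S) (hT : star T = -T) (hc : 0 < c)
    (hSc : ∀ x, c * ‖x‖ ^ 2 ≤ (⟪x, S x⟫_ℂ).re) {z₀ : ℂ} (hz₀ : 0 < z₀.re) :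
    DifferentiableAt ℂ (fun z : ℂ => rayIntegral f φ (bddResolvent (z • S + T))) z₀ := by
  obtain ⟨b, hb, hbf⟩ := hf.exists_integrable_bound hθ
  have hacc : ∀ z : ℂ, 0 ≤ z.re → ∀ x, c * z.re * ‖x‖ ^ 2 ≤ (⟪x, (z • S + T) x⟫_ℂ).re := by
    intro z hz x
    rw [re_inner_smul_add_apply S T hS hT]
    nlinarith [hSc x]
  have hacc0 : ∀ z : ℂ, 0 ≤ z.re → ∀ x, 0 ≤ (⟪x, (z • S + T) x⟫_ℂ).re := fun z hz x =>
    (by positivity : (0 : ℝ) ≤ c * z.re * ‖x‖ ^ 2).trans (hacc z hz x)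
  have hball : ∀ z ∈ Metric.ball z₀ (z₀.re / 2), z₀.re / 2 ≤ z.re := by
    intro z hz
    rw [Metric.mem_ball, dist_eq] at hz
    have h1 := (abs_re_le_norm (z - z₀)).trans hz.le
    rw [sub_re] at h1
    have := (abs_le.1 h1).1
    linarith
  have hcont : ∀ z : ℂ, 0 ≤ z.re → ContinuousOn (fun r => bddResolvent (z • S + T) (ray φ r))
      (Ioi 0) := fun z hz => continuousOn_bddResolvent_ray hφ' (hacc0 z hz)
  have hw : ContinuousOn (fun r => f (ray φ r) * exp ((φ : ℂ) * I)) (Ioi 0) :=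
    (hf.continuousOn_ray hθ hφ).mul continuousOn_const
  have hbd : ∀ z : ℂ, 0 ≤ z.re → ∀ r, 0 < r →
      ‖bddResolvent (z • S + T) (ray φ r)‖ ≤ |Real.cos φ|⁻¹ / r := fun z hz r hr =>
    norm_bddResolvent_ray_le hφ' (hacc0 z hz) hr
  refine (hasDerivAt_integral_of_dominated_loc_of_deriv_le
    (F := fun (z : ℂ) r => (f (ray φ r) * exp ((φ : ℂ) * I)) • bddResolvent (z • S + T) (ray φ r))
    (F' := fun (z : ℂ) r => (f (ray φ r) * exp ((φ : ℂ) * I)) • (bddResolvent (z • S + T) (ray φ r) *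
      S * bddResolvent (z • S + T) (ray φ r)))
    (bound := fun r => |Real.cos φ|⁻¹ * ‖S‖ * (c * (z₀.re / 2))⁻¹ * b r)
    (Metric.ball_mem_nhds z₀ (by linarith : 0 < z₀.re / 2)) ?_ ?_ ?_ ?_ ?_ ?_).2.differentiableAt
  · filter_upwards [Metric.ball_mem_nhds z₀ (by linarith : 0 < z₀.re / 2)] with z hz
    exact (hw.smul (hcont z (by linarith [hball z hz]))).aestronglyMeasurable measurableSet_Ioi
  · exact integrableOn_rayIntegrand hf hθ hφ (hcont z₀ hz₀.le) (hbd z₀ hz₀.le)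
  · have := hcont z₀ hz₀.le
    exact (hw.smul ((this.mul continuousOn_const).mul this)).aestronglyMeasurable measurableSet_Ioi
  · filter_upwards [ae_restrict_mem measurableSet_Ioi] with r hr z hz
    have hr : 0 < r := hr
    have hz' := hball z hz
    have hz0 : 0 < z.re := by linarith
    have h1 := hbd z hz0.le r hr
    have h2 : ‖bddResolvent (z • S + T) (ray φ r)‖ ≤ (c * (z₀.re / 2))⁻¹ := by
      have hneg : (ray φ r).re < 0 := by rw [re_ray]; exact mul_neg_of_pos_of_neg hr hφ'
      have hcz : 0 < c * z.re := mul_pos hc hz0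
      refine (norm_bddResolvent_le (hacc z hz0.le) (by linarith)).trans ?_
      refine inv_anti₀ (by positivity) ?_
      nlinarith
    have h3 := norm_nonneg (bddResolvent (z • S + T) (ray φ r))
    rw [norm_smul, norm_mul, norm_exp_ofReal_mul_I, mul_one]
    calc _ ≤ ‖f (ray φ r)‖ * ((|Real.cos φ|⁻¹ / r) * ‖S‖ * (c * (z₀.re / 2))⁻¹) := by
          gcongr
          refine (norm_mul_le _ _).trans ?_
          refine mul_le_mul ((norm_mul_le _ _).trans ?_) h2 h3 (by positivity)
          gcongr
      _ = |Real.cos φ|⁻¹ * ‖S‖ * (c * (z₀.re / 2))⁻¹ * (‖f (ray φ r)‖ / r) := by ring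
      _ ≤ _ := by gcongr; exact hbf φ hφ r hr
  · exact hb.const_mul _
  · filter_upwards [ae_restrict_mem measurableSet_Ioi] with r hr z hz
    refine HasDerivAt.const_smul (f (ray φ r) * exp ((φ : ℂ) * I))
      (hasDerivAt_bddResolvent_smul_add S T _ z ?_)
    refine isUnit_sub_of_accretive (c := 0) (by simpa using hacc0 z (by linarith [hball z hz])) ?_
    rw [re_ray]
    exact mul_neg_of_pos_of_neg hr hφ'

theorem continuousOn_rayIntegral_pencil (hf : MemHZero θ f) (hθ : θ ≤ Real.pi) (hφ : |φ| < θ)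
    (hφ' : Real.cos φ < 0) (hacc : ∀ z : ℂ, 0 ≤ z.re → ∀ x, 0 ≤ (⟪x, (z • S + T) x⟫_ℂ).re) :
    ContinuousOn (fun z : ℂ => rayIntegral f φ (bddResolvent (z • S + T))) {z | 0 ≤ z.re} := by
  intro z hz
  refine tendsto_rayIntegral (κ := |Real.cos φ|⁻¹) hf hθ hφ ?_ ?_ ?_
  · filter_upwards [self_mem_nhdsWithin] with w hw
    exact continuousOn_bddResolvent_ray hφ' (hacc w hw)
  · filter_upwards [self_mem_nhdsWithin] with w hw r hr
    exact norm_bddResolvent_ray_le hφ' (hacc w hw) hr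
  · intro r hr
    have hu : IsUnit (algebraMap ℂ (H →L[ℂ] H) (ray φ r) - (z • S + T)) :=
      isUnit_sub_of_accretive (c := 0) (by simpa using hacc z hz)
        (by rw [re_ray]; exact mul_neg_of_pos_of_neg hr hφ')
    refine ContinuousAt.continuousWithinAt ?_
    refine ContinuousAt.comp (g := Ring.inverse)
      (f := fun z : ℂ => algebraMap ℂ (H →L[ℂ] H) (ray φ r) - (z • S + T))
      (continuousAt_ringInverse_of_isUnit hu) ?_
    fun_prop

theorem norm_rayIntegral_le {E : Type*} [NormedAddCommGroup E] [NormedSpace ℂ E] {b : ℝ → ℝ}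
    {κ : ℝ} (hκ0 : 0 ≤ κ) (hb : IntegrableOn b (Ioi 0))
    (hbf : ∀ r : ℝ, 0 < r → ‖f (ray φ r)‖ / r ≤ b r)
    {g : ℂ → E} (hκ : ∀ r, 0 < r → ‖g (ray φ r)‖ ≤ κ / r) :
    ‖rayIntegral f φ g‖ ≤ ∫ r in Ioi (0 : ℝ), κ * b r := by
  refine norm_integral_le_of_norm_le (hb.const_mul κ) ?_
  filter_upwards [ae_restrict_mem measurableSet_Ioi] with r hr
  have hr : 0 < r := hr
  rw [norm_smul, norm_mul, norm_exp_ofReal_mul_I, mul_one]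
  calc _ ≤ ‖f (ray φ r)‖ * (κ / r) := by gcongr; exact hκ r hr
    _ = κ * (‖f (ray φ r)‖ / r) := by ring
    _ ≤ _ := by gcongr; exact hbf r hr

/-- The `H^∞` bound for a bounded operator `P` with strictly positive real part. In the pencil
`z (P + P*)/2 + (P - P*)/2` the operator `P` sits at `z = 1` and the operators with `z ∈ iℝ` are
skew-adjoint, so that the Phragmén-Lindelöf principle carries the bound for skew-adjoint operators
over to `P`. -/
theorem norm_sectorIntegral_le_of_accretive {P : H →L[ℂ] H} (hc : 0 < c)
    (hP : ∀ x, c * ‖x‖ ^ 2 ≤ (⟪x, P x⟫_ℂ).re) {ν : ℝ}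
    (hf : MemHZero θ f) (hν : Real.pi / 2 < ν) (hνθ : ν < θ) (hθ : θ < Real.pi) {M : ℝ}
    (hM : ∀ z ∈ sector θ, ‖f z‖ ≤ M) : ‖sectorIntegral f ν (bddResolvent P)‖ ≤ M := by
  set S : H →L[ℂ] H := (2⁻¹ : ℂ) • (P + star P) with hSdef
  set T : H →L[ℂ] H := (2⁻¹ : ℂ) • (P - star P) with hTdef
  have hS : IsSelfAdjoint S := by
    rw [IsSelfAdjoint, hSdef, star_smul, star_add, star_star, add_comm]
    simp
  have hT : star T = -T := by
    rw [hTdef, star_smul, star_sub, star_star, ← smul_neg, neg_sub]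
    simp
  have hPST : (1 : ℂ) • S + T = P := by
    rw [one_smul, hSdef, hTdef, ← smul_add, add_add_sub_cancel, ← two_smul ℂ P, smul_smul]
    simp
  have hSc : ∀ x, c * ‖x‖ ^ 2 ≤ (⟪x, S x⟫_ℂ).re := by
    intro x
    have := re_inner_smul_add_apply S T hS hT 1 x
    rw [hPST, one_re, one_mul] at this
    rw [← this]
    exact hP x
  have hacc0 : ∀ z : ℂ, 0 ≤ z.re → ∀ x, 0 ≤ (⟪x, (z • S + T) x⟫_ℂ).re := by
    intro z hz x
    rw [re_inner_smul_add_apply S T hS hT]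
    exact mul_nonneg hz ((by positivity : (0 : ℝ) ≤ c * ‖x‖ ^ 2).trans (hSc x))
  have hcos : Real.cos ν < 0 :=
    Real.cos_neg_of_pi_div_two_lt_of_lt hν (by linarith [Real.pi_pos])
  have habs : |ν| < θ := by rwa [abs_of_pos (by linarith [Real.pi_pos])]
  have hcos' : Real.cos (-ν) < 0 := by rwa [Real.cos_neg]
  have habs' : |-ν| < θ := by rwa [abs_neg]
  set F : ℂ → (H →L[ℂ] H) := fun z => sectorIntegral f ν (bddResolvent (z • S + T)) with hF
  obtain ⟨b, hb, hbf⟩ := hf.exists_integrable_bound hθ.le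
  -- an a priori bound on the half plane, as the Phragmén-Lindelöf principle requires
  obtain ⟨D, hD⟩ : ∃ D, ∀ z : ℂ, 0 ≤ z.re → ‖F z‖ ≤ D := by
    refine ⟨‖(2 * (Real.pi : ℂ) * I)⁻¹‖ * ((∫ r in Ioi (0 : ℝ), |Real.cos (-ν)|⁻¹ * b r) +
      ∫ r in Ioi (0 : ℝ), |Real.cos ν|⁻¹ * b r), fun z hz => ?_⟩
    simp only [hF, sectorIntegral]
    rw [norm_smul]
    refine mul_le_mul_of_nonneg_left ((norm_sub_le _ _).trans (add_le_add
      (norm_rayIntegral_le (κ := |Real.cos (-ν)|⁻¹) (by positivity) hb (hbf _ habs') ?_)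
      (norm_rayIntegral_le (κ := |Real.cos ν|⁻¹) (by positivity) hb (hbf _ habs) ?_)))
      (norm_nonneg _)
    · exact fun r hr => norm_bddResolvent_ray_le hcos' (hacc0 z hz) hr
    · exact fun r hr => norm_bddResolvent_ray_le hcos (hacc0 z hz) hr
  have hd : DiffContOnCl ℂ F {z | 0 < z.re} := by
    refine ⟨fun z hz => ?_, ?_⟩
    · exact (((differentiableAt_rayIntegral_pencil hf hθ.le habs' hcos' hS hT hc hSc hz).sub
        (differentiableAt_rayIntegral_pencil hf hθ.le habs hcos hS hT hc hSc hz)).const_smul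
        (2 * (Real.pi : ℂ) * I)⁻¹).differentiableWithinAt
    · rw [closure_setOfPred_lt_re]
      exact ((continuousOn_rayIntegral_pencil hf hθ.le habs' hcos' hacc0).sub
        (continuousOn_rayIntegral_pencil hf hθ.le habs hcos hacc0)).const_smul
          (2 * (Real.pi : ℂ) * I)⁻¹
  have key := PhragmenLindelof.right_half_plane_of_bounded_on_real (f := F) (C := M) (z := 1) hd
    ⟨1, by norm_num, 0, ?_⟩ ?_ ?_ (by simp)
  · rw [hF] at key
    simpa only [hPST] using key
  · simp only [zero_mul, Real.exp_zero]
    refine Asymptotics.IsBigO.of_bound D ?_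
    filter_upwards [mem_inf_of_right (mem_principal_self {z : ℂ | 0 < z.re})] with z hz
    simpa using hD z (le_of_lt hz)
  · refine isBoundedUnder_of_eventually_le (a := D) ?_
    filter_upwards [eventually_ge_atTop 0] with x hx
    exact hD x (by simpa using hx)
  · intro y
    refine norm_sectorIntegral_le_of_skew ?_ hf hν hνθ hθ hM
    rw [star_add, star_smul, hS.star_eq, hT]
    simp
    abel

end Accretive

end TimeGraph

/-! ### m-accretive operators -/

namespace TimeGraph

open Complex Filter Topology

section MAccretive

variable {H : Type*} [NormedAddCommGroup H] [InnerProductSpace ℂ H]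

open scoped InnerProductSpace

/-- `A` is m-accretive: `Re ⟪y, A y⟫ ≥ 0` on the domain, and `1 + A` is surjective. -/
structure IsMAccretive (A : H →ₗ.[ℂ] H) : Prop where
  re_inner_nonneg : ∀ y : A.domain, 0 ≤ (⟪(y : H), A y⟫_ℂ).re
  surjective : ∀ x : H, ∃ y : A.domain, (y : H) + A y = x

variable {A : H →ₗ.[ℂ] H}

theorem re_inner_self_eq_norm_sq (x : H) : (⟪x, x⟫_ℂ).re = ‖x‖ ^ 2 :=
  inner_self_eq_norm_sq (𝕜 := ℂ) x

theorem IsMAccretive.norm_sq_le (hA : IsMAccretive A) (y : A.domain) :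
    ‖(y : H)‖ ^ 2 ≤ (⟪(y : H), (y : H) + A y⟫_ℂ).re := by
  rw [inner_add_right, add_re, re_inner_self_eq_norm_sq]
  linarith [hA.re_inner_nonneg y]

theorem IsMAccretive.norm_le (hA : IsMAccretive A) (y : A.domain) :
    ‖(y : H)‖ ≤ ‖(y : H) + A y‖ := by
  have h1 := (hA.norm_sq_le y).trans ((re_le_norm _).trans (norm_inner_le_norm _ _))
  rcases (norm_nonneg (y : H)).eq_or_lt with h0 | h0
  · rw [← h0]; exact norm_nonneg _
  · exact le_of_mul_le_mul_left (by rwa [← sq]) h0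

/-- The bounded operator `R = (1 + A)⁻¹`. -/
theorem IsMAccretive.exists_inverse (hA : IsMAccretive A) : ∃ R : H →L[ℂ] H,
    (∀ x, ∃ h : R x ∈ A.domain, A ⟨R x, h⟩ = x - R x) ∧
    ∀ y : A.domain, R ((y : H) + A y) = y := by
  let g : A.domain →ₗ[ℂ] H := A.domain.subtype + A.toFun
  have hg : ∀ y, g y = (y : H) + A y := fun y => rfl
  have hbij : Function.Bijective g := by
    refine ⟨(injective_iff_map_eq_zero g).2 fun y hy => ?_, fun x => ?_⟩
    · have := hA.norm_le y
      rw [← hg, hy, norm_zero] at this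
      exact Subtype.ext (norm_le_zero_iff.1 this)
    · exact hA.surjective x
  let e := LinearEquiv.ofBijective g hbij
  have he : ∀ x, g (e.symm x) = x := fun x => e.apply_symm_apply x
  let R : H →L[ℂ] H := (A.domain.subtype ∘ₗ e.symm.toLinearMap).mkContinuous 1 (by
    intro x
    rw [one_mul]
    have := hA.norm_le (e.symm x)
    rw [← hg, he] at this
    exact this)
  have hR : ∀ x, R x = (e.symm x : H) := fun x => rfl
  refine ⟨R, fun x => ?_, fun y => ?_⟩
  · refine ⟨(e.symm x).2, ?_⟩
    have := he x
    rw [hg] at this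
    rw [eq_sub_iff_add_eq, add_comm]
    exact this
  · rw [← hg, hR]
    have : e.symm (g y) = y := e.symm_apply_apply y
    rw [this]

/-- The resolvent estimate `‖(z - A)⁻¹‖ ≤ 1 / |Re z|` in the left half plane. -/
theorem norm_le_of_isResolventAt (hA : IsMAccretive A) {z : ℂ} (hz : z.re < 0) {S : H →L[ℂ] H}
    (hS : IsResolventAt A z S) : ‖S‖ ≤ (-z.re)⁻¹ := by
  have hc : 0 < -z.re := by linarith
  refine ContinuousLinearMap.opNorm_le_bound _ (by positivity) fun y => ?_
  obtain ⟨h, hy⟩ := hS.1 y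
  have h1 : (⟪S y, y⟫_ℂ).re = z.re * ‖S y‖ ^ 2 - (⟪S y, A ⟨S y, h⟩⟫_ℂ).re := by
    have e : ⟪S y, y⟫_ℂ = ⟪S y, z • S y - A ⟨S y, h⟩⟫_ℂ := by rw [hy]
    rw [e, inner_sub_right, inner_smul_right, sub_re, inner_self_eq_norm_sq_to_K]
    congr 1
    change (z * ((‖S y‖ : ℝ) : ℂ) ^ 2).re = _
    rw [← Complex.ofReal_pow]
    exact re_mul_ofReal _ _
  have h2 : -z.re * ‖S y‖ ^ 2 ≤ ‖S y‖ * ‖y‖ := by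
    have h3 := (neg_le_abs _).trans ((abs_re_le_norm _).trans (norm_inner_le_norm (𝕜 := ℂ) (S y) y))
    have := hA.re_inner_nonneg ⟨S y, h⟩
    simp only at this
    nlinarith
  rw [inv_mul_eq_div, le_div_iff₀ hc]
  rcases (norm_nonneg (S y)).eq_or_lt with h0 | h0
  · rw [← h0]; simp
  · refine le_of_mul_le_mul_left ?_ h0
    nlinarith

theorem isClosed_of_isResolventAt {z : ℂ} {S : H →L[ℂ] H} (hS : IsResolventAt A z S) :
    A.IsClosed := by
  have : (A.graph : Set (H × H)) = {p | S (z • p.1 - p.2) = p.1} := by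
    ext ⟨x, y⟩
    simp only [SetLike.mem_coe, LinearPMap.mem_graph_iff, Set.mem_ofPred_eq]
    constructor
    · rintro ⟨w, rfl, rfl⟩
      exact hS.2 w
    · intro h
      obtain ⟨hd, h'⟩ := hS.1 (z • x - y)
      refine ⟨⟨_, hd⟩, h, ?_⟩
      have hz : z • S (z • x - y) = z • x := by rw [h]
      rw [sub_eq_sub_iff_add_eq_add, hz] at h'
      exact (add_left_cancel h').symm
  rw [LinearPMap.IsClosed, this]
  exact isClosed_eq (by fun_prop) (by fun_prop)

theorem resolvent_eq_of_isResolventAt {z : ℂ} {S : H →L[ℂ] H} (hS : IsResolventAt A z S) :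
    resolvent A z = S :=
  (isResolventAt_resolvent ⟨S, hS⟩).unique hS

variable [CompleteSpace H]

/-- An element `y + A y` orthogonal to the domain is `0`, since `‖y‖² ≤ Re ⟪y, y + A y⟫`. -/
theorem IsMAccretive.dense (hA : IsMAccretive A) : Dense (A.domain : Set H) := by
  rw [Submodule.dense_iff_topologicalClosure_eq_top, Submodule.topologicalClosure_eq_top_iff,
    Submodule.eq_bot_iff]
  intro x hx
  obtain ⟨y, rfl⟩ := hA.surjective x
  have h1 := hA.norm_sq_le y
  rw [(Submodule.mem_orthogonal _ _).1 hx y y.2, zero_re] at h1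
  have h2 : (y : H) = 0 := by
    have : ‖(y : H)‖ = 0 := by nlinarith [norm_nonneg (y : H)]
    exact norm_eq_zero.1 this
  have h3 : y = 0 := Subtype.ext h2
  rw [h3]
  simp

variable {R : H →L[ℂ] H}

/-- The Cayley transform `1 - 2R` is a contraction, and `(z + 1) R - 1` is half of
`(z - 1) - (z + 1) (1 - 2R)`, which is invertible since `|z + 1| < |z - 1|`. -/
theorem isUnit_smul_sub_one (hA : IsMAccretive A)
    (hR : ∀ x, ∃ h : R x ∈ A.domain, A ⟨R x, h⟩ = x - R x) {z : ℂ} (hz : z.re < 0) :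
    IsUnit ((z + 1) • R - 1) := by
  have hT : ‖(1 : H →L[ℂ] H) - (2 : ℂ) • R‖ ≤ 1 := by
    refine ContinuousLinearMap.opNorm_le_bound _ zero_le_one fun x => ?_
    obtain ⟨h, hx⟩ := hR x
    have h1 := hA.norm_sq_le ⟨R x, h⟩
    simp only [hx, add_sub_cancel] at h1
    rw [one_mul]
    refine le_of_sq_le_sq ?_ (norm_nonneg _)
    have h2 := norm_sub_sq (𝕜 := ℂ) x ((2 : ℂ) • R x)
    rw [inner_smul_right, norm_smul] at h2
    have h3 : (⟪x, R x⟫_ℂ).re = (⟪R x, x⟫_ℂ).re := inner_re_symm (𝕜 := ℂ) _ _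
    have h4 : RCLike.re ((2 : ℂ) * ⟪x, R x⟫_ℂ) = 2 * (⟪R x, x⟫_ℂ).re := by
      rw [← h3]
      change ((2 : ℂ) * ⟪x, R x⟫_ℂ).re = _
      simp
    rw [h4, norm_ofNat] at h2
    have h5 : ((1 : H →L[ℂ] H) - (2 : ℂ) • R) x = x - (2 : ℂ) • R x := rfl
    rw [h5, h2]
    nlinarith
  have hlt : ‖z + 1‖ < ‖z - 1‖ := by
    refine lt_of_pow_lt_pow_left₀ 2 (norm_nonneg _) ?_
    rw [← normSq_eq_norm_sq, ← normSq_eq_norm_sq, normSq_apply, normSq_apply]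
    simp
    nlinarith
  have hmem : (z - 1) ∈ _root_.resolventSet ℂ ((z + 1) • ((1 : H →L[ℂ] H) - (2 : ℂ) • R)) := by
    refine spectrum.mem_resolventSet_of_norm_lt_mul ?_
    refine lt_of_le_of_lt ?_ hlt
    rw [norm_smul, mul_assoc]
    refine mul_le_of_le_one_right (norm_nonneg _) ?_
    exact mul_le_one₀ hT (norm_nonneg _) ContinuousLinearMap.norm_id_le
  rw [spectrum.mem_resolventSet_iff] at hmem
  have e : algebraMap ℂ (H →L[ℂ] H) (z - 1) - (z + 1) • ((1 : H →L[ℂ] H) - (2 : ℂ) • R)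
      = (2 : ℂ) • ((z + 1) • R - 1) := by
    rw [Algebra.algebraMap_eq_smul_one]
    module
  rw [e] at hmem
  have := hmem.smul (Units.mk0 (2⁻¹ : ℂ) (by norm_num))
  rw [Units.smul_def, Units.val_mk0, smul_smul] at this
  simpa using this

/-- The resolvent of `A` in terms of `R = (1 + A)⁻¹`. -/
theorem isResolventAt_of_inverse (hA : IsMAccretive A)
    (hR : ∀ x, ∃ h : R x ∈ A.domain, A ⟨R x, h⟩ = x - R x)
    (hR' : ∀ y : A.domain, R ((y : H) + A y) = y) {z : ℂ} (hz : z.re < 0) :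
    IsResolventAt A z (R * Ring.inverse ((z + 1) • R - 1)) := by
  have hu := isUnit_smul_sub_one hA hR hz
  set V := Ring.inverse ((z + 1) • R - 1) with hV
  constructor
  · intro x
    obtain ⟨h, hx⟩ := hR (V x)
    refine ⟨h, ?_⟩
    have h1 : ((z + 1) • R - 1) (V x) = x := by
      rw [← mul_apply_eq_comp, Ring.mul_inverse_cancel _ hu, one_apply_eq_self]
    have h2 : ((z + 1) • R - 1) (V x) = (z + 1) • R (V x) - V x := rfl
    change z • R (V x) - A ⟨R (V x), h⟩ = x
    rw [hx]
    rw [h2] at h1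
    refine Eq.trans ?_ h1
    module
  · intro y
    have h1 : z • (y : H) - A y = ((z + 1) • R - 1) ((y : H) + A y) := by
      have : ((z + 1) • R - 1) ((y : H) + A y) = (z + 1) • R ((y : H) + A y) - ((y : H) + A y) :=
        rfl
      rw [this, hR']
      module
    rw [h1, mul_apply_eq_comp, ← mul_apply_eq_comp V, Ring.inverse_mul_cancel _ hu, one_apply_eq_self,
      hR']

/-- An m-accretive operator is sectorial of angle `π / 2`: its spectrum lies in the closed right
half plane, and `|λ| ‖(λ - A)⁻¹‖ ≤ |λ| / |Re λ|` is bounded on sectors around the negative axis. -/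
theorem IsMAccretive.isSectorial (hA : IsMAccretive A) : IsSectorial A (Real.pi / 2) := by
  obtain ⟨R, hR, hR'⟩ := hA.exists_inverse
  have hres : ∀ z : ℂ, z.re < 0 → IsResolventAt A z (R * Ring.inverse ((z + 1) • R - 1)) :=
    fun z hz => isResolventAt_of_inverse hA hR hR' hz
  refine ⟨by linarith [Real.pi_pos], by linarith [Real.pi_pos],
    isClosed_of_isResolventAt (hres (-1) (by simp)), hA.dense, ?_, ?_⟩
  · intro z hz
    have hz0 : 0 ≤ z.re := by
      by_contra h
      exact hz ⟨_, hres z (not_le.1 h)⟩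
    have ht : Tendsto (fun t : ℝ => z + t) (𝓝[>] 0) (𝓝 z) := by
      refine Tendsto.mono_left ?_ nhdsWithin_le_nhds
      exact Continuous.tendsto' (by fun_prop) _ _ (by simp)
    refine mem_closure_of_tendsto ht ?_
    filter_upwards [self_mem_nhdsWithin] with t ht
    have ht : 0 < t := ht
    have hp : 0 < (z + t).re := by simp; linarith
    refine ⟨fun h => by rw [h] at hp; simp at hp, ?_⟩
    exact abs_arg_lt_pi_div_two_iff.2 (Or.inl hp)
  · intro ν hν hν'
    have hcos : Real.cos ν < 0 :=
      Real.cos_neg_of_pi_div_two_lt_of_lt hν (by linarith [Real.pi_pos])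
    refine ⟨(-Real.cos ν)⁻¹, fun z hz harg => ?_⟩
    have hzn : 0 < ‖z‖ := norm_pos_iff.2 hz
    have hre : z.re ≤ ‖z‖ * Real.cos ν := by
      rw [← norm_mul_cos_arg z, ← Real.cos_abs]
      gcongr
      exact Real.cos_le_cos_of_nonneg_of_le_pi (by linarith [Real.pi_pos]) (abs_arg_le_pi z) harg
    have hneg : z.re < 0 := hre.trans_lt (mul_neg_of_pos_of_neg hzn hcos)
    rw [resolvent_eq_of_isResolventAt (hres z hneg), norm_smul]
    calc _ ≤ ‖z‖ * (-z.re)⁻¹ := by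
          gcongr
          exact norm_le_of_isResolventAt hA hneg (hres z hneg)
      _ ≤ ‖z‖ * (‖z‖ * -Real.cos ν)⁻¹ := by
          have : 0 < ‖z‖ * -Real.cos ν := mul_pos hzn (by linarith)
          gcongr
          linarith
      _ = _ := by
          have : -Real.cos ν ≠ 0 := by linarith
          field_simp

/-- A bounded strictly accretive operator whose resolvent is close to that of `A`: the inverse of
`1 + P` is `(R + δ) / (1 + 2δ)`, where `R = (1 + A)⁻¹`. -/
noncomputable def boundedApprox (R : H →L[ℂ] H) (δ : ℝ) : H →L[ℂ] H :=
  (1 + 2 * δ : ℂ) • Ring.inverse (R + (δ : ℂ) • 1) - 1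

theorem isUnit_add_smul_one (hpos : ∀ x, ‖R x‖ ^ 2 ≤ (⟪x, R x⟫_ℂ).re) {δ : ℝ} (hδ : 0 < δ) :
    IsUnit (R + (δ : ℂ) • (1 : H →L[ℂ] H)) := by
  have := isUnit_sub_of_accretive (P := R) (c := 0) (z := -δ)
    (by intro x; rw [zero_mul]; exact (sq_nonneg _).trans (hpos x)) (by simpa using hδ)
  rw [Algebra.algebraMap_eq_smul_one, ← IsUnit.neg_iff] at this
  convert this using 1
  module

/-- With `x = (R + δ) u` one has `P x = (1 + 2δ) u - x`, so the claim becomes a quadratic inequality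
in `u` and `R u`, which follows from `‖R u‖² ≤ Re ⟪u, R u⟫ ≤ ‖u‖²`. -/
theorem boundedApprox_accretive (hpos : ∀ x, ‖R x‖ ^ 2 ≤ (⟪x, R x⟫_ℂ).re) {δ : ℝ} (hδ : 0 < δ)
    (x : H) : δ / (1 + δ) * ‖x‖ ^ 2 ≤ (⟪x, boundedApprox R δ x⟫_ℂ).re := by
  have hu := isUnit_add_smul_one hpos hδ
  set W := R + (δ : ℂ) • (1 : H →L[ℂ] H) with hW
  obtain ⟨u, hux⟩ : ∃ u, Ring.inverse W x = u := ⟨_, rfl⟩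
  have hx : x = W u := by
    rw [← hux, ← mul_apply_eq_comp, Ring.mul_inverse_cancel _ hu, one_apply_eq_self]
  have hWu : W u = R u + (δ : ℂ) • u := rfl
  have e : boundedApprox R δ x = (1 + 2 * δ : ℂ) • u - x := by
    rw [← hux]; rfl
  have h3 : (⟪u, R u⟫_ℂ).re = (⟪R u, u⟫_ℂ).re := inner_re_symm (𝕜 := ℂ) _ _
  have hn : ‖x‖ ^ 2 = ‖R u‖ ^ 2 + 2 * δ * (⟪u, R u⟫_ℂ).re + δ ^ 2 * ‖u‖ ^ 2 := by
    rw [hx, hWu, norm_add_sq (𝕜 := ℂ), inner_smul_right, norm_smul, norm_real,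
      Real.norm_of_nonneg hδ.le]
    have : RCLike.re ((δ : ℂ) * ⟪R u, u⟫_ℂ) = δ * (⟪u, R u⟫_ℂ).re := by
      rw [h3]
      exact re_ofReal_mul _ _
    rw [this]
    ring
  have hi : (⟪x, boundedApprox R δ x⟫_ℂ).re =
      (1 + 2 * δ) * ((⟪u, R u⟫_ℂ).re + δ * ‖u‖ ^ 2) - ‖x‖ ^ 2 := by
    rw [e, inner_sub_right, inner_smul_right, sub_re, re_inner_self_eq_norm_sq]
    congr 1
    have : (1 + 2 * δ : ℂ) = ((1 + 2 * δ : ℝ) : ℂ) := by push_cast; rfl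
    rw [this, re_ofReal_mul]
    congr 1
    rw [hx, hWu, inner_add_left, inner_smul_left, conj_ofReal, add_re, re_ofReal_mul,
      re_inner_self_eq_norm_sq, h3]
  have h1 := hpos u
  -- `‖R‖ ≤ 1`
  have h2 : (⟪u, R u⟫_ℂ).re ≤ ‖u‖ ^ 2 := by
    have h4 : (⟪u, R u⟫_ℂ).re ≤ ‖u‖ * ‖R u‖ := (re_le_norm _).trans (norm_inner_le_norm _ _)
    nlinarith [norm_nonneg u, norm_nonneg (R u), sq_nonneg (‖u‖ - ‖R u‖)]
  have h5 : ‖x‖ ^ 2 ≤ (1 + δ) ^ 2 * ‖u‖ ^ 2 := by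
    rw [hn]
    nlinarith
  rw [div_mul_eq_mul_div, div_le_iff₀ (by positivity)]
  have h6 : (δ + δ ^ 2) * ‖u‖ ^ 2 ≤ (⟪x, boundedApprox R δ x⟫_ℂ).re := by
    rw [hi, hn]
    nlinarith
  have h7 : δ * ‖x‖ ^ 2 ≤ δ * ((1 + δ) ^ 2 * ‖u‖ ^ 2) := by gcongr
  nlinarith

/-- The resolvent of the approximating operator in a form that is continuous in `δ` at `δ = 0`,
where it becomes the resolvent of `A`. -/
theorem bddResolvent_boundedApprox (hpos : ∀ x, ‖R x‖ ^ 2 ≤ (⟪x, R x⟫_ℂ).re) {δ : ℝ} (hδ : 0 < δ)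
    {z : ℂ} (hz : z.re < 0) : bddResolvent (boundedApprox R δ) z =
      (R + (δ : ℂ) • 1) * Ring.inverse ((z + 1) • (R + (δ : ℂ) • 1) - (1 + 2 * δ : ℂ) • 1) := by
  have hu := isUnit_add_smul_one hpos hδ
  have hP : IsUnit (algebraMap ℂ (H →L[ℂ] H) z - boundedApprox R δ) := by
    refine isUnit_sub_of_accretive (c := 0) (fun x => ?_) hz
    rw [zero_mul]
    exact (by positivity : (0 : ℝ) ≤ δ / (1 + δ) * ‖x‖ ^ 2).trans (boundedApprox_accretive hpos hδ x)
  set W := R + (δ : ℂ) • (1 : H →L[ℂ] H) with hW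
  have hQ : (algebraMap ℂ (H →L[ℂ] H) z - boundedApprox R δ) * W =
      (z + 1) • W - (1 + 2 * δ : ℂ) • 1 := by
    rw [boundedApprox, ← hW, sub_mul, sub_mul, smul_mul_assoc, Ring.inverse_mul_cancel _ hu, one_mul,
      Algebra.algebraMap_eq_smul_one, smul_mul_assoc, one_mul]
    module
  rw [← hQ, bddResolvent]
  set Q := algebraMap ℂ (H →L[ℂ] H) z - boundedApprox R δ
  calc Ring.inverse Q = Ring.inverse Q * ((Q * W) * Ring.inverse (Q * W)) := by
        rw [Ring.mul_inverse_cancel _ (hP.mul hu), mul_one]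
    _ = (Ring.inverse Q * Q) * W * Ring.inverse (Q * W) := by simp only [mul_assoc]
    _ = _ := by rw [Ring.inverse_mul_cancel _ hP, one_mul]

/-- An m-accretive operator on a Hilbert space has a contractive `H^∞(Σ_θ)`-calculus for every
`θ > π / 2`. -/
theorem IsMAccretive.hasBoundedHInfty (hA : IsMAccretive A) {θ : ℝ} (hθ : Real.pi / 2 < θ)
    (hθ' : θ < Real.pi) : HasBoundedHInfty A θ := by
  refine ⟨hθ', Real.pi / 2, hθ, hA.isSectorial, 1, fun f hf ν hν hνθ => ?_⟩
  obtain ⟨R, hR, hR'⟩ := hA.exists_inverse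
  have hpos : ∀ x, ‖R x‖ ^ 2 ≤ (⟪x, R x⟫_ℂ).re := by
    intro x
    obtain ⟨h, hx⟩ := hR x
    have h1 := hA.norm_sq_le ⟨R x, h⟩
    simp only [hx, add_sub_cancel] at h1
    have h3 : (⟪x, R x⟫_ℂ).re = (⟪R x, x⟫_ℂ).re := inner_re_symm (𝕜 := ℂ) _ _
    rwa [h3]
  have hres : ∀ z : ℂ, z.re < 0 → resolvent A z = R * Ring.inverse ((z + 1) • R - 1) :=
    fun z hz => resolvent_eq_of_isResolventAt (isResolventAt_of_inverse hA hR hR' hz)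
  have hcos : Real.cos ν < 0 :=
    Real.cos_neg_of_pi_div_two_lt_of_lt hν (by linarith [Real.pi_pos])
  have habs : |ν| < θ := by rwa [abs_of_pos (by linarith [Real.pi_pos])]
  have hcos' : Real.cos (-ν) < 0 := by rwa [Real.cos_neg]
  have habs' : |-ν| < θ := by rwa [abs_neg]
  have hneg : ∀ φ : ℝ, Real.cos φ < 0 → ∀ r : ℝ, 0 < r → (ray φ r).re < 0 := by
    intro φ hφ r hr
    rw [re_ray]
    exact mul_neg_of_pos_of_neg hr hφ
  have hint : ∀ φ : ℝ, |φ| < θ → Real.cos φ < 0 → IntegrableOn (rayIntegrand A f φ) (Ioi 0) := by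
    intro φ hφ hφ'
    refine integrableOn_rayIntegrand (κ := |Real.cos φ|⁻¹) hf hθ'.le hφ ?_ ?_
    · have hc : ContinuousOn (fun r => R * Ring.inverse ((ray φ r + 1) • R - 1)) (Ioi 0) := by
        refine continuousOn_const.mul fun r hr => ContinuousAt.continuousWithinAt ?_
        refine ContinuousAt.comp (g := Ring.inverse) (f := fun r => (ray φ r + 1) • R - 1)
          (continuousAt_ringInverse_of_isUnit (isUnit_smul_sub_one hA hR (hneg φ hφ' r hr))) ?_
        have := continuous_ray φ
        fun_prop
      exact hc.congr fun r hr => hres _ (hneg φ hφ' r hr)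
    · intro r hr
      have h1 := isResolventAt_of_inverse hA hR hR' (hneg φ hφ' r hr)
      rw [resolvent_eq_of_isResolventAt h1]
      refine (norm_le_of_isResolventAt hA (hneg φ hφ' r hr) h1).trans ?_
      rw [re_ray, abs_of_neg hφ', ← mul_neg, mul_inv, mul_comm, div_eq_mul_inv]
  refine ⟨hint ν habs hcos, hint (-ν) habs' hcos', fun M hM => ?_⟩
  rw [one_mul]
  have hacc0 : ∀ δ : ℝ, 0 < δ → ∀ x, 0 ≤ (⟪x, boundedApprox R δ x⟫_ℂ).re := fun δ hδ x =>
    (by positivity : (0 : ℝ) ≤ δ / (1 + δ) * ‖x‖ ^ 2).trans (boundedApprox_accretive hpos hδ x)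
  have hlim : ∀ φ : ℝ, |φ| < θ → Real.cos φ < 0 → Tendsto (fun δ : ℝ =>
      rayIntegral f φ (bddResolvent (boundedApprox R δ))) (𝓝[>] 0)
      (𝓝 (rayIntegral f φ (resolvent A))) := by
    intro φ hφ hφ'
    refine tendsto_rayIntegral (κ := |Real.cos φ|⁻¹) hf hθ'.le hφ ?_ ?_ ?_
    · filter_upwards [self_mem_nhdsWithin] with δ hδ
      exact continuousOn_bddResolvent_ray hφ' (hacc0 δ hδ)
    · filter_upwards [self_mem_nhdsWithin] with δ hδ r hr
      exact norm_bddResolvent_ray_le hφ' (hacc0 δ hδ) hr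
    · intro r hr
      rw [hres _ (hneg φ hφ' r hr)]
      have hc : ContinuousAt (fun δ : ℝ => (R + (δ : ℂ) • (1 : H →L[ℂ] H)) * Ring.inverse
          ((ray φ r + 1) • (R + (δ : ℂ) • 1) - (1 + 2 * δ : ℂ) • 1)) 0 := by
        refine ContinuousAt.mul (by fun_prop) ?_
        refine ContinuousAt.comp (g := Ring.inverse) (f := fun δ : ℝ =>
          (ray φ r + 1) • (R + (δ : ℂ) • (1 : H →L[ℂ] H)) - (1 + 2 * δ : ℂ) • 1) ?_ (by fun_prop)
        refine continuousAt_ringInverse_of_isUnit ?_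
        simpa using isUnit_smul_sub_one hA hR (hneg φ hφ' r hr)
      have h1 := hc.tendsto.mono_left (nhdsWithin_le_nhds (s := Ioi 0))
      simp only [ofReal_zero, zero_smul, add_zero, mul_zero, one_smul] at h1
      refine h1.congr' ?_
      filter_upwards [self_mem_nhdsWithin] with δ hδ
      exact (bddResolvent_boundedApprox hpos hδ (hneg φ hφ' r hr)).symm
  have hlim' : Tendsto (fun δ : ℝ => sectorIntegral f ν (bddResolvent (boundedApprox R δ))) (𝓝[>] 0)
      (𝓝 (dunford A f ν)) :=
    ((hlim (-ν) habs' hcos').sub (hlim ν habs hcos)).const_smul _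
  refine le_of_tendsto hlim'.norm ?_
  filter_upwards [self_mem_nhdsWithin] with δ hδ
  have hδ : 0 < δ := hδ
  exact norm_sectorIntegral_le_of_accretive (by positivity : 0 < δ / (1 + δ))
    (boundedApprox_accretive hpos hδ) hf hν hνθ hθ' hM

end MAccretive

end TimeGraph

/-! ### Integration by parts and weak derivatives -/

namespace TimeGraph

open Filter Topology

section IntegrationByParts

theorem setIntegral_smul_of_tsupport_subset {E : Type*} [NormedAddCommGroup E] [NormedSpace ℝ E]
    {s : Set ℝ} {ψ : ℝ → ℝ} (k : ℝ → E) (hψ : tsupport ψ ⊆ s) :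
    ∫ t in s, ψ t • k t = ∫ t, ψ t • k t := by
  apply setIntegral_eq_integral_of_forall_compl_eq_zero
  intro t ht
  rw [image_eq_zero_of_notMem_tsupport fun h => ht (hψ h), zero_smul]

theorem setIntegral_indicator_Iic_eq {E : Type*} [NormedAddCommGroup E] [NormedSpace ℝ E]
    (f : ℝ → E) {a b t : ℝ} (ht : t ∈ Ioc a b) :
    ∫ s in a..t, f s = ∫ s in Ioc a b, (Iic t).indicator f s := by
  rw [setIntegral_indicator measurableSet_Iic, intervalIntegral.integral_of_le ht.1.le,
    Ioc_inter_Iic, min_eq_right ht.2]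

variable {E F K : Type*} [NormedAddCommGroup E] [NormedSpace ℝ E] [CompleteSpace E]
  [NormedAddCommGroup F] [NormedSpace ℝ F] [CompleteSpace F]
  [NormedAddCommGroup K] [NormedSpace ℝ K] [CompleteSpace K]

/-- Integration by parts for the primitives `t ↦ ∫ s in a..t, f s` and `t ↦ ∫ s in a..t, g s`,
by Fubini's theorem on the two triangles of the square `(a, b]²`. -/
theorem integral_bilin_primitive_add (L : E →L[ℝ] F →L[ℝ] K) {f : ℝ → E} {g : ℝ → F} {a b : ℝ}
    (hab : a ≤ b) (hf : IntervalIntegrable f volume a b) (hg : IntervalIntegrable g volume a b) :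
    (∫ t in a..b, L (∫ s in a..t, f s) (g t)) + ∫ t in a..b, L (f t) (∫ s in a..t, g s) =
      L (∫ t in a..b, f t) (∫ t in a..b, g t) := by
  rw [intervalIntegrable_iff_integrableOn_Ioc_of_le hab] at hf hg
  set μ := volume.restrict (Ioc a b) with hμ
  have hprod : Integrable (fun p : ℝ × ℝ => L (f p.1) (g p.2)) (μ.prod μ) :=
    hf.op_fst_snd (op := fun x y => L x y) (by fun_prop) ⟨‖L‖, L.le_opNorm₂⟩ hg
  have hm1 : MeasurableSet {p : ℝ × ℝ | p.1 ≤ p.2} := measurableSet_le measurable_fst measurable_snd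
  have hm2 : MeasurableSet {p : ℝ × ℝ | p.2 ≤ p.1} := measurableSet_le measurable_snd measurable_fst
  have e1 : ∫ t in a..b, L (∫ s in a..t, f s) (g t) =
      ∫ t, ∫ s, {p : ℝ × ℝ | p.1 ≤ p.2}.indicator (fun p => L (f p.1) (g p.2)) (s, t) ∂μ ∂μ := by
    rw [intervalIntegral.integral_of_le hab]
    refine setIntegral_congr_fun measurableSet_Ioc fun t ht => ?_
    rw [setIntegral_indicator_Iic_eq f ht]
    change L.flip (g t) _ = _
    rw [← ContinuousLinearMap.integral_comp_comm _ (hf.indicator measurableSet_Iic)]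
    refine integral_congr_ae (ae_of_all _ fun s => ?_)
    by_cases hst : s ≤ t <;> simp [indicator, hst]
  have e2 : ∫ t in a..b, L (f t) (∫ s in a..t, g s) =
      ∫ s, ∫ t, {p : ℝ × ℝ | p.2 ≤ p.1}.indicator (fun p => L (f p.1) (g p.2)) (s, t) ∂μ ∂μ := by
    rw [intervalIntegral.integral_of_le hab]
    refine setIntegral_congr_fun measurableSet_Ioc fun t ht => ?_
    rw [setIntegral_indicator_Iic_eq g ht]
    rw [← ContinuousLinearMap.integral_comp_comm _ (hg.indicator measurableSet_Iic)]
    refine integral_congr_ae (ae_of_all _ fun s => ?_)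
    by_cases hst : s ≤ t <;> simp [indicator, hst]
  have e3 : ∫ t, ∫ s, {p : ℝ × ℝ | p.1 ≤ p.2}.indicator (fun p => L (f p.1) (g p.2)) (s, t) ∂μ ∂μ =
      ∫ s, ∫ t, {p : ℝ × ℝ | p.1 ≤ p.2}.indicator (fun p => L (f p.1) (g p.2)) (s, t) ∂μ ∂μ := by
    rw [integral_integral_swap]
    exact (hprod.indicator hm1).swap
  have e4 : L (∫ t in a..b, f t) (∫ t in a..b, g t) = ∫ s, ∫ t, L (f s) (g t) ∂μ ∂μ := by
    rw [intervalIntegral.integral_of_le hab, intervalIntegral.integral_of_le hab]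
    change L.flip (∫ t in Ioc a b, g t) _ = _
    rw [← ContinuousLinearMap.integral_comp_comm _ hf]
    refine integral_congr_ae (ae_of_all _ fun s => ?_)
    exact (ContinuousLinearMap.integral_comp_comm (L (f s)) hg).symm
  rw [e1, e2, e3, e4, ← integral_add (hprod.indicator hm1).integral_prod_left
    (hprod.indicator hm2).integral_prod_left]
  have hs1 := (hprod.indicator hm1).prod_right_ae
  have hs2 := (hprod.indicator hm2).prod_right_ae
  refine integral_congr_ae ?_
  filter_upwards [hs1, hs2] with s h1 h2
  rw [← integral_add h1 h2]
  refine integral_congr_ae ?_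
  have hne : ∀ᵐ t ∂μ, t ≠ s := ae_restrict_of_ae (Measure.ae_ne volume s)
  filter_upwards [hne] with t ht
  rcases lt_or_gt_of_ne ht with h | h
  · simp [indicator, h.le, not_le.2 h]
  · simp [indicator, h.le, not_le.2 h]

variable {h : ℝ → F} {G : ℝ → F}

/-- A primitive `G` of a locally integrable function `h` has the weak derivative `h` on `ℝ`. -/
theorem integral_deriv_smul_primitive (hh : ∀ a b, IntervalIntegrable h volume a b)
    (hG : ∀ a b, G b - G a = ∫ t in a..b, h t) {χ : ℝ → ℝ} (hχ : ContDiff ℝ 1 χ)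
    (hc : HasCompactSupport χ) : ∫ t, deriv χ t • G t = -∫ t, χ t • h t := by
  obtain ⟨r, hr0, hr⟩ : ∃ r : ℝ, 0 < r ∧ tsupport χ ⊆ Ioo (-r) r := by
    obtain ⟨r, hr⟩ := hc.isCompact.isBounded.subset_ball 0
    refine ⟨max r 1, by positivity, hr.trans ?_⟩
    rw [Real.ball_eq_Ioo]
    refine Ioo_subset_Ioo ?_ ?_ <;> simp
  have hχd : ∀ t, HasDerivAt χ (deriv χ t) t := fun t =>
    (hχ.differentiable (by simp) t).hasDerivAt
  have hdc : Continuous (deriv χ) := hχ.continuous_deriv (by simp)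
  have hzero : ∀ t, t ∉ Ioo (-r) r → χ t = 0 := fun t ht =>
    image_eq_zero_of_notMem_tsupport fun h => ht (hr h)
  have hχint : ∀ t, ∫ s in (-r)..t, deriv χ s = χ t := by
    intro t
    rw [intervalIntegral.integral_eq_sub_of_hasDerivAt (fun s _ => hχd s)
      (hdc.intervalIntegrable _ _), hzero (-r) (by simp), sub_zero]
  have hsub : Function.support (fun t => deriv χ t • G t) ⊆ Ioc (-r) r := by
    intro t ht
    have h1 : deriv χ t ≠ 0 := fun h0 => ht (by simp [h0])
    exact Ioo_subset_Ioc_self (hr (support_deriv_subset h1))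
  have hsub' : Function.support (fun t => χ t • h t) ⊆ Ioc (-r) r := by
    intro t ht
    have h1 : χ t ≠ 0 := fun h0 => ht (by simp [h0])
    exact Ioo_subset_Ioc_self (hr (subset_tsupport _ h1))
  rw [← intervalIntegral.integral_eq_integral_of_support_subset hsub,
    ← intervalIntegral.integral_eq_integral_of_support_subset hsub']
  have key := integral_bilin_primitive_add (ContinuousLinearMap.lsmul ℝ ℝ : ℝ →L[ℝ] F →L[ℝ] F)
    (by linarith : -r ≤ r) (hdc.intervalIntegrable (-r) r) (hh (-r) r)
  simp only [ContinuousLinearMap.lsmul_apply, hχint, hzero r (by simp), zero_smul] at key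
  have hGcont : Continuous G := by
    have : G = fun t => G 0 + ∫ s in (0 : ℝ)..t, h s := by
      funext t
      rw [← hG 0 t]
      abel
    rw [this]
    exact continuous_const.add (intervalIntegral.continuous_primitive hh 0)
  have e : ∀ t, deriv χ t • ∫ s in (-r)..t, h s = deriv χ t • G t - deriv χ t • G (-r) := by
    intro t
    rw [← hG, smul_sub]
  simp_rw [e] at key
  rw [intervalIntegral.integral_sub (f := fun t => deriv χ t • G t)
    (g := fun t => deriv χ t • G (-r)) ((hdc.smul hGcont).intervalIntegrable _ _)
    ((hdc.smul continuous_const).intervalIntegrable _ _), intervalIntegral.integral_smul_const, hχint,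
    hzero r (by simp), zero_smul, sub_zero] at key
  rw [eq_neg_iff_add_eq_zero, add_comm]
  exact key

theorem isWeakDerivOn_of_primitive (hh : ∀ a b, IntervalIntegrable h volume a b)
    (hG : ∀ a b, G b - G a = ∫ t in a..b, h t) (s : Set ℝ) : IsWeakDerivOn s G h := by
  intro φ hφ hc hs
  rw [setIntegral_smul_of_tsupport_subset _ hs,
    setIntegral_smul_of_tsupport_subset _ (tsupport_deriv_subset.trans hs)]
  exact integral_deriv_smul_primitive hh hG (hφ.of_le (by simp)) hc

end IntegrationByParts

section FundamentalTheorem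

variable {F : Type*} [NormedAddCommGroup F] [NormedSpace ℝ F] [CompleteSpace F]

/-- A test function with mean `0` is the derivative of a test function supported in the same
interval. -/
theorem exists_antideriv_of_integral_eq_zero {s : Set ℝ} (hs : s.OrdConnected) {χ : ℝ → ℝ}
    (hχ : ContDiff ℝ ∞ χ) (hc : HasCompactSupport χ) (hsupp : tsupport χ ⊆ s)
    (hint : ∫ t, χ t = 0) :
    ∃ φ : ℝ → ℝ, ContDiff ℝ ∞ φ ∧ HasCompactSupport φ ∧ tsupport φ ⊆ s ∧ deriv φ = χ := by
  rcases (tsupport χ).eq_empty_or_nonempty with h0 | hne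
  · have : χ = 0 := tsupport_eq_empty_iff.1 h0
    refine ⟨0, contDiff_const, HasCompactSupport.zero, by simp [tsupport], ?_⟩
    rw [this]
    funext t
    simp
  · have hK : IsCompact (tsupport χ) := hc
    set m := sInf (tsupport χ) with hm
    set M := sSup (tsupport χ) with hM
    have hmm := hK.sInf_mem hne
    have hMM := hK.sSup_mem hne
    have hsub : tsupport χ ⊆ Icc m M := fun t ht =>
      ⟨csInf_le hK.bddBelow ht, le_csSup hK.bddAbove ht⟩
    have hd : ∀ t, HasDerivAt (fun t => ∫ x in m..t, χ x) (χ t) t := fun t =>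
      intervalIntegral.integral_hasDerivAt_right (hχ.continuous.intervalIntegrable _ _)
        (hχ.continuous.stronglyMeasurableAtFilter _ _) hχ.continuous.continuousAt
    have hder : deriv (fun t => ∫ x in m..t, χ x) = χ := funext fun t => (hd t).deriv
    have hz : ∀ t, t ∉ Icc m M → ∫ x in m..t, χ x = 0 := by
      intro t ht
      rw [mem_Icc, not_and_or, not_le, not_le] at ht
      rcases ht with ht | ht
      · rw [intervalIntegral.integral_symm, neg_eq_zero]
        rw [intervalIntegral.integral_of_le ht.le, integral_Ioc_eq_integral_Ioo]
        refine setIntegral_eq_zero_of_forall_eq_zero fun x hx => ?_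
        exact image_eq_zero_of_notMem_tsupport fun h => not_le.2 hx.2 (hsub h).1
      · rw [← hint]
        have h1 : m ≤ t := (hsub hmm).2.trans ht.le
        rw [intervalIntegral.integral_of_le h1, ← integral_Icc_eq_integral_Ioc]
        refine setIntegral_eq_integral_of_forall_compl_eq_zero fun x hx => ?_
        exact image_eq_zero_of_notMem_tsupport fun h => hx ⟨(hsub h).1, (hsub h).2.trans ht.le⟩
    have hts : tsupport (fun t => ∫ x in m..t, χ x) ⊆ Icc m M :=
      closure_minimal (fun t ht => by_contra fun h => ht (hz t h)) isClosed_Icc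
    refine ⟨_, ?_, HasCompactSupport.of_support_subset_isCompact isCompact_Icc
      ((subset_tsupport _).trans hts), hts.trans (hs.out (hsupp hmm) (hsupp hMM)), hder⟩
    refine contDiff_infty_iff_deriv.2 ⟨fun t => (hd t).differentiableAt, ?_⟩
    rw [hder]
    exact hχ

/-- The lemma of du Bois-Reymond. -/
theorem exists_ae_eq_const_of_isWeakDerivOn_zero {s : Set ℝ} (hs : IsOpen s) (hs' : s.OrdConnected)
    (hne : s.Nonempty) {w : ℝ → F} (hw : LocallyIntegrableOn w s) (h : IsWeakDerivOn s w 0) :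
    ∃ c : F, w =ᵐ[volume.restrict s] fun _ => c := by
  obtain ⟨t₀, ht₀⟩ := hne
  obtain ⟨r, hr0, hr⟩ := Metric.isOpen_iff.1 hs t₀ ht₀
  let ρ : ContDiffBump t₀ := ⟨r / 4, r / 2, by linarith, by linarith⟩
  set n : ℝ → ℝ := ρ.normed volume with hn
  have hnc : ContDiff ℝ ∞ n := ρ.contDiff_normed
  have hns : HasCompactSupport n := ρ.hasCompactSupport_normed
  have hnt : tsupport n ⊆ s := by
    rw [hn, ρ.tsupport_normed_eq]
    exact (Metric.closedBall_subset_ball (by change r / 2 < r; linarith)).trans hr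
  have hn1 : ∫ t, n t = 1 := ρ.integral_normed
  have hint : ∀ ψ : ℝ → ℝ, Continuous ψ → HasCompactSupport ψ → tsupport ψ ⊆ s →
      IntegrableOn (fun t => ψ t • w t) s := by
    intro ψ hψ hψc hψs
    have h1 : IntegrableOn w (tsupport ψ) := hw.integrableOn_compact_subset hψs hψc
    have h2 : IntegrableOn (fun t => ψ t • w t) (tsupport ψ) := by
      refine IntegrableOn.continuousOn_smul h1 hψ.continuousOn hψc
    refine (h2.integrable_of_forall_notMem_eq_zero fun t ht => ?_).integrableOn
    rw [image_eq_zero_of_notMem_tsupport ht, zero_smul]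
  set c := ∫ t in s, n t • w t with hc
  refine ⟨c, ?_⟩
  have hloc : LocallyIntegrableOn (fun t => w t - c) s :=
    hw.sub (continuousOn_const.locallyIntegrableOn hs.measurableSet)
  have key := hs.ae_eq_zero_of_integral_contDiff_smul_eq_zero hloc (fun ψ hψ hψc hψs => by
    -- `ψ - (∫ ψ) n` has mean `0`, so it is the derivative of a test function
    set a := ∫ t, ψ t with ha
    have hsm : ContDiff ℝ ∞ fun t => ψ t - a * n t := hψ.sub (contDiff_const.mul hnc)
    have hcs : HasCompactSupport fun t => ψ t - a * n t := hψc.sub hns.mul_left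
    have hts : tsupport (fun t => ψ t - a * n t) ⊆ s := by
      refine (closure_minimal (t := tsupport ψ ∪ tsupport n) ?_
        ((isClosed_tsupport _).union (isClosed_tsupport _))).trans (union_subset hψs hnt)
      intro t ht
      by_contra hcon
      rw [mem_union, not_or] at hcon
      apply ht
      simp [image_eq_zero_of_notMem_tsupport hcon.1, image_eq_zero_of_notMem_tsupport hcon.2]
    have hi0 : ∫ t, (ψ t - a * n t) = 0 := by
      rw [integral_sub (hψ.continuous.integrable_of_hasCompactSupport hψc)
        ((hnc.continuous.integrable_of_hasCompactSupport hns).const_mul a), integral_const_mul, hn1]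
      simp [ha]
    obtain ⟨φ, hφ, hφc, hφs, hφd⟩ := exists_antideriv_of_integral_eq_zero hs' hsm hcs hts hi0
    have h1 := h φ hφ hφc hφs
    rw [hφd] at h1
    simp only [Pi.zero_apply, smul_zero, integral_zero, neg_zero] at h1
    have iψ := hint ψ hψ.continuous hψc hψs
    have inn := hint n hnc.continuous hns hnt
    simp_rw [sub_smul, mul_smul] at h1
    rw [integral_sub (g := fun t => a • n t • w t) iψ (inn.smul a), integral_smul, ← hc] at h1
    have h2 := setIntegral_smul_of_tsupport_subset w hψs
    simp_rw [smul_sub]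
    rw [integral_sub, integral_smul_const, ← ha, ← h2]
    · exact h1
    · refine (integrableOn_iff_integrable_of_support_subset ?_).1 iψ
      intro t ht
      by_contra hcon
      exact ht (by simp [image_eq_zero_of_notMem_tsupport fun h => hcon (hψs h)])
    · exact (hψ.continuous.integrable_of_hasCompactSupport hψc).smul_const c)
  rw [Filter.EventuallyEq, ae_restrict_iff' hs.measurableSet]
  filter_upwards [key] with t ht hts
  exact sub_eq_zero.1 (ht hts)

theorem memLp_indicator {F : Type*} [NormedAddCommGroup F] {s : Set ℝ} (hs : MeasurableSet s)
    {g : ℝ → F} (hg : MemLp g 2 (volume.restrict s)) : MemLp (s.indicator g) 2 volume :=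
  (memLp_indicator_iff_restrict hs).2 hg

theorem intervalIntegrable_of_memLp {F : Type*} [NormedAddCommGroup F] {g : ℝ → F}
    (hg : MemLp g 2 volume) (a b : ℝ) : IntervalIntegrable g volume a b :=
  ((hg.locallyIntegrable (by norm_num)).integrableOn_isCompact isCompact_uIcc).intervalIntegrable

/-- The fundamental theorem of calculus for a continuous representative `u`, up to the boundary, of
a function with a square integrable weak derivative. -/
theorem sub_eq_integral_of_isWeakDerivOn {s : Set ℝ} (hs : IsOpen s) (hs' : s.OrdConnected)
    (hne : s.Nonempty) {u f g : ℝ → F} (hu : ContinuousOn u (closure s))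
    (huf : u =ᵐ[volume.restrict s] f) (hf : MemLp f 2 (volume.restrict s))
    (hg : MemLp g 2 (volume.restrict s)) (h : IsWeakDerivOn s f g) {a b : ℝ}
    (ha : a ∈ closure s) (hb : b ∈ closure s) : u b - u a = ∫ t in a..b, s.indicator g t := by
  have hgi : ∀ a b, IntervalIntegrable (s.indicator g) volume a b :=
    intervalIntegrable_of_memLp (memLp_indicator hs.measurableSet hg)
  set v : ℝ → F := fun t => ∫ x in (0 : ℝ)..t, s.indicator g x with hv
  have hvd : ∀ a b, v b - v a = ∫ t in a..b, s.indicator g t := fun a b =>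
    intervalIntegral.integral_interval_sub_left (hgi _ _) (hgi _ _)
  have hvc : Continuous v := intervalIntegral.continuous_primitive hgi 0
  have hvw : IsWeakDerivOn s v g :=
    (isWeakDerivOn_of_primitive hgi hvd s).congr (Filter.EventuallyEq.refl _ _)
      (indicator_ae_eq_restrict hs.measurableSet).symm
  have huv : LocallyIntegrableOn (u - v) s :=
    ((hu.mono subset_closure).sub hvc.continuousOn).locallyIntegrableOn hs.measurableSet
  have hw : IsWeakDerivOn s (u - v) 0 := by
    intro φ hφ hc hφs
    have e1 := (h.congr huf (Filter.EventuallyEq.refl _ g)) φ hφ hc hφs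
    have e2 := hvw φ hφ hc hφs
    have hd : Continuous (deriv φ) := hφ.continuous_deriv (by simp)
    have hdc : HasCompactSupport (deriv φ) := hc.deriv
    have i1 : IntegrableOn (fun t => deriv φ t • u t) s :=
      integrableOn_test_smul hd hdc (hf.ae_eq huf.symm)
    have i2 : IntegrableOn (fun t => deriv φ t • v t) s :=
      ((hd.smul hvc).integrable_of_hasCompactSupport hdc.smul_right).integrableOn
    simp only [Pi.sub_apply, smul_sub, Pi.zero_apply, smul_zero, integral_zero, neg_zero]
    rw [integral_sub i1 i2, e1, e2, sub_self]
  obtain ⟨c, hc⟩ := exists_ae_eq_const_of_isWeakDerivOn_zero hs hs' hne huv hw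
  have hcl : ContinuousOn (u - v) (closure s) := hu.sub hvc.continuousOn
  have heq : EqOn (u - v) (fun _ => c) s :=
    Measure.eqOn_open_of_ae_eq hc hs (hcl.mono subset_closure) continuousOn_const
  have heq' : EqOn (u - v) (fun _ => c) (closure s) :=
    heq.of_subset_closure hcl continuousOn_const subset_closure le_rfl
  have h1 := heq' ha
  have h2 := heq' hb
  simp only [Pi.sub_apply] at h1 h2
  rw [← hvd a b, sub_eq_sub_iff_sub_eq_sub, h1, h2]

end FundamentalTheorem

section Energy

variable {F : Type*} [NormedAddCommGroup F] [InnerProductSpace ℂ F] [CompleteSpace F]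

open scoped InnerProductSpace

/-- The identity `‖u b‖² - ‖u a‖² = 2 ∫ Re ⟪u, u'⟫`. -/
theorem norm_sq_sub_norm_sq_eq_integral {u h : ℝ → F} {a b : ℝ} (hab : a ≤ b)
    (hh : IntervalIntegrable h volume a b)
    (hu : ∀ t ∈ Icc a b, u t - u a = ∫ x in a..t, h x) :
    ‖u b‖ ^ 2 - ‖u a‖ ^ 2 = 2 * ∫ t in a..b, (⟪u t, h t⟫_ℂ).re := by
  let L : F →L[ℝ] F →L[ℝ] ℝ := LinearMap.mkContinuous₂
    (LinearMap.mk₂ ℝ (fun x y : F => (⟪x, y⟫_ℂ).re) (fun x y z => by simp)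
      (fun c x y => by
        rw [RCLike.real_smul_eq_coe_smul (K := ℂ) c x, inner_smul_left]
        simp) (fun x y z => by simp)
      (fun c x y => by
        rw [RCLike.real_smul_eq_coe_smul (K := ℂ) c y, inner_smul_right]
        simp)) 1
    fun x y => by
      rw [one_mul]
      exact (Complex.abs_re_le_norm _).trans (norm_inner_le_norm x y)
  have hL : ∀ x y : F, L x y = (⟪x, y⟫_ℂ).re := fun x y => rfl
  have hsymm : ∀ x y : F, L x y = L y x := fun x y => inner_re_symm (𝕜 := ℂ) x y
  have key := integral_bilin_primitive_add L hab hh hh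
  have e2 : ∫ t in a..b, L (h t) (∫ s in a..t, h s) = ∫ t in a..b, L (∫ s in a..t, h s) (h t) :=
    intervalIntegral.integral_congr fun t _ => hsymm _ _
  rw [e2] at key
  have hprim : ContinuousOn (fun t => ∫ s in a..t, h s) (uIcc a b) :=
    intervalIntegral.continuousOn_primitive_interval' hh left_mem_uIcc
  have hi2 : IntervalIntegrable (fun t => L (∫ s in a..t, h s) (h t)) volume a b := by
    obtain ⟨C, hC⟩ := isCompact_uIcc.exists_bound_of_continuousOn hprim
    rw [uIcc_of_le hab] at hC hprim
    rw [intervalIntegrable_iff_integrableOn_Ioc_of_le hab] at hh ⊢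
    refine Integrable.mono' (hh.norm.const_mul (‖L‖ * C)) (L.aestronglyMeasurable_comp₂
      ((hprim.mono Ioc_subset_Icc_self).aestronglyMeasurable measurableSet_Ioc)
      hh.aestronglyMeasurable) ?_
    filter_upwards [ae_restrict_mem measurableSet_Ioc] with t ht
    refine (L.le_opNorm₂ _ _).trans ?_
    gcongr
    exact hC t (Ioc_subset_Icc_self ht)
  have hi1 : IntervalIntegrable (fun t => L (u a) (h t)) volume a b := by
    rw [intervalIntegrable_iff_integrableOn_Ioc_of_le hab] at hh ⊢
    exact (L (u a)).integrable_comp hh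
  have e3 : ∫ t in a..b, (⟪u t, h t⟫_ℂ).re =
      L (u a) (∫ t in a..b, h t) + ∫ t in a..b, L (∫ s in a..t, h s) (h t) := by
    rw [← ContinuousLinearMap.intervalIntegral_comp_comm _ hh, ← intervalIntegral.integral_add hi1 hi2]
    refine intervalIntegral.integral_congr fun t ht => ?_
    rw [uIcc_of_le hab] at ht
    rw [← hL, ← _root_.add_apply, ← map_add, ← hu t ht, add_sub_cancel]
  have hub : u b = u a + ∫ t in a..b, h t := by
    rw [← hu b (right_mem_Icc.2 hab), add_sub_cancel]
  have hsq : ∀ x : F, ‖x‖ ^ 2 = L x x := fun x => (re_inner_self_eq_norm_sq x).symm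
  have hadd : ∀ x y z : F, L (x + y) z = L x z + L y z := fun x y z => by
    rw [map_add, _root_.add_apply]
  rw [e3, hsq, hsq, hub, map_add, hadd, hadd, hsymm (∫ t in a..b, h t) (u a)]
  linarith

end Energy

end TimeGraph

/-! ### The equation `u + u' = g` on the real line -/

namespace TimeGraph

open Filter Topology

section ExpConv

variable {F : Type*} [NormedAddCommGroup F] [NormedSpace ℝ F]

/-- The solution `u(t) = ∫_{-∞}^t e^{s - t} g(s) ds` of `u + u' = g` on the real line. -/
noncomputable def expConv (g : ℝ → F) (t : ℝ) : F :=
  Real.exp (-t) • ∫ s in Iic t, Real.exp s • g s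

theorem integrableOn_Iic_exp_smul {g : ℝ → F} (hg : MemLp g 2 volume) (t : ℝ) :
    IntegrableOn (fun s => Real.exp s • g s) (Iic t) := by
  have h1 : MemLp Real.exp 2 (volume.restrict (Iic t)) := by
    rw [memLp_two_iff_integrable_sq Real.continuous_exp.aestronglyMeasurable]
    have : IntegrableOn (fun s : ℝ => Real.exp (2 * s)) (Iic t) :=
      integrableOn_exp_mul_Iic (by norm_num) t
    refine this.congr (ae_of_all _ fun s => ?_)
    simp only
    rw [← Real.exp_nat_mul]
    norm_num
  have h2 : MemLp (Real.exp • g) 1 (volume.restrict (Iic t)) := (hg.restrict _).smul h1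
  exact memLp_one_iff_integrable.1 h2

theorem intervalIntegrable_exp_smul {g : ℝ → F} (hg : MemLp g 2 volume) (a b : ℝ) :
    IntervalIntegrable (fun s => Real.exp s • g s) volume a b :=
  (intervalIntegrable_of_memLp hg a b).continuousOn_smul Real.continuous_exp.continuousOn

theorem setIntegral_Iic_exp_smul_sub {g : ℝ → F} (hg : MemLp g 2 volume) (a b : ℝ) :
    (∫ s in Iic b, Real.exp s • g s) - (∫ s in Iic a, Real.exp s • g s) =
      ∫ s in a..b, Real.exp s • g s :=
  intervalIntegral.integral_Iic_sub_Iic (integrableOn_Iic_exp_smul hg a)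
    (integrableOn_Iic_exp_smul hg b)

theorem continuous_expConv {g : ℝ → F} (hg : MemLp g 2 volume) : Continuous (expConv g) := by
  have : (fun t : ℝ => ∫ s in Iic t, Real.exp s • g s) = fun t =>
      (∫ s in Iic (0 : ℝ), Real.exp s • g s) + ∫ s in (0 : ℝ)..t, Real.exp s • g s := by
    funext t
    rw [← setIntegral_Iic_exp_smul_sub hg]
    abel
  have hc : Continuous fun t : ℝ => ∫ s in Iic t, Real.exp s • g s := by
    rw [this]
    exact continuous_const.add
      (intervalIntegral.continuous_primitive (intervalIntegrable_exp_smul hg) 0)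
  unfold expConv
  exact (Real.continuous_exp.comp continuous_neg).smul hc

theorem expConv_eq_zero {g : ℝ → F} {t : ℝ} (h : ∀ s ≤ t, g s = 0) : expConv g t = 0 := by
  rw [expConv, setIntegral_eq_zero_of_forall_eq_zero (fun s hs => by rw [h s hs, smul_zero]),
    smul_zero]

theorem lintegral_Iic_exp (t : ℝ) : ∫⁻ s in Iic t, ENNReal.ofReal (Real.exp (s - t)) = 1 := by
  have h : ∀ s : ℝ, Real.exp (s - t) = Real.exp (-t) * Real.exp s := fun s => by
    rw [← Real.exp_add]; ring_nf
  simp_rw [h]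
  rw [← ofReal_integral_eq_lintegral_ofReal ((integrableOn_exp_Iic t).const_mul _)
    (ae_of_all _ fun s => by positivity), integral_const_mul, integral_exp_Iic, ← Real.exp_add]
  simp

theorem lintegral_Ici_exp (s : ℝ) : ∫⁻ t in Ici s, ENNReal.ofReal (Real.exp (s - t)) = 1 := by
  have h : ∀ t : ℝ, Real.exp (s - t) = Real.exp s * Real.exp (-t) := fun t => by
    rw [← Real.exp_add]; ring_nf
  have hi : IntegrableOn (fun t : ℝ => Real.exp (-t)) (Ici s) := by
    rw [integrableOn_Ici_iff_integrableOn_Ioi]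
    exact integrableOn_exp_neg_Ioi s
  simp_rw [h]
  rw [← ofReal_integral_eq_lintegral_ofReal (hi.const_mul _)
    (ae_of_all _ fun s => by positivity), integral_const_mul, integral_Ici_eq_integral_Ioi,
    integral_exp_neg_Ioi, ← Real.exp_add]
  simp

/-- `‖u(t)‖² ≤ ∫_{-∞}^t e^{s - t} ‖g(s)‖² ds`, by the Cauchy-Schwarz inequality for the probability
measure `e^{s - t} ds` on `(-∞, t]`. -/
theorem enorm_expConv_sq_le {g : ℝ → F} (hg : MemLp g 2 volume) (t : ℝ) :
    ‖expConv g t‖ₑ ^ (2 : ℝ) ≤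
      ∫⁻ s in Iic t, ENNReal.ofReal (Real.exp (s - t)) * ‖g s‖ₑ ^ (2 : ℝ) := by
  have hhalf : ∀ s : ℝ, ENNReal.ofReal (Real.exp ((s - t) / 2)) ^ (2 : ℝ) =
      ENNReal.ofReal (Real.exp (s - t)) := by
    intro s
    rw [ENNReal.ofReal_rpow_of_pos (Real.exp_pos _), ← Real.exp_mul]
    congr 2
    ring
  have h1 : ‖expConv g t‖ₑ ≤ ∫⁻ s in Iic t, ENNReal.ofReal (Real.exp ((s - t) / 2)) *
      (ENNReal.ofReal (Real.exp ((s - t) / 2)) * ‖g s‖ₑ) := by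
    rw [expConv, ← integral_smul]
    refine (enorm_integral_le_lintegral_enorm _).trans (lintegral_mono fun s => ?_)
    rw [smul_smul, enorm_smul, ← mul_assoc, ← ENNReal.ofReal_mul (Real.exp_pos _).le,
      ← Real.exp_add, ← Real.exp_add, Real.enorm_of_nonneg (Real.exp_pos _).le]
    ring_nf
    exact le_rfl
  have h2 := ENNReal.lintegral_mul_le_Lp_mul_Lq (volume.restrict (Iic t)) Real.HolderConjugate.two_two
    (f := fun s => ENNReal.ofReal (Real.exp ((s - t) / 2)))
    (g := fun s => ENNReal.ofReal (Real.exp ((s - t) / 2)) * ‖g s‖ₑ)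
    (by fun_prop) ((by fun_prop : Measurable fun s : ℝ =>
      ENNReal.ofReal (Real.exp ((s - t) / 2))).aemeasurable.mul hg.1.enorm.restrict)
  simp only [Pi.mul_apply, ENNReal.mul_rpow_of_nonneg _ _ (by norm_num : (0 : ℝ) ≤ 2), hhalf,
    lintegral_Iic_exp, ENNReal.one_rpow, one_mul] at h2
  refine (ENNReal.rpow_le_rpow (h1.trans h2) (by norm_num : (0 : ℝ) ≤ 2)).trans ?_
  rw [← ENNReal.rpow_mul]
  norm_num

/-- Convolution with `e^{-t}` on `(0, ∞)` is a contraction of `L²`, by Tonelli's theorem and the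
pointwise bound `enorm_expConv_sq_le`. -/
theorem memLp_expConv {g : ℝ → F} (hg : MemLp g 2 volume) : MemLp (expConv g) 2 volume := by
  refine ⟨(continuous_expConv hg).aestronglyMeasurable, ?_⟩
  have hgl := hg.2
  rw [eLpNorm_lt_top_iff_lintegral_rpow_enorm_lt_top (by norm_num) (by norm_num)] at hgl ⊢
  simp only [ENNReal.toReal_ofNat] at hgl ⊢
  refine lt_of_le_of_lt ?_ hgl
  calc _ ≤ ∫⁻ t, ∫⁻ s, {p : ℝ × ℝ | p.2 ≤ p.1}.indicator (fun p => ENNReal.ofReal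
        (Real.exp (p.2 - p.1)) * ‖g p.2‖ₑ ^ (2 : ℝ)) (t, s) := by
        refine lintegral_mono fun t => (enorm_expConv_sq_le hg t).trans_eq ?_
        rw [← lintegral_indicator measurableSet_Iic]
        rfl
    _ = ∫⁻ s, ∫⁻ t, {p : ℝ × ℝ | p.2 ≤ p.1}.indicator (fun p => ENNReal.ofReal
        (Real.exp (p.2 - p.1)) * ‖g p.2‖ₑ ^ (2 : ℝ)) (t, s) := by
        refine lintegral_lintegral_swap ?_
        refine AEMeasurable.indicator ?_ (measurableSet_le measurable_snd measurable_fst)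
        refine AEMeasurable.mul (by fun_prop) ?_
        exact (hg.1.enorm.comp_snd).pow_const _
    _ = ∫⁻ s, ‖g s‖ₑ ^ (2 : ℝ) := by
        refine lintegral_congr fun s => ?_
        have : ∀ t : ℝ, {p : ℝ × ℝ | p.2 ≤ p.1}.indicator (fun p => ENNReal.ofReal
            (Real.exp (p.2 - p.1)) * ‖g p.2‖ₑ ^ (2 : ℝ)) (t, s) =
            (Ici s).indicator (fun t => ENNReal.ofReal (Real.exp (s - t)) * ‖g s‖ₑ ^ (2 : ℝ)) t :=
          fun t => rfl
        simp_rw [this]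
        rw [lintegral_indicator measurableSet_Ici, lintegral_mul_const _ (by fun_prop),
          lintegral_Ici_exp, one_mul]
    _ ≤ _ := le_rfl

variable [CompleteSpace F]

/-- If `G` is a primitive of `e^t k(t)`, then `u = e^{-t} G` solves `u' = k - u`. -/
theorem isWeakDerivOn_exp_neg_smul {k G : ℝ → F} {s : Set ℝ}
    (hk : ∀ a b, IntervalIntegrable k volume a b)
    (hG : ∀ a b, G b - G a = ∫ t in a..b, Real.exp t • k t) (hGc : Continuous G) :
    IsWeakDerivOn s (fun t => Real.exp (-t) • G t) (fun t => k t - Real.exp (-t) • G t) := by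
  intro φ hφ hc hs
  rw [setIntegral_smul_of_tsupport_subset _ hs,
    setIntegral_smul_of_tsupport_subset _ (tsupport_deriv_subset.trans hs)]
  have hφ1 : ContDiff ℝ 1 φ := hφ.of_le (by simp)
  have hde : ∀ t : ℝ, HasDerivAt (fun t => φ t * Real.exp (-t))
      (deriv φ t * Real.exp (-t) - φ t * Real.exp (-t)) t := by
    intro t
    have h2 := ((hφ1.differentiable (by simp) t).hasDerivAt).mul ((hasDerivAt_neg t).exp)
    refine h2.congr_deriv ?_
    ring
  have key := integral_deriv_smul_primitive (χ := fun t => φ t * Real.exp (-t))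
    (fun a b => (hk a b).continuousOn_smul Real.continuous_exp.continuousOn) hG
    (hφ1.mul (Real.contDiff_exp.comp contDiff_neg)) hc.mul_right
  have hder : deriv (fun t => φ t * Real.exp (-t)) = fun t =>
      deriv φ t * Real.exp (-t) - φ t * Real.exp (-t) := funext fun t => (hde t).deriv
  rw [hder] at key
  have hdc : Continuous (deriv φ) := hφ.continuous_deriv (by simp)
  have hexp : Continuous fun t : ℝ => Real.exp (-t) := by fun_prop
  have i1 : Integrable fun t => deriv φ t • Real.exp (-t) • G t :=
    (hdc.smul (hexp.smul hGc)).integrable_of_hasCompactSupport hc.deriv.smul_right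
  have i2 : Integrable fun t => φ t • Real.exp (-t) • G t :=
    (hφ.continuous.smul (hexp.smul hGc)).integrable_of_hasCompactSupport hc.smul_right
  have i3 : Integrable fun t => φ t • k t := by
    have hloc : LocallyIntegrable k := by
      rw [locallyIntegrable_iff]
      intro K hK
      obtain ⟨r, hr⟩ := hK.isBounded.subset_closedBall 0
      rw [Real.closedBall_eq_Icc] at hr
      have := hk (0 - r) (0 + r)
      rw [intervalIntegrable_iff'] at this
      exact this.mono_set (hr.trans Icc_subset_uIcc)
    exact hloc.integrable_smul_left_of_hasCompactSupport hφ.continuous hc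
  simp_rw [sub_smul, mul_smul] at key
  rw [integral_sub i1 i2] at key
  have hexp1 : ∀ t : ℝ, φ t • Real.exp (-t) • Real.exp t • k t = φ t • k t := by
    intro t
    rw [smul_smul (Real.exp (-t)), ← Real.exp_add]
    simp
  simp_rw [hexp1] at key
  simp_rw [smul_sub]
  rw [integral_sub i3 i2, sub_eq_iff_eq_add.1 key]
  abel

theorem isWeakDerivOn_expConv {g : ℝ → F} (hg : MemLp g 2 volume) (s : Set ℝ) :
    IsWeakDerivOn s (expConv g) (g - expConv g) := by
  refine isWeakDerivOn_exp_neg_smul (intervalIntegrable_of_memLp hg)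
    (setIntegral_Iic_exp_smul_sub hg) ?_
  have : (fun t : ℝ => ∫ s in Iic t, Real.exp s • g s) = fun t => Real.exp t • expConv g t := by
    funext t
    rw [expConv, smul_smul, ← Real.exp_add]
    simp
  rw [this]
  exact Real.continuous_exp.smul (continuous_expConv hg)

theorem isWeakDerivOn_exp_neg_smul_const (c : F) (s : Set ℝ) :
    IsWeakDerivOn s (fun t => Real.exp (-t) • c) (fun t => -(Real.exp (-t) • c)) := by
  have := isWeakDerivOn_exp_neg_smul (k := fun _ => (0 : F)) (G := fun _ => c) (s := s)
    (fun a b => by simp) (fun a b => by simp) continuous_const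
  simpa using this

end ExpConv

end TimeGraph

/-! ### The boundary form of `D_t` -/

namespace TimeGraph

open Filter Topology

section EdgeEnergy

variable {F : Type*} [NormedAddCommGroup F] [InnerProductSpace ℂ F]

open scoped InnerProductSpace

theorem integrable_re_inner {s : Set ℝ} (f g : Lp F 2 (volume.restrict s)) :
    IntegrableOn (fun t => (⟪f t, g t⟫_ℂ).re) s :=
  (L2.integrable_inner (𝕜 := ℂ) f g).re

theorem re_inner_Lp {s : Set ℝ} (f g : Lp F 2 (volume.restrict s)) :
    (⟪f, g⟫_ℂ).re = ∫ t in s, (⟪f t, g t⟫_ℂ).re := by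
  rw [L2.inner_def]
  exact (integral_re (L2.integrable_inner (𝕜 := ℂ) f g)).symm

variable [CompleteSpace F]

/-- The energy identity on a subinterval of an edge. -/
theorem norm_sq_sub_norm_sq_of_isWeakDerivOn {s : Set ℝ} (hs : IsOpen s) (hs' : s.OrdConnected)
    (hne : s.Nonempty) {f g : Lp F 2 (volume.restrict s)} {u : ℝ → F}
    (hu : ContinuousOn u (closure s)) (huf : u =ᵐ[volume.restrict s] f)
    (h : IsWeakDerivOn s f g) {a b : ℝ} (hab : a ≤ b) (hsub : Ioo a b ⊆ s)
    (hcl : Icc a b ⊆ closure s) :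
    ‖u b‖ ^ 2 - ‖u a‖ ^ 2 = 2 * ∫ t in a..b, (⟪f t, g t⟫_ℂ).re := by
  have hgi : ∀ a b, IntervalIntegrable (s.indicator g) volume a b :=
    intervalIntegrable_of_memLp (memLp_indicator hs.measurableSet (Lp.memLp g))
  rw [norm_sq_sub_norm_sq_eq_integral hab (hgi a b) fun t ht =>
    sub_eq_integral_of_isWeakDerivOn hs hs' hne hu huf (Lp.memLp f) (Lp.memLp g) h
      (hcl (left_mem_Icc.2 hab)) (hcl ht)]
  congr 1
  rw [intervalIntegral.integral_of_le hab, intervalIntegral.integral_of_le hab,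
    integral_Ioc_eq_integral_Ioo, integral_Ioc_eq_integral_Ioo]
  refine setIntegral_congr_ae measurableSet_Ioo ?_
  have := ae_imp_of_ae_restrict huf
  filter_upwards [this] with t ht hts
  rw [indicator_of_mem (hsub hts), ht (hsub hts)]

theorem re_inner_of_isWeakDerivOn_Ioo {ℓ : ℝ} (hℓ : 0 < ℓ)
    {f g : Lp F 2 (volume.restrict (Ioo 0 ℓ))} (h : IsWeakDerivOn (Ioo 0 ℓ) f g) {x y : F}
    (hx : IsTraceAt (Ioo 0 ℓ) f 0 x) (hy : IsTraceAt (Ioo 0 ℓ) f ℓ y) :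
    2 * (⟪f, g⟫_ℂ).re = ‖y‖ ^ 2 - ‖x‖ ^ 2 := by
  obtain ⟨u, hu, huf, rfl⟩ := hx
  obtain ⟨v, hv, hvf, rfl⟩ := hy
  have hcl : closure (Ioo 0 ℓ) = Icc 0 ℓ := closure_Ioo hℓ.ne
  have huv : EqOn v u (closure (Ioo 0 ℓ)) :=
    (Measure.eqOn_open_of_ae_eq (hvf.trans huf.symm) isOpen_Ioo (hv.mono subset_closure)
      (hu.mono subset_closure)).of_subset_closure hv hu subset_closure le_rfl
  rw [huv (by rw [hcl]; exact right_mem_Icc.2 hℓ.le),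
    norm_sq_sub_norm_sq_of_isWeakDerivOn isOpen_Ioo ordConnected_Ioo (nonempty_Ioo.2 hℓ) hu huf h
      hℓ.le subset_rfl hcl.ge, re_inner_Lp, intervalIntegral.integral_of_le hℓ.le,
    integral_Ioc_eq_integral_Ioo]

/-- On an incoming edge only the value at `0` enters; dropping `‖ψ(N)‖² ≥ 0` at the far end gives
the inequality that is needed. -/
theorem re_inner_of_isWeakDerivOn_Ioi {f g : Lp F 2 (volume.restrict (Ioi (0 : ℝ)))}
    (h : IsWeakDerivOn (Ioi 0) f g) {x : F} (hx : IsTraceAt (Ioi 0) f 0 x) :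
    -‖x‖ ^ 2 ≤ 2 * (⟪f, g⟫_ℂ).re := by
  obtain ⟨u, hu, huf, rfl⟩ := hx
  have hlim := (intervalIntegral_tendsto_integral_Ioi 0 (integrable_re_inner f g)
    tendsto_id).const_mul 2
  rw [re_inner_Lp]
  refine ge_of_tendsto hlim ?_
  filter_upwards [eventually_ge_atTop 0] with N hN
  have := norm_sq_sub_norm_sq_of_isWeakDerivOn isOpen_Ioi ordConnected_Ioi nonempty_Ioi hu huf h hN
    Ioo_subset_Ioi_self (by rw [closure_Ioi]; exact Icc_subset_Ici_self)
  simp only [id]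
  rw [← this]
  nlinarith [sq_nonneg ‖u N‖]

/-- On an outgoing edge the far end enters with the unfavourable sign, so the argument uses that
`‖ψ(t)‖² → 0` as `t → -∞`. -/
theorem re_inner_of_isWeakDerivOn_Iio {f g : Lp F 2 (volume.restrict (Iio (0 : ℝ)))}
    (h : IsWeakDerivOn (Iio 0) f g) {y : F} (hy : IsTraceAt (Iio 0) f 0 y) :
    ‖y‖ ^ 2 ≤ 2 * (⟪f, g⟫_ℂ).re := by
  obtain ⟨u, hu, huf, rfl⟩ := hy
  have hint : IntegrableOn (fun t => (⟪f t, g t⟫_ℂ).re) (Iic 0) := by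
    rw [integrableOn_Iic_iff_integrableOn_Iio]
    exact integrable_re_inner f g
  have hlim := (intervalIntegral_tendsto_integral_Iic 0 hint tendsto_id).const_mul 2
  rw [re_inner_Lp, ← integral_Iic_eq_integral_Iio]
  have hlim' : Tendsto (fun t => ‖u t‖ ^ 2) atBot
      (𝓝 (‖u 0‖ ^ 2 - 2 * ∫ t in Iic 0, (⟪f t, g t⟫_ℂ).re)) := by
    refine (hlim.const_sub (‖u 0‖ ^ 2)).congr' ?_
    filter_upwards [eventually_le_atBot 0] with t ht
    have := norm_sq_sub_norm_sq_of_isWeakDerivOn isOpen_Iio ordConnected_Iio nonempty_Iio hu huf h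
      ht Ioo_subset_Iio_self (by rw [closure_Iio]; exact Icc_subset_Iic_self)
    simp only [id]
    rw [← this]
    ring
  -- a positive limit of `‖u‖²` at `-∞` contradicts square integrability
  by_contra hcon
  rw [not_le] at hcon
  set l := ‖u 0‖ ^ 2 - 2 * ∫ t in Iic 0, (⟪f t, g t⟫_ℂ).re with hl
  have hl0 : 0 < l := by linarith
  obtain ⟨T, hT⟩ := eventually_atBot.1 (hlim'.eventually (lt_mem_nhds (half_lt_self hl0)))
  have husq : IntegrableOn (fun t => ‖u t‖ ^ 2) (Iio 0) :=
    ((memLp_two_iff_integrable_sq_norm ((Lp.aestronglyMeasurable f).congr huf.symm)).1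
      ((Lp.memLp f).ae_eq huf.symm))
  have hconst : IntegrableOn (fun _ : ℝ => l / 2) (Iio (min T 0)) := by
    refine Integrable.mono' (husq.mono_set (Iio_subset_Iio (min_le_right T 0)))
      aestronglyMeasurable_const ?_
    filter_upwards [ae_restrict_mem measurableSet_Iio] with t ht
    rw [Real.norm_of_nonneg (by linarith)]
    exact (hT t (le_of_lt (lt_of_lt_of_le ht (min_le_left _ _)))).le
  rw [integrableOn_const_iff] at hconst
  rcases hconst with h0 | h0
  · rw [enorm_eq_zero] at h0
    linarith
  · simp at h0

end EdgeEnergy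

section Graph

variable {V I Em Ep : Type*} [Fintype I] [Fintype Em] [Fintype Ep] {G : MetricGraph V I Em Ep}
  {X : Edge I Em Ep → Type*} [∀ j, NormedAddCommGroup (X j)] [∀ j, InnerProductSpace ℂ (X j)]

open scoped InnerProductSpace

theorem BoundarySpace.norm_sq_eq {I Em Ep : Type*} [Fintype I] [Fintype Em]
    {X : Edge I Em Ep → Type*} [∀ j, NormedAddCommGroup (X j)] (x : BoundarySpace X) :
    ‖x‖ ^ 2 = (∑ i, ‖x.fst i‖ ^ 2) + ∑ e, ‖x.snd e‖ ^ 2 := by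
  rw [WithLp.prod_norm_sq_eq_of_L2, PiLp.norm_sq_eq_of_L2, PiLp.norm_sq_eq_of_L2]

variable [∀ j, CompleteSpace (X j)]
  {q : Em ≃ Ep} {U : ∀ e : Em, X (Edge.outgoing (q e)) ≃ₗᵢ[ℂ] X (Edge.incoming e)}

/-- Integration by parts on the graph: the boundary form of `D_t` is `‖ψ₊‖² - ‖ψ₋‖²`. Only the
inequality is needed. -/
theorem norm_sq_sub_norm_sq_le_re_inner {ψ g : L2 G X} (h : IsDeriv G ψ g)
    {x y : BoundarySpace X} (hy : IsTerminalValue G q U ψ y) (hx : IsInitialValue G ψ x) :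
    ‖y‖ ^ 2 - ‖x‖ ^ 2 ≤ 2 * (⟪ψ, g⟫_ℂ).re := by
  have e : (⟪ψ, g⟫_ℂ).re = ∑ j, (⟪ψ j, g j⟫_ℂ).re := by
    rw [PiLp.inner_apply, Complex.re_sum]
  rw [e, BoundarySpace.norm_sq_eq, BoundarySpace.norm_sq_eq, Fintype.sum_sum_type,
    Fintype.sum_sum_type, ← Equiv.sum_comp q, mul_add, mul_add, Finset.mul_sum, Finset.mul_sum,
    Finset.mul_sum]
  have h1 : ∑ i, 2 * (⟪ψ (Edge.internal i), g (Edge.internal i)⟫_ℂ).re =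
      ∑ i, (‖y.fst i‖ ^ 2 - ‖x.fst i‖ ^ 2) :=
    Finset.sum_congr rfl fun i _ =>
      re_inner_of_isWeakDerivOn_Ioo (G.length_pos i) (h (Edge.internal i)) (hx.1 i) (hy.1 i)
  have h2 : ∑ e, -‖x.snd e‖ ^ 2 ≤
      ∑ e, 2 * (⟪ψ (Edge.incoming e), g (Edge.incoming e)⟫_ℂ).re :=
    Finset.sum_le_sum fun e _ =>
      re_inner_of_isWeakDerivOn_Ioi (h (Edge.incoming e)) (hx.2 e)
  have h3 : ∑ e, ‖y.snd e‖ ^ 2 ≤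
      ∑ e, 2 * (⟪ψ (Edge.outgoing (q e)), g (Edge.outgoing (q e))⟫_ℂ).re := by
    refine Finset.sum_le_sum fun e _ => ?_
    rw [← (U e).symm.norm_map (y.snd e)]
    exact re_inner_of_isWeakDerivOn_Iio (h (Edge.outgoing (q e))) (hy.2 e)
  rw [Finset.sum_sub_distrib] at h1
  rw [Finset.sum_neg_distrib] at h2
  linarith

theorem mem_domain_dt {B : BoundarySpace X →L[ℂ] BoundarySpace X} (ψ : (dt G q U B).domain) :
    IsDeriv G (ψ : L2 G X) (dt G q U B ψ) ∧ ∃ y x : BoundarySpace X,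
      IsTerminalValue G q U (ψ : L2 G X) y ∧ IsInitialValue G (ψ : L2 G X) x ∧ x = B y := by
  have h : ((ψ : L2 G X), dt G q U B ψ) ∈ dtGraph G q U (boundaryCondition B) := by
    rw [← graph_dtOf]
    exact (dt G q U B).mem_graph ψ
  obtain ⟨h1, y, x, hy, hx, hM⟩ := h
  exact ⟨h1, y, x, hy, hx, sub_eq_zero.1 hM⟩

theorem exists_domain_dt {B : BoundarySpace X →L[ℂ] BoundarySpace X} {ψ g : L2 G X}
    (h : IsDeriv G ψ g) {x y : BoundarySpace X} (hy : IsTerminalValue G q U ψ y)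
    (hx : IsInitialValue G ψ x) (hB : x = B y) :
    ∃ φ : (dt G q U B).domain, (φ : L2 G X) = ψ ∧ dt G q U B φ = g := by
  have hmem : (ψ, g) ∈ (dt G q U B).graph := by
    rw [dt, graph_dtOf]
    exact ⟨h, y, x, hy, hx, sub_eq_zero.2 hB⟩
  obtain ⟨φ, h1, h2⟩ := (LinearPMap.mem_graph_iff _).1 hmem
  exact ⟨φ, h1, h2⟩

end Graph

end TimeGraph

/-! ### m-accretivity of `D_t(B)` for contractions `B` -/

namespace TimeGraph

open Filter Topology

section Surjectivity

variable {V I Em Ep : Type*} (G : MetricGraph V I Em Ep)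
  {X : Edge I Em Ep → Type*} [∀ j, NormedAddCommGroup (X j)]

theorem MetricGraph.nonempty_interval (j : Edge I Em Ep) : (G.interval j).Nonempty := by
  rcases j with i | e | e
  · exact nonempty_Ioo.2 (G.length_pos i)
  · exact nonempty_Ioi
  · exact nonempty_Iio

theorem memLp_exp_neg_smul_const {F : Type*} [NormedAddCommGroup F] [NormedSpace ℝ F] (c : F)
    {s : Set ℝ} (hs : s ⊆ Ioi 0) :
    MemLp (fun t => Real.exp (-t) • c) 2 (volume.restrict s) := by
  have h1 : MemLp (fun t : ℝ => Real.exp (-t)) 2 (volume.restrict s) := by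
    rw [memLp_two_iff_integrable_sq (by fun_prop)]
    have : IntegrableOn (fun t : ℝ => Real.exp (-2 * t)) (Ioi 0) :=
      integrableOn_exp_mul_Ioi (by norm_num) 0
    refine (this.mono_set hs).congr (ae_of_all _ fun t => ?_)
    simp only
    rw [← Real.exp_nat_mul]
    norm_num
  exact (ContinuousLinearMap.toSpanSingleton ℝ c).comp_memLp' h1

theorem memLp_extension {G : MetricGraph V I Em Ep} (g : L2 G X) (j : Edge I Em Ep) :
    MemLp ((G.interval j).indicator (g j)) 2 volume :=
  memLp_indicator (G.isOpen_interval j).measurableSet (Lp.memLp (g j))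

variable [∀ j, InnerProductSpace ℂ (X j)]

/-- The edgewise solution of `ψ + ψ' = g` with coefficient `c j` of the homogeneous solution
`e^{-t}`; the function is defined on the whole real line, with `g` extended by zero. -/
noncomputable def edgeSolution (g : L2 G X) (c : ∀ j, X j) (j : Edge I Em Ep) (t : ℝ) : X j :=
  expConv ((G.interval j).indicator (g j)) t + Real.exp (-t) • c j

variable {G}

theorem continuous_edgeSolution (g : L2 G X) (c : ∀ j, X j) (j : Edge I Em Ep) :
    Continuous (edgeSolution G g c j) := by
  have h1 := continuous_expConv (memLp_extension g j)
  have h2 : Continuous fun t : ℝ => Real.exp (-t) • c j := by fun_prop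
  exact h1.add h2

/-- The coefficients of the homogeneous solutions: on outgoing edges only `0` gives a square
integrable function. -/
def coefficients (x : BoundarySpace X) : ∀ j, X j
  | Sum.inl i => x.fst i
  | Sum.inr (Sum.inl e) => x.snd e
  | Sum.inr (Sum.inr _) => 0

theorem memLp_homogeneous (x : BoundarySpace X) (j : Edge I Em Ep) :
    MemLp (fun t => Real.exp (-t) • coefficients x j) 2 (volume.restrict (G.interval j)) := by
  rcases j with i | e | e
  · exact memLp_exp_neg_smul_const _ Ioo_subset_Ioi_self
  · exact memLp_exp_neg_smul_const _ subset_rfl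
  · simp [coefficients]

theorem memLp_edgeSolution (g : L2 G X) (x : BoundarySpace X) (j : Edge I Em Ep) :
    MemLp (edgeSolution G g (coefficients x) j) 2 (volume.restrict (G.interval j)) :=
  ((memLp_expConv (memLp_extension g j)).restrict _).add (memLp_homogeneous x j)

theorem expConv_extension_zero (g : L2 G X) {j : Edge I Em Ep} (hj : G.interval j ⊆ Ioi 0) :
    expConv ((G.interval j).indicator (g j)) 0 = 0 :=
  expConv_eq_zero fun _ hs => indicator_of_notMem (fun h => not_lt.2 hs (hj h)) _

/-- The solution of `ψ + ψ' = g` with initial values `x`. -/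
noncomputable def solution (g : L2 G X) (x : BoundarySpace X) : L2 G X :=
  WithLp.toLp 2 fun j => (memLp_edgeSolution g x j).toLp

theorem coeFn_solution (g : L2 G X) (x : BoundarySpace X) (j : Edge I Em Ep) :
    solution g x j =ᵐ[volume.restrict (G.interval j)] edgeSolution G g (coefficients x) j :=
  MemLp.coeFn_toLp (memLp_edgeSolution g x j)

theorem isTraceAt_solution (g : L2 G X) (x : BoundarySpace X) (j : Edge I Em Ep) (t : ℝ) :
    IsTraceAt (G.interval j) (solution g x j) t (edgeSolution G g (coefficients x) j t) :=
  ⟨_, (continuous_edgeSolution g _ j).continuousOn, (coeFn_solution g x j).symm, rfl⟩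

theorem isInitialValue_solution (g : L2 G X) (x : BoundarySpace X) :
    IsInitialValue G (solution g x) x := by
  constructor
  · intro i
    have h := isTraceAt_solution g x (Edge.internal i) 0
    have h0 : edgeSolution G g (coefficients x) (Edge.internal i) 0 = x.fst i := by
      rw [edgeSolution, expConv_extension_zero (j := Edge.internal i) g Ioo_subset_Ioi_self]
      simp [coefficients]
    rwa [h0] at h
  · intro e
    have h := isTraceAt_solution g x (Edge.incoming e) 0
    have h0 : edgeSolution G g (coefficients x) (Edge.incoming e) 0 = x.snd e := by
      rw [edgeSolution, expConv_extension_zero (j := Edge.incoming e) g subset_rfl]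
      simp [coefficients]
    rwa [h0] at h

/-- The terminal values of the solution of `ψ + ψ' = g` with initial values `x`. -/
noncomputable def terminalValue (q : Em ≃ Ep)
    (U : ∀ e : Em, X (Edge.outgoing (q e)) ≃ₗᵢ[ℂ] X (Edge.incoming e))
    (g : L2 G X) (x : BoundarySpace X) : BoundarySpace X :=
  WithLp.toLp 2 (WithLp.toLp 2 fun i =>
      edgeSolution G g (coefficients x) (Edge.internal i) (G.length i),
    WithLp.toLp 2 fun e => U e (edgeSolution G g (coefficients x) (Edge.outgoing (q e)) 0))

theorem isTerminalValue_solution (q : Em ≃ Ep)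
    (U : ∀ e : Em, X (Edge.outgoing (q e)) ≃ₗᵢ[ℂ] X (Edge.incoming e))
    (g : L2 G X) (x : BoundarySpace X) :
    IsTerminalValue G q U (solution g x) (terminalValue q U g x) := by
  refine ⟨fun i => isTraceAt_solution g x _ _, fun e => ?_⟩
  have h := isTraceAt_solution g x (Edge.outgoing (q e)) 0
  have h0 : (U e).symm ((terminalValue q U g x).snd e) =
      edgeSolution G g (coefficients x) (Edge.outgoing (q e)) 0 :=
    (U e).symm_apply_apply _
  rwa [h0]

theorem isDeriv_solution [∀ j, CompleteSpace (X j)] (g : L2 G X) (x : BoundarySpace X) :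
    IsDeriv G (solution g x) (g - solution g x) := by
  intro j
  have hms := (G.isOpen_interval j).measurableSet
  have hext := memLp_extension g j
  have hadd := isWeakDerivOn_add ((memLp_expConv hext).restrict (G.interval j))
    (memLp_homogeneous x j) ((hext.sub (memLp_expConv hext)).restrict (G.interval j))
    (memLp_homogeneous x j).neg (isWeakDerivOn_expConv hext (G.interval j))
    (isWeakDerivOn_exp_neg_smul_const (coefficients x j) (G.interval j))
  refine hadd.congr (coeFn_solution g x j) ?_
  have hsub : (g - solution g x) j = g j - solution g x j := rfl
  rw [hsub]
  filter_upwards [Lp.coeFn_sub (g j) (solution g x j), coeFn_solution g x j,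
    indicator_ae_eq_restrict (f := g j) hms] with t h1 h2 h3
  rw [h1, Pi.sub_apply, h2, ← h3]
  simp only [edgeSolution, Pi.add_apply, Pi.sub_apply, Pi.neg_apply]
  abel

variable [Fintype I] [Fintype Em]

/-- The initial values reach the terminal vertices of internal edges damped by `e^{-a_i}`, and do
not reach those of the external edges at all. -/
theorem dist_terminalValue_le (q : Em ≃ Ep)
    (U : ∀ e : Em, X (Edge.outgoing (q e)) ≃ₗᵢ[ℂ] X (Edge.incoming e)) (g : L2 G X) {κ : ℝ}
    (hκ0 : 0 ≤ κ) (hκ : ∀ i, Real.exp (-G.length i) ≤ κ) (x y : BoundarySpace X) :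
    ‖terminalValue q U g x - terminalValue q U g y‖ ≤ κ * ‖x - y‖ := by
  refine le_of_sq_le_sq ?_ (by positivity)
  rw [mul_pow, BoundarySpace.norm_sq_eq, BoundarySpace.norm_sq_eq]
  have h1 : ∀ i, (terminalValue q U g x - terminalValue q U g y).fst i =
      Real.exp (-G.length i) • (x - y).fst i := by
    intro i
    change edgeSolution G g (coefficients x) (Edge.internal i) (G.length i) -
      edgeSolution G g (coefficients y) (Edge.internal i) (G.length i) = _
    rw [edgeSolution, edgeSolution, add_sub_add_left_eq_sub, ← smul_sub]
    rfl
  have h2 : ∀ e, (terminalValue q U g x - terminalValue q U g y).snd e = 0 := by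
    intro e
    exact sub_self _
  simp_rw [h1, h2, norm_smul]
  rw [mul_add, Finset.mul_sum]
  refine add_le_add (Finset.sum_le_sum fun i _ => ?_) ?_
  · rw [mul_pow, Real.norm_of_nonneg (Real.exp_pos _).le]
    gcongr
    exact hκ i
  · simp only [norm_zero, ne_eq, OfNat.ofNat_ne_zero, not_false_eq_true, zero_pow,
      Finset.sum_const_zero]
    positivity

variable [Fintype Ep] [∀ j, CompleteSpace (X j)]

/-- Accretivity is `‖B ψ₊‖ ≤ ‖ψ₊‖` in the boundary form. For surjectivity of `1 + D_t(B)`, the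
initial values of the solution of `ψ + ψ' = g` are found as the fixed point of a contraction. -/
theorem isMAccretive_dt (q : Em ≃ Ep)
    (U : ∀ e : Em, X (Edge.outgoing (q e)) ≃ₗᵢ[ℂ] X (Edge.incoming e))
    (B : BoundarySpace X →L[ℂ] BoundarySpace X) (hB : ‖B‖ ≤ 1) : IsMAccretive (dt G q U B) := by
  constructor
  · intro ψ
    obtain ⟨h, y, x, hy, hx, rfl⟩ := mem_domain_dt ψ
    have h1 := norm_sq_sub_norm_sq_le_re_inner h hy hx
    have h2 : ‖B y‖ ^ 2 ≤ ‖y‖ ^ 2 := by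
      gcongr
      exact (B.le_of_opNorm_le hB y).trans_eq (one_mul _)
    linarith
  · intro g
    obtain ⟨κ, hκ0, hκ1, hκ⟩ : ∃ κ : ℝ, 0 ≤ κ ∧ κ < 1 ∧ ∀ i, Real.exp (-G.length i) ≤ κ := by
      rcases isEmpty_or_nonempty I with hI | hI
      · exact ⟨0, le_rfl, one_pos, fun i => hI.elim i⟩
      · obtain ⟨i₀, hi₀⟩ := Finite.exists_min G.length
        exact ⟨Real.exp (-G.length i₀), (Real.exp_pos _).le,
          Real.exp_lt_one_iff.2 (neg_neg_of_pos (G.length_pos i₀)),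
          fun i => Real.exp_le_exp.2 (neg_le_neg (hi₀ i))⟩
    -- the boundary condition is a fixed point equation for the initial values
    have hcontr : ContractingWith ⟨κ, hκ0⟩ fun x => B (terminalValue q U g x) := by
      refine ⟨hκ1, LipschitzWith.of_dist_le_mul fun x y => ?_⟩
      rw [dist_eq_norm, dist_eq_norm, ← map_sub]
      refine (B.le_of_opNorm_le hB _).trans ?_
      rw [one_mul]
      exact dist_terminalValue_le q U g hκ0 hκ x y
    have hfix := hcontr.fixedPoint_isFixedPt
    set x := ContractingWith.fixedPoint _ hcontr
    obtain ⟨φ, hφ, hφ'⟩ := exists_domain_dt (isDeriv_solution g x)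
      (isTerminalValue_solution q U g x) (isInitialValue_solution g x) hfix.symm
    exact ⟨φ, by rw [hφ, hφ', add_sub_cancel]⟩

end Surjectivity

end TimeGraph

/-! ### The lower bound for the angle -/

namespace TimeGraph

open Filter Topology

section LowerBound

variable {V I Em Ep : Type*} {G : MetricGraph V I Em Ep}
  {X : Edge I Em Ep → Type*} [∀ j, NormedAddCommGroup (X j)]

/-- A continuous function with compact support, as a square integrable function on an interval. -/
theorem memLp_restrict_of_hasCompactSupport {F : Type*} [NormedAddCommGroup F] {w : ℝ → F}
    (hw : Continuous w) (hc : HasCompactSupport w) (s : Set ℝ) :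
    MemLp w 2 (volume.restrict s) :=
  (hw.memLp_of_hasCompactSupport hc).restrict s

open Classical in
/-- The function on the graph that equals `w` on the edge `j` and vanishes on all other edges. -/
noncomputable def edgeFunction (G : MetricGraph V I Em Ep) (j : Edge I Em Ep) (w : ℝ → X j)
    (hw : MemLp w 2 (volume.restrict (G.interval j))) : L2 G X :=
  PiLp.single 2 j hw.toLp

open Classical in
theorem norm_edgeFunction [Fintype I] [Fintype Em] [Fintype Ep] (j : Edge I Em Ep) (w : ℝ → X j)
    (hw : MemLp w 2 (volume.restrict (G.interval j))) :
    ‖edgeFunction G j w hw‖ = ‖hw.toLp‖ :=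
  PiLp.norm_single 2 _ _ _

theorem edgeFunction_same (j : Edge I Em Ep) (w : ℝ → X j)
    (hw : MemLp w 2 (volume.restrict (G.interval j))) :
    edgeFunction G j w hw j = hw.toLp := by
  simp [edgeFunction]

theorem edgeFunction_of_ne {j k : Edge I Em Ep} (hk : k ≠ j) (w : ℝ → X j)
    (hw : MemLp w 2 (volume.restrict (G.interval j))) :
    edgeFunction G j w hw k = 0 := by
  simp [edgeFunction, hk]

theorem isTraceAt_edgeFunction {j : Edge I Em Ep} {w : ℝ → X j}
    (hw : Continuous w) (hc : HasCompactSupport w) (hs : tsupport w ⊆ G.interval j)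
    (k : Edge I Em Ep) {t : ℝ} (ht : t ∉ G.interval k) :
    IsTraceAt (G.interval k)
      (edgeFunction G j w (memLp_restrict_of_hasCompactSupport hw hc _) k) t 0 := by
  rcases eq_or_ne k j with rfl | hk
  · rw [edgeFunction_same]
    exact ⟨w, hw.continuousOn, (MemLp.coeFn_toLp _).symm,
      image_eq_zero_of_notMem_tsupport fun h => ht (hs h)⟩
  · rw [edgeFunction_of_ne hk]
    exact ⟨0, continuousOn_const, (Lp.coeFn_zero _ _ _).symm, rfl⟩

variable [∀ j, InnerProductSpace ℂ (X j)]

theorem isDeriv_edgeFunction [∀ j, CompleteSpace (X j)] {j : Edge I Em Ep} {w : ℝ → X j}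
    (hw : ContDiff ℝ 1 w) (hc : HasCompactSupport w) :
    IsDeriv G (edgeFunction G j w (memLp_restrict_of_hasCompactSupport hw.continuous hc _))
      (edgeFunction G j (deriv w) (memLp_restrict_of_hasCompactSupport
        (hw.continuous_deriv (by simp)) hc.deriv _)) := by
  have hd := hw.continuous_deriv (by simp)
  intro k
  rcases eq_or_ne k j with rfl | hk
  · rw [edgeFunction_same, edgeFunction_same]
    refine (isWeakDerivOn_of_primitive (G := w) (fun a b => hd.intervalIntegrable a b)
      (fun a b => ?_) (G.interval k)).congr (MemLp.coeFn_toLp _) (MemLp.coeFn_toLp _)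
    rw [intervalIntegral.integral_eq_sub_of_hasDerivAt
      (fun t _ => (hw.differentiable (by simp) t).hasDerivAt) (hd.intervalIntegrable a b)]
  · rw [edgeFunction_of_ne hk, edgeFunction_of_ne hk]
    exact IsWeakDerivOn.congr (f := 0) (g := 0) (fun φ _ _ _ => by simp) (Lp.coeFn_zero _ _ _)
      (Lp.coeFn_zero _ _ _)

theorem norm_edgeFunction_exp_smul [Fintype I] [Fintype Em] [Fintype Ep] {j : Edge I Em Ep}
    {w : ℝ → X j} {τ : ℝ} (hw : MemLp w 2 (volume.restrict (G.interval j)))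
    (hw' : MemLp (fun t => Complex.exp ((τ * t : ℝ) * Complex.I) • w t) 2
      (volume.restrict (G.interval j))) :
    ‖edgeFunction G j _ hw'‖ = ‖edgeFunction G j w hw‖ := by
  rw [norm_edgeFunction, norm_edgeFunction, Lp.norm_toLp, Lp.norm_toLp]
  congr 1
  refine eLpNorm_congr_norm_ae (ae_of_all _ fun t => ?_)
  rw [norm_smul, Complex.norm_exp_ofReal_mul_I, one_mul]

theorem mul_I_notMem_closure_sector {α τ : ℝ} (hα : 0 < α) (hα' : α < Real.pi / 2) (hτ : 0 < τ) :
    (τ : ℂ) * Complex.I ∉ closure (sector α) := by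
  have hclosed : IsClosed {z : ℂ | ‖z‖ * Real.cos α ≤ z.re} :=
    isClosed_le (by fun_prop) Complex.continuous_re
  have hsub : sector α ⊆ {z : ℂ | ‖z‖ * Real.cos α ≤ z.re} := by
    rintro z ⟨-, hz⟩
    rw [Set.mem_ofPred_eq, ← Complex.norm_mul_cos_arg z, ← Real.cos_abs z.arg]
    gcongr
    exact Real.cos_le_cos_of_nonneg_of_le_pi (abs_nonneg _) (by linarith [Real.pi_pos]) hz.le
  intro h
  have h1 := closure_minimal hsub hclosed h
  have hcos : 0 < Real.cos α := Real.cos_pos_of_mem_Ioo ⟨by linarith, hα'⟩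
  simp only [Set.mem_ofPred_eq, norm_mul, Complex.norm_real, Complex.norm_I, mul_one,
    Complex.re_ofReal_mul, Complex.I_re, mul_zero, Real.norm_of_nonneg hτ.le] at h1
  nlinarith

variable [Fintype I] [Fintype Em] [Fintype Ep] [∀ j, CompleteSpace (X j)]

/-- The functions `e^{iτt} χ(t) x`, supported inside one edge, lie in the domain for all boundary
conditions and `(iτ - D_t(B)) (e^{iτt} χ x) = -e^{iτt} χ' x` stays bounded as `τ → ∞`. So
`τ ‖(iτ - D_t(B))⁻¹‖` is unbounded, and the sectoriality angle is at least `π / 2`. -/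
theorem pi_div_two_le_of_isSectorial_dt (hX : ∃ j, Nontrivial (X j)) {q : Em ≃ Ep}
    {U : ∀ e : Em, X (Edge.outgoing (q e)) ≃ₗᵢ[ℂ] X (Edge.incoming e)}
    {B : BoundarySpace X →L[ℂ] BoundarySpace X} {α : ℝ} (hA : IsSectorial (dt G q U B) α) :
    Real.pi / 2 ≤ α := by
  by_contra hα
  rw [not_le] at hα
  obtain ⟨j, hj⟩ := hX
  obtain ⟨x, hx⟩ := exists_ne (0 : X j)
  obtain ⟨t₀, ht₀⟩ := G.nonempty_interval j
  obtain ⟨r, hr0, hr⟩ := Metric.isOpen_iff.1 (G.isOpen_interval j) t₀ ht₀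
  let χ : ContDiffBump t₀ := ⟨r / 4, r / 2, by linarith, by linarith⟩
  have hχs : tsupport χ ⊆ G.interval j := by
    rw [χ.tsupport_eq]
    exact (Metric.closedBall_subset_ball (by change r / 2 < r; linarith)).trans hr
  have hχ : ContDiff ℝ 1 χ := χ.contDiff
  have hχc : HasCompactSupport χ := χ.hasCompactSupport
  have hχd : Continuous (deriv χ) := hχ.continuous_deriv (by simp)
  set v : ℝ → X j := fun t => χ t • x with hv
  set v' : ℝ → X j := fun t => deriv χ t • x with hv'
  have hvm : MemLp v 2 (volume.restrict (G.interval j)) :=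
    memLp_restrict_of_hasCompactSupport (by fun_prop) hχc.smul_right _
  have hvm' : MemLp v' 2 (volume.restrict (G.interval j)) :=
    memLp_restrict_of_hasCompactSupport (by fun_prop) hχc.deriv.smul_right _
  have hpos : 0 < ‖edgeFunction G j v hvm‖ := by
    rw [norm_edgeFunction, norm_pos_iff, Ne, Lp.eq_zero_iff_ae_eq_zero]
    intro h0
    have h1 := (MemLp.coeFn_toLp hvm).symm.trans h0
    have h2 := Measure.eqOn_open_of_ae_eq h1 (G.isOpen_interval j)
      (by fun_prop : Continuous v).continuousOn continuousOn_const ht₀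
    simp only [hv, Pi.zero_apply, smul_eq_zero] at h2
    rcases h2 with h2 | h2
    · have : χ t₀ = 1 := χ.one_of_mem_closedBall (by simp [χ.rIn_pos.le])
      rw [this] at h2
      exact one_ne_zero h2
    · exact hx h2
  obtain ⟨M, hM⟩ := hA.bounded (Real.pi / 2) hα (by linarith [Real.pi_pos])
  have key : ∀ τ : ℝ, 0 < τ →
      τ * ‖edgeFunction G j v hvm‖ ≤ M * ‖edgeFunction G j v' hvm'‖ := by
    intro τ hτ
    set z : ℂ := τ * Complex.I with hz
    have hz0 : z ≠ 0 := mul_ne_zero (by exact_mod_cast hτ.ne') Complex.I_ne_zero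
    have harg : |z.arg| = Real.pi / 2 := by
      rw [hz, Complex.arg_real_mul _ hτ, Complex.arg_I, abs_of_pos (by positivity)]
    have hres : z ∈ resolventSet (dt G q U B) := by
      by_contra h
      exact mul_I_notMem_closure_sector hA.pos hα hτ (hA.spectrum_subset h)
    have hR := isResolventAt_resolvent hres
    set R := resolvent (dt G q U B) z
    have hRM : τ * ‖R‖ ≤ M := by
      have := hM z hz0 harg.ge
      rwa [norm_smul, hz, norm_mul, Complex.norm_real, Complex.norm_I, mul_one,
        Real.norm_of_nonneg hτ.le] at this
    have he : ContDiff ℝ 1 fun t : ℝ => Complex.exp ((τ * t : ℝ) * Complex.I) := by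
      have : ContDiff ℝ 1 fun t : ℝ => (((τ * t : ℝ) : ℂ)) * Complex.I :=
        (Complex.ofRealCLM.contDiff.comp (contDiff_const.mul contDiff_id)).mul contDiff_const
      exact this.cexp
    set w : ℝ → X j := fun t => Complex.exp ((τ * t : ℝ) * Complex.I) • v t with hw
    have hvC : ContDiff ℝ 1 v := hχ.smul contDiff_const
    have hwC : ContDiff ℝ 1 w := he.smul hvC
    have hwc : HasCompactSupport w := (hχc.smul_right : HasCompactSupport v).smul_left
    have hws : tsupport w ⊆ G.interval j := by
      refine (closure_mono fun t ht => ?_).trans hχs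
      intro h0
      exact ht (by simp [hw, hv, h0])
    have hwd : ∀ t, deriv w t = z • w t + Complex.exp ((τ * t : ℝ) * Complex.I) • v' t := by
      intro t
      have h1 : HasDerivAt (fun t : ℝ => Complex.exp ((τ * t : ℝ) * Complex.I))
          (Complex.exp ((τ * t : ℝ) * Complex.I) * z) t := by
        have h2 : HasDerivAt (fun t : ℝ => (((τ * t : ℝ) : ℂ)) * Complex.I) z t := by
          have := (((hasDerivAt_id' t).const_mul τ).ofReal_comp).mul_const Complex.I
          simpa [hz] using this
        exact h2.cexp
      have h3 : HasDerivAt v (v' t) t :=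
        ((hχ.differentiable (by simp) t).hasDerivAt).smul_const x
      have h4 : HasDerivAt w (Complex.exp ((τ * t : ℝ) * Complex.I) • v' t +
          (Complex.exp ((τ * t : ℝ) * Complex.I) * z) • v t) t := h1.smul h3
      rw [h4.deriv, hw]
      simp only
      rw [smul_smul, mul_comm z, add_comm]
    have hwm := memLp_restrict_of_hasCompactSupport hwC.continuous hwc (G.interval j)
    have hwm' : MemLp (fun t => Complex.exp ((τ * t : ℝ) * Complex.I) • v' t) 2
        (volume.restrict (G.interval j)) :=
      memLp_restrict_of_hasCompactSupport (he.continuous.smul (by fun_prop))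
        (hχc.deriv.smul_right : HasCompactSupport v').smul_left _
    obtain ⟨φ, hφ, hφ'⟩ := exists_domain_dt (q := q) (U := U) (B := B) (x := 0) (y := 0)
      (isDeriv_edgeFunction (G := G) hwC hwc)
      ⟨fun i => isTraceAt_edgeFunction hwC.continuous hwc hws _ (by simp [MetricGraph.interval]),
        fun e => by
          have := isTraceAt_edgeFunction hwC.continuous hwc hws (Edge.outgoing (q e)) (t := 0)
            (by simp [MetricGraph.interval])
          rw [← (U e).symm.map_zero] at this
          exact this⟩
      ⟨fun i => isTraceAt_edgeFunction hwC.continuous hwc hws _ (by simp [MetricGraph.interval]),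
        fun e => isTraceAt_edgeFunction hwC.continuous hwc hws _ (by simp [MetricGraph.interval])⟩
      (by simp)
    have h1 := hR.2 φ
    have h2 : z • (φ : L2 G X) - dt G q U B φ = -edgeFunction G j _ hwm' := by
      rw [hφ, hφ', sub_eq_iff_eq_add, eq_comm, neg_add_eq_iff_eq_add]
      refine PiLp.ext fun k => ?_
      rw [PiLp.add_apply, PiLp.smul_apply]
      rcases eq_or_ne k j with rfl | hk
      · rw [edgeFunction_same, edgeFunction_same, edgeFunction_same, ← MemLp.toLp_const_smul,
          ← MemLp.toLp_add]
        refine MemLp.toLp_congr _ _ (ae_of_all _ fun t => ?_)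
        rw [hwd, add_comm]
        rfl
      · rw [edgeFunction_of_ne hk, edgeFunction_of_ne hk, edgeFunction_of_ne hk, smul_zero,
          add_zero]
    rw [h2] at h1
    have h3 := R.le_opNorm (-edgeFunction G j _ hwm')
    rw [h1, hφ, norm_neg, norm_edgeFunction_exp_smul hvm hwm, norm_edgeFunction_exp_smul hvm' hwm'] at h3
    calc _ ≤ τ * (‖R‖ * ‖edgeFunction G j v' hvm'‖) := by gcongr
      _ = τ * ‖R‖ * ‖edgeFunction G j v' hvm'‖ := by ring
      _ ≤ _ := by gcongr
  have h1 : Tendsto (fun τ : ℝ => τ * ‖edgeFunction G j v hvm‖) atTop atTop :=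
    tendsto_id.atTop_mul_const hpos
  obtain ⟨τ, hτ, hτ0⟩ := ((h1.eventually_gt_atTop (M * ‖edgeFunction G j v' hvm'‖)).and
    (eventually_gt_atTop 0)).exists
  exact absurd (key τ hτ0) (not_le.2 hτ)

end LowerBound

end TimeGraph

theorem mainTheorem6 {V I Em Ep : Type*} [Finite V] [Fintype I] [Fintype Em] [Fintype Ep]
    (G : TimeGraph.MetricGraph V I Em Ep)
    (X : TimeGraph.Edge I Em Ep → Type*) [∀ j, NormedAddCommGroup (X j)]
    [∀ j, InnerProductSpace ℂ (X j)] [∀ j, CompleteSpace (X j)]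
    (hX : ∃ j, Nontrivial (X j))
    (q : Em ≃ Ep)
    (U : ∀ e : Em, X (TimeGraph.Edge.outgoing (q e)) ≃ₗᵢ[ℂ] X (TimeGraph.Edge.incoming e))
    (B : TimeGraph.BoundarySpace X →L[ℂ] TimeGraph.BoundarySpace X) (hB : ‖B‖ ≤ 1) :
    TimeGraph.HasBoundedHInftyCalculus (TimeGraph.dt G q U B) ∧
      TimeGraph.hInftyAngle (TimeGraph.dt G q U B) = Real.pi / 2 := by
  have hset : {θ : ℝ | TimeGraph.HasBoundedHInfty (TimeGraph.dt G q U B) θ} =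
      Ioo (Real.pi / 2) Real.pi := by
    ext θ
    constructor
    · rintro ⟨hθ, α, hα, hA, -⟩
      exact ⟨(TimeGraph.pi_div_two_le_of_isSectorial_dt hX hA).trans_lt hα, hθ⟩
    · rintro ⟨h1, h2⟩
      exact (TimeGraph.isMAccretive_dt q U B hB).hasBoundedHInfty h1 h2
  have hlt : Real.pi / 2 < Real.pi := by linarith [Real.pi_pos]
  refine ⟨?_, ?_⟩
  · obtain ⟨θ, hθ⟩ := nonempty_Ioo.2 hlt
    exact ⟨θ, hset.ge hθ⟩
  · rw [TimeGraph.hInftyAngle, hset, csInf_Ioo hlt]
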